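/- Work over $\mathbb{C}$. For a vector space $V=\mathbb{C}^{n+1}$ let $\mathbb{P}^n=\mathbb{P}(V)$ be the space of lines in $V$, with tautological sequence $0\to\mathcal{O}(-1)\to V\otimes\mathcal{O}\to\mathcal{Q}\to 0$. For a vector bundle $E$ on $X$ let $\mathbb{P}_X(E)\to X$ be the bundle of lines in $E$ (subspace convention). A property holds for a general section of a vector bundle if it holds for all sections in some nonempty Zariski open subset of the (finite-dimensional) space of global sections; $\mathscr{Z}(F)$ denotes the (scheme-theoretic) zero locus of a general global section of $F$. On $\mathbb{P}^3\times\mathbb{P}^{10}$ write $E(a,b)=\mathrm{pr}_1^*E(a)\otimes\mathrm{pr}_2^*\mathcal{O}(b)$ for a vector bundle $E$ on $\mathbb{P}^3$. Let $V=\mathbb{C}^4$. On $\mathbb{P}^3=\mathbb{P}(V)$ there are the canonical short exact sequences (dual to sequences of principal parts) $$0\to\mathcal{O}(-2)\to V\otimes\mathcal{O}(-1)\to\mathcal{Q}(-1)\to 0,\qquad 0\to V\otimes\mathcal{O}(-1)\to \mathrm{Sym}^2V\otimes\mathcal{O}\to\mathrm{Sym}^2\mathcal{Q}\to 0,$$ where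 the first is the twisted tautological sequence, the maps of the second are $v\otimes\ell\mapsto v\ell$ and the one induced by $V\otimes\mathcal{O}\to\mathcal{Q}$, and $\mathrm{Sym}^2V\otimes\mathcal{O}\cong\mathcal{O}^{\oplus 10}$. (1) These sequences, as first row and middle column, can be completed to a commutative diagram with exact rows and columns $$\begin{array}{ccccccccc}0&\to&\mathcal{O}(-2)&\to&V\otimes\mathcal{O}(-1)&\to&\mathcal{Q}(-1)&\to&0\\&&\|&&\downarrow&&\downarrow&&\\0&\to&\mathcal{O}(-2)&\to&\mathrm{Sym}^2V\otimes\mathcal{O}&\to&\Lambda&\to&0\\&&\downarrow&&\downarrow&&\downarrow&&\\&&0&\to&\mathrm{Sym}^2\mathcal{Q}&=&\mathrm{Sym}^2\mathcal{Q}&\to&0\end{array}$$ with a vector bundle $\Lambda$, and this completion is unique up to unique isomorphism (compatible with the three maps $\mathrm{Sym}^2V\otimes\mathcal{O}\to\Lambda$, $\mathcal{Q}(-1)\to\Lambda$, $\Lambda\to\mathrm{Sym}^2\mathcal{Q}$). (2) $\Lambda$ has rank $9$ and is homogeneous (it carries a lift of the action of the algebraic group $\mathrm{GL}(V)$ on $\mathbb{P}^3$),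 and the extension $0\to\mathcal{Q}(-1)\to\Lambda\to\mathrm{Sym}^2\mathcal{Q}\to 0$ does not split. (3) $\mathscr{Z}(\Lambda(0,1))\subset\mathbb{P}^3\times\mathbb{P}^{10}$ is isomorphic, over $\mathbb{P}^3$, to the projective bundle $\mathbb{P}_{\mathbb{P}^3}(\mathcal{O}(-2)\oplus\mathcal{O})$. (4) $\mathscr{Z}(\Lambda(0,1)\oplus\mathcal{O}(0,2))\subset\mathbb{P}^3\times\mathbb{P}^{10}$ is a Fano threefold of the family 1–12, i.e. a double cover of $\mathbb{P}^3$ branched along a smooth quartic surface: for some $f\in H^0(\mathbb{P}^3,\mathcal{O}(4))$ with $\{f=0\}$ smooth it is isomorphic, over $\mathbb{P}^3$, to the subscheme $y^2=f$ of the total space of $\mathcal{O}(2)$. Conversely, for every such $f$ this double cover is isomorphic, over $\mathbb{P}^3$, to the zero locus of some global section of $\Lambda(0,1)\oplus\mathcal{O}(0,2)$. -/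

import Mathlib

open CategoryTheory TensorProduct

namespace FanoBundles

set_option linter.style.haveILetI false

section Algebra

variable {R S T : Type} [CommRing R] [CommRing S] [CommRing T]
variable {M M' N N' : Type} [AddCommGroup M] [AddCommGroup M'] [AddCommGroup N] [AddCommGroup N']
variable [Module R M] [Module R M'] [Module S N] [Module S N']

/-- A `φ`-semilinear map `g : M → N` exhibits `N` as the base change `S ⊗[R] M`. -/
def IsBaseChangeAlong (φ : R →+* S) (g : M →ₛₗ[φ] N) : Prop :=
  letI := φ.toAlgebra
  ∃ e : S ⊗[R] M ≃ₗ[S] N, ∀ m, e (1 ⊗ₜ m) = g m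

theorem IsBaseChangeAlong.tensor {φ : R →+* S} {g : M →ₛₗ[φ] N} {g' : M' →ₛₗ[φ] N'}
    (h : IsBaseChangeAlong φ g) (h' : IsBaseChangeAlong φ g') :
    IsBaseChangeAlong φ (TensorProduct.map g g') := by
  letI := φ.toAlgebra
  obtain ⟨e, he⟩ := h
  obtain ⟨e', he'⟩ := h'
  refine ⟨AlgebraTensorModule.distribBaseChange R S M M' ≪≫ₗ TensorProduct.congr e e', fun m => ?_⟩
  induction m using TensorProduct.induction_on with
  | zero => simp
  | tmul x y => simp [he, he']
  | add x y hx hy => rw [tmul_add, map_add, map_add, hx, hy]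

/-- The direct sum of two semilinear maps. -/
def prodMapₛₗ {φ : R →+* S} (g : M →ₛₗ[φ] N) (g' : M' →ₛₗ[φ] N') : M × M' →ₛₗ[φ] N × N' where
  toFun x := (g x.1, g' x.2)
  map_add' x y := by simp
  map_smul' r x := by simp

theorem IsBaseChangeAlong.prod {φ : R →+* S} {g : M →ₛₗ[φ] N} {g' : M' →ₛₗ[φ] N'}
    (h : IsBaseChangeAlong φ g) (h' : IsBaseChangeAlong φ g') :
    IsBaseChangeAlong φ (prodMapₛₗ g g') := by
  letI := φ.toAlgebra
  obtain ⟨e, he⟩ := h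
  obtain ⟨e', he'⟩ := h'
  refine ⟨TensorProduct.prodRight R S S M M' ≪≫ₗ LinearEquiv.prodCongr e e', fun m => ?_⟩
  obtain ⟨x, y⟩ := m
  simp [he, he', prodMapₛₗ]

theorem IsBaseChangeAlong.span_range {φ : R →+* S} {g : M →ₛₗ[φ] N}
    (h : IsBaseChangeAlong φ g) : Submodule.span S (Set.range g) = ⊤ := by
  letI := φ.toAlgebra
  obtain ⟨e, he⟩ := h
  rw [eq_top_iff]
  rintro x -
  obtain ⟨y, rfl⟩ := e.surjective x
  induction y using TensorProduct.induction_on with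
  | zero => simp
  | tmul s m =>
    have : (s ⊗ₜ[R] m : S ⊗[R] M) = s • (1 ⊗ₜ m) := by simp [smul_tmul']
    rw [this, map_smul, he]
    exact Submodule.smul_mem _ _ (Submodule.subset_span ⟨m, rfl⟩)
  | add a b ha hb => rw [map_add]; exact add_mem ha hb

/-- The base change of a linear form along `g`: the unique `S`-linear form `f'` on `N` with
`f' (g m) = φ (f m)`. -/
noncomputable def dualMap {φ : R →+* S} {g : M →ₛₗ[φ] N} (h : IsBaseChangeAlong φ g) :
    Module.Dual R M →ₛₗ[φ] Module.Dual S N :=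
  letI := φ.toAlgebra
  { toFun f := (TensorProduct.AlgebraTensorModule.rid R S S).toLinearMap ∘ₗ
      (LinearMap.baseChange S f) ∘ₗ h.choose.symm.toLinearMap
    map_add' f f' := by
      ext x
      simp [LinearMap.baseChange_add]
    map_smul' r f := by
      ext x
      simp only [LinearMap.baseChange_smul, LinearMap.comp_apply, LinearMap.smul_apply,
        LinearEquiv.coe_coe]
      rw [← algebraMap_smul S r, map_smul]
      rfl }

theorem dualMap_apply {φ : R →+* S} {g : M →ₛₗ[φ] N} (h : IsBaseChangeAlong φ g)
    (f : Module.Dual R M) (m : M) : dualMap h f (g m) = φ (f m) := by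
  letI := φ.toAlgebra
  have : h.choose.symm (g m) = 1 ⊗ₜ m := by
    rw [LinearEquiv.symm_apply_eq]; exact (h.choose_spec m).symm
  simp only [dualMap, LinearMap.coe_mk, AddHom.coe_mk, LinearMap.comp_apply, LinearEquiv.coe_coe,
    this]
  simp [Algebra.smul_def]
  rfl

theorem dual_ext {φ : R →+* S} {g : M →ₛₗ[φ] N} (h : IsBaseChangeAlong φ g)
    {P : Type} [AddCommGroup P] [Module S P]
    {f f' : N →ₗ[S] P} (hf : ∀ m, f (g m) = f' (g m)) : f = f' := by
  apply LinearMap.ext_on_range h.span_range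
  exact hf

theorem IsBaseChangeAlong.dual {φ : R →+* S} {g : M →ₛₗ[φ] N} (h : IsBaseChangeAlong φ g)
    [Module.Finite R M] [Module.Projective R M] : IsBaseChangeAlong φ (dualMap h) := by
  letI := φ.toAlgebra
  obtain ⟨n, p, i, -, -, hpi⟩ := Module.Finite.exists_comp_eq_id_of_projective R M
  let b : Fin n → M := fun k => p (Pi.single k 1)
  let c : Fin n → Module.Dual R M := fun k => LinearMap.proj k ∘ₗ i
  have hbc (x : M) : x = ∑ k, c k x • b k := by
    conv_lhs => rw [← LinearMap.id_apply (R := R) x, ← hpi, LinearMap.comp_apply,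
      ← (Pi.basisFun R (Fin n)).sum_repr (i x)]
    simp [b, c]
  have hfc (f : Module.Dual R M) : f = ∑ k, f (b k) • c k := by
    ext x
    conv_lhs => rw [hbc x]
    simp [mul_comm]
  letI : Module R (Module.Dual S N) := Module.compHom _ φ
  haveI : IsScalarTower R S (Module.Dual S N) :=
    ⟨fun r s x => by rw [Algebra.smul_def, mul_smul]; rfl⟩
  let F : S ⊗[R] Module.Dual R M →ₗ[S] Module.Dual S N :=
    AlgebraTensorModule.lift
      { toFun := fun s =>
          { toFun := fun f => s • dualMap h f
            map_add' := fun f f' => by rw [map_add, smul_add]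
            map_smul' := fun r f => by
              rw [LinearMap.map_smulₛₗ, smul_comm]; rfl }
        map_add' := fun s s' => by ext f; simp [add_smul]
        map_smul' := fun s s' => by ext f; simp [mul_smul] }
  have hF (s : S) (f) : F (s ⊗ₜ f) = s • dualMap h f := rfl
  let G : Module.Dual S N →ₗ[S] S ⊗[R] Module.Dual R M :=
    { toFun := fun u => ∑ k, u (g (b k)) ⊗ₜ[R] c k
      map_add' := fun u u' => by simp [add_tmul, Finset.sum_add_distrib]
      map_smul' := fun s u => by simp [Finset.smul_sum, smul_tmul'] }
  refine ⟨LinearEquiv.ofLinearMap F G ?_ ?_, fun f => ?_⟩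
  · ext1 u
    apply dual_ext h
    intro m
    simp only [LinearMap.comp_apply, LinearMap.id_apply, G, LinearMap.coe_mk, AddHom.coe_mk,
      map_sum, hF, LinearMap.sum_apply, LinearMap.smul_apply, dualMap_apply]
    conv_rhs => rw [hbc m]
    simp [mul_comm]
  · refine LinearMap.ext fun t => ?_
    induction t using TensorProduct.induction_on with
    | zero => simp
    | add x y hx hy => rw [map_add, hx, hy, map_add]
    | tmul s f =>
      change ∑ k, (s • dualMap h f) (g (b k)) ⊗ₜ[R] c k = s ⊗ₜ[R] f
      conv_rhs => rw [hfc f]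
      rw [tmul_sum]
      refine Finset.sum_congr rfl fun k _ => ?_
      rw [LinearMap.smul_apply, dualMap_apply, tmul_smul, smul_tmul', smul_eq_mul, mul_comm]
      congr 1
  · simp [hF]

/-- Descending a semilinear map to quotients. -/
def quotMap {φ : R →+* S} (g : M →ₛₗ[φ] N) (K : Submodule R M) (K' : Submodule S N)
    (hK : ∀ m ∈ K, g m ∈ K') : M ⧸ K →ₛₗ[φ] N ⧸ K' :=
  K.liftQ (K'.mkQ.comp g) fun m hm => by simpa using hK m hm

@[simp] theorem quotMap_mk {φ : R →+* S} (g : M →ₛₗ[φ] N) (K : Submodule R M)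
    (K' : Submodule S N) (hK : ∀ m ∈ K, g m ∈ K') (m : M) :
    quotMap g K K' hK (Submodule.Quotient.mk m) = Submodule.Quotient.mk (g m) := rfl

theorem IsBaseChangeAlong.quot {φ : R →+* S} {g : M →ₛₗ[φ] N} (h : IsBaseChangeAlong φ g)
    (K : Submodule R M) (K' : Submodule S N) (hK : ∀ m ∈ K, g m ∈ K')
    (hK' : K' ≤ Submodule.span S (g '' K)) : IsBaseChangeAlong φ (quotMap g K K' hK) := by
  letI := φ.toAlgebra
  obtain ⟨e, he⟩ := h
  letI : Module R (N ⧸ K') := Module.compHom _ φ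
  haveI : IsScalarTower R S (N ⧸ K') :=
    ⟨fun r s x => by rw [Algebra.smul_def, mul_smul]; rfl⟩
  let F : S ⊗[R] (M ⧸ K) →ₗ[S] N ⧸ K' :=
    AlgebraTensorModule.lift
      { toFun := fun s =>
          { toFun := fun f => s • quotMap g K K' hK f
            map_add' := fun f f' => by rw [map_add, smul_add]
            map_smul' := fun r f => by
              rw [LinearMap.map_smulₛₗ, smul_comm]; rfl }
        map_add' := fun s s' => by ext f; simp [add_smul]
        map_smul' := fun s s' => by ext f; simp [mul_smul] }
  have hF (s : S) (f) : F (s ⊗ₜ f) = s • quotMap g K K' hK f := rfl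
  let G : N ⧸ K' →ₗ[S] S ⊗[R] (M ⧸ K) :=
    K'.liftQ (K.mkQ.baseChange S ∘ₗ e.symm.toLinearMap) (by
      refine hK'.trans (Submodule.span_le.2 ?_)
      rintro _ ⟨m, hm, rfl⟩
      have : e.symm (g m) = 1 ⊗ₜ m := by rw [LinearEquiv.symm_apply_eq]; exact (he m).symm
      simp only [SetLike.mem_coe, LinearMap.mem_ker, LinearMap.comp_apply, LinearEquiv.coe_coe,
        this, LinearMap.baseChange_tmul, Submodule.mkQ_apply]
      rw [(Submodule.Quotient.mk_eq_zero K).2 hm, tmul_zero])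
  have hG (m : M) : G (Submodule.Quotient.mk (g m)) = 1 ⊗ₜ Submodule.Quotient.mk m := by
    have : e.symm (g m) = 1 ⊗ₜ m := by rw [LinearEquiv.symm_apply_eq]; exact (he m).symm
    change (K.mkQ.baseChange S) (e.symm (g m)) = _
    rw [this]
    simp
  refine ⟨LinearEquiv.ofLinearMap F G ?_ ?_, fun f => ?_⟩
  · ext1
    have hs : IsBaseChangeAlong φ g := ⟨e, he⟩
    apply dual_ext hs
    intro m
    change F (G (Submodule.Quotient.mk (g m))) = Submodule.Quotient.mk (g m)
    rw [hG, hF, one_smul]; rfl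
  · refine LinearMap.ext fun t => ?_
    induction t using TensorProduct.induction_on with
    | zero => simp
    | add x y hx hy => rw [map_add, hx, hy, map_add]
    | tmul s f =>
      obtain ⟨m, rfl⟩ := Submodule.Quotient.mk_surjective K f
      change G (s • quotMap g K K' hK (Submodule.Quotient.mk m)) = _
      rw [map_smul, quotMap_mk, hG, smul_tmul', smul_eq_mul, mul_one]
      rfl
  · simp [hF]

/-- Restricting a semilinear map to submodules. -/
def subMap {φ : R →+* S} (g : M →ₛₗ[φ] N) (K : Submodule R M) (K' : Submodule S N)
    (hK : ∀ m ∈ K, g m ∈ K') : K →ₛₗ[φ] K' where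
  toFun m := ⟨g m, hK m m.2⟩
  map_add' x y := by ext; simp
  map_smul' r x := by ext; simp

/-- A submodule with projective quotient is a direct summand. -/
theorem exists_retraction (K : Submodule R M) [Module.Projective R (M ⧸ K)] :
    ∃ r : M →ₗ[R] K, ∀ k : K, r k = k := by
  obtain ⟨s, hs⟩ := Module.projective_lifting_property K.mkQ LinearMap.id K.mkQ_surjective
  have hmem (m : M) : m - s (K.mkQ m) ∈ K := by
    refine (Submodule.Quotient.eq K).1 ?_
    exact (DFunLike.congr_fun hs (K.mkQ m)).symm
  refine ⟨LinearMap.codRestrict K (LinearMap.id - s ∘ₗ K.mkQ) hmem, fun k => ?_⟩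
  ext
  have : K.mkQ k = 0 := by simp
  simp [LinearMap.codRestrict_apply, this]

theorem finite_of_quot_projective [Module.Finite R M] (K : Submodule R M)
    [Module.Projective R (M ⧸ K)] : Module.Finite R K := by
  obtain ⟨r, hr⟩ := exists_retraction K
  exact Module.Finite.of_surjective r fun k => ⟨k, hr k⟩

theorem projective_of_quot_projective [Module.Projective R M] (K : Submodule R M)
    [Module.Projective R (M ⧸ K)] : Module.Projective R K := by
  obtain ⟨r, hr⟩ := exists_retraction K
  exact Module.Projective.of_split K.subtype r (LinearMap.ext hr)

theorem IsBaseChangeAlong.sub {φ : R →+* S} {g : M →ₛₗ[φ] N} (h : IsBaseChangeAlong φ g)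
    (K : Submodule R M) [Module.Projective R (M ⧸ K)]
    (K' : Submodule S N) (hK : ∀ m ∈ K, g m ∈ K')
    (hK' : K' ≤ Submodule.span S (g '' K)) : IsBaseChangeAlong φ (subMap g K K' hK) := by
  letI := φ.toAlgebra
  obtain ⟨e, he⟩ := h
  obtain ⟨r, hr⟩ := exists_retraction K
  let F : S ⊗[R] K →ₗ[S] N := e.toLinearMap ∘ₗ K.subtype.baseChange S
  have hF (s : S) (k : K) : F (s ⊗ₜ k) = s • g k := by
    have : (s ⊗ₜ[R] (k : M) : S ⊗[R] M) = s • (1 ⊗ₜ (k : M)) := by simp [smul_tmul']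
    simp [F, this, he]
  have hmem (t) : F t ∈ K' := by
    induction t using TensorProduct.induction_on with
    | zero => simp
    | add x y hx hy => rw [map_add]; exact add_mem hx hy
    | tmul s k => rw [hF]; exact K'.smul_mem _ (hK _ k.2)
  have hinj : Function.Injective F := by
    have hl : Function.LeftInverse (r.baseChange S) (K.subtype.baseChange S) := fun t => by
      rw [← LinearMap.comp_apply, ← LinearMap.baseChange_comp]
      have : r ∘ₗ K.subtype = LinearMap.id := LinearMap.ext hr
      rw [this, LinearMap.baseChange_id, LinearMap.id_apply]
    exact e.injective.comp hl.injective
  refine ⟨LinearEquiv.ofBijective (F.codRestrict K' hmem) ⟨?_, ?_⟩, fun k => ?_⟩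
  · intro x y hxy
    exact hinj (congrArg Subtype.val hxy)
  · rintro ⟨x, hx⟩
    have : K' ≤ LinearMap.range F := by
      refine hK'.trans (Submodule.span_le.2 ?_)
      rintro _ ⟨m, hm, rfl⟩
      exact ⟨1 ⊗ₜ ⟨m, hm⟩, by rw [hF, one_smul]⟩
    obtain ⟨t, rfl⟩ := this hx
    exact ⟨t, rfl⟩
  · ext
    change F (1 ⊗ₜ k) = _
    rw [hF, one_smul]; rfl

theorem IsBaseChangeAlong.projective {φ : R →+* S} {g : M →ₛₗ[φ] N} (h : IsBaseChangeAlong φ g)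
    [Module.Projective R M] : Module.Projective S N := by
  letI := φ.toAlgebra
  obtain ⟨e, -⟩ := h
  exact Module.Projective.of_equiv e

theorem IsBaseChangeAlong.rank_eq_one {φ : R →+* S} {g : M →ₛₗ[φ] N}
    (h : IsBaseChangeAlong φ g) [Module.Finite R M] [Module.Projective R M]
    (h1 : ∀ p, Module.rankAtStalk (R := R) M p = 1) (p) : Module.rankAtStalk (R := S) N p = 1 := by
  letI := φ.toAlgebra
  obtain ⟨e, -⟩ := h
  rw [← Module.rankAtStalk_eq_of_equiv e, Module.rankAtStalk_baseChange, h1]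

variable (R M) in
/-- The submodule of `M ⊗ M` spanned by the `x ⊗ y - y ⊗ x`. -/
def symRel : Submodule R (M ⊗[R] M) :=
  Submodule.span R (Set.range fun z : M × M => z.1 ⊗ₜ[R] z.2 - z.2 ⊗ₜ[R] z.1)

variable (R M) in
/-- The symmetric square `Sym² M`, the quotient of `M ⊗ M` by all `x ⊗ y - y ⊗ x`. -/
abbrev SymSq : Type := (M ⊗[R] M) ⧸ symRel R M

theorem map_symRel {φ : R →+* S} (g : M →ₛₗ[φ] N) :
    ∀ t ∈ symRel R M, TensorProduct.map g g t ∈ symRel S N := by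
  intro t ht
  induction ht using Submodule.span_induction with
  | mem x hx =>
    obtain ⟨⟨a, b⟩, rfl⟩ := hx
    exact Submodule.subset_span ⟨(g a, g b), by simp⟩
  | zero => simp
  | add x y _ _ hx hy => rw [map_add]; exact add_mem hx hy
  | smul r x _ hx => rw [LinearMap.map_smulₛₗ]; exact Submodule.smul_mem _ _ hx

/-- The map `Sym² M → Sym² N`, `x y ↦ g x · g y`. -/
def symSqMap {φ : R →+* S} (g : M →ₛₗ[φ] N) : SymSq R M →ₛₗ[φ] SymSq S N :=
  quotMap (TensorProduct.map g g) _ _ (map_symRel g)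

theorem IsBaseChangeAlong.symSq {φ : R →+* S} {g : M →ₛₗ[φ] N} (h : IsBaseChangeAlong φ g) :
    IsBaseChangeAlong φ (symSqMap g) := by
  refine (h.tensor h).quot _ _ _ ?_
  refine Submodule.span_le.2 ?_
  rintro _ ⟨⟨a, b⟩, rfl⟩
  have key (x y : N) : x ⊗ₜ[S] y - y ⊗ₜ[S] x ∈
      Submodule.span S (TensorProduct.map g g '' (symRel R M : Set (M ⊗[R] M))) := by
    have hx : x ∈ Submodule.span S (Set.range g) := by rw [h.span_range]; trivial
    have hy : y ∈ Submodule.span S (Set.range g) := by rw [h.span_range]; trivial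
    induction hx using Submodule.span_induction with
    | zero => simp
    | add u v _ _ hu hv =>
      rw [add_tmul, tmul_add, add_sub_add_comm]; exact add_mem hu hv
    | smul r u _ hu =>
      rw [tmul_smul, ← smul_tmul', ← smul_sub]; exact Submodule.smul_mem _ _ hu
    | mem u hu =>
      obtain ⟨m, rfl⟩ := hu
      induction hy using Submodule.span_induction with
      | zero => simp
      | add u v _ _ hu hv =>
        rw [add_tmul, tmul_add, add_sub_add_comm]; exact add_mem hu hv
      | smul r u _ hu =>
        rw [tmul_smul, ← smul_tmul', ← smul_sub]; exact Submodule.smul_mem _ _ hu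
      | mem v hv =>
        obtain ⟨m', rfl⟩ := hv
        exact Submodule.subset_span
          ⟨m ⊗ₜ m' - m' ⊗ₜ m, Submodule.subset_span ⟨(m, m'), rfl⟩, by simp⟩
  exact key a b

theorem symSq_projective [Module.Projective R M] (h2 : IsUnit (2 : R)) :
    Module.Projective R (SymSq R M) := by
  obtain ⟨u, hu⟩ := h2
  let c : R := ((u⁻¹ : Rˣ) : R)
  have hc : c * 2 = 1 := by rw [← hu]; simp [c]
  let s : M ⊗[R] M →ₗ[R] M ⊗[R] M :=
    c • (LinearMap.id + (TensorProduct.comm R M M).toLinearMap)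
  have hs : symRel R M ≤ LinearMap.ker s := by
    refine Submodule.span_le.2 ?_
    rintro _ ⟨⟨a, b⟩, rfl⟩
    simp only [s, SetLike.mem_coe, LinearMap.mem_ker, LinearMap.smul_apply, LinearMap.add_apply,
      LinearMap.id_apply, LinearEquiv.coe_coe, map_sub, TensorProduct.comm_tmul]
    rw [add_comm (a ⊗ₜ[R] b), sub_self]
  refine Module.Projective.of_split ((symRel R M).liftQ s hs) (symRel R M).mkQ ?_
  ext a b
  have hab : (Submodule.Quotient.mk (b ⊗ₜ[R] a) : SymSq R M) = Submodule.Quotient.mk (a ⊗ₜ b) :=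
    (Submodule.Quotient.eq _).2 (Submodule.subset_span ⟨(b, a), rfl⟩)
  simp [s, Submodule.Quotient.mk_smul, Submodule.Quotient.mk_add, hab, ← two_smul R, smul_smul,
    mul_comm 2 c, hc]

/-- The map `A ⊗ V → B ⊗ V` induced by a morphism of `ℂ`-algebras `A → B`. -/
noncomputable def extMap {A B : Type} [CommRing A] [CommRing B] [Algebra ℂ A] [Algebra ℂ B]
    (V : Type) [AddCommGroup V] [Module ℂ V] (φ : A →ₐ[ℂ] B) :
    A ⊗[ℂ] V →ₛₗ[(φ : A →+* B)] B ⊗[ℂ] V :=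
  { TensorProduct.map φ.toLinearMap (LinearMap.id : V →ₗ[ℂ] V) with
    map_smul' := fun r x => by
      change TensorProduct.map _ _ (r • x) = φ r • TensorProduct.map _ _ x
      induction x using TensorProduct.induction_on with
      | zero => simp
      | tmul a v => simp [smul_tmul']
      | add x y hx hy => rw [smul_add, map_add, map_add, smul_add, hx, hy] }

@[simp] theorem extMap_tmul {A B : Type} [CommRing A] [CommRing B] [Algebra ℂ A] [Algebra ℂ B]
    (V : Type) [AddCommGroup V] [Module ℂ V] (φ : A →ₐ[ℂ] B) (a : A) (v : V) :
    extMap V φ (a ⊗ₜ v) = φ a ⊗ₜ v := rfl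

theorem extMap_isBaseChange {A B : Type} [CommRing A] [CommRing B] [Algebra ℂ A] [Algebra ℂ B]
    (V : Type) [AddCommGroup V] [Module ℂ V] (φ : A →ₐ[ℂ] B) :
    IsBaseChangeAlong (φ : A →+* B) (extMap V φ) := by
  letI := (φ : A →+* B).toAlgebra
  haveI : IsScalarTower ℂ A B := IsScalarTower.of_algebraMap_eq' φ.comp_algebraMap.symm
  refine ⟨AlgebraTensorModule.cancelBaseChange ℂ A B B V, fun m => ?_⟩
  induction m using TensorProduct.induction_on with
  | zero => simp
  | tmul a v =>
    rw [AlgebraTensorModule.cancelBaseChange_tmul, extMap_tmul, Algebra.smul_def, mul_one]; rfl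
  | add x y hx hy => rw [tmul_add, map_add, map_add, hx, hy]

/-- The points of a Grassmannian transform by the rule `N ↦ span of the image of N`. -/
theorem grassmannian_map_eq {A B : Type} [CommRing A] [CommRing B] [Algebra ℂ A] [Algebra ℂ B]
    (V : Type) [AddCommGroup V] [Module ℂ V] (k : ℕ) (φ : A →ₐ[ℂ] B)
    (N : Module.Grassmannian A (A ⊗[ℂ] V) k) :
    (Module.Grassmannian.map φ N).toSubmodule =
      Submodule.span B (extMap V φ '' (N.toSubmodule : Set (A ⊗[ℂ] V))) := by
  letI : Algebra A B := (φ : A →+* B).toAlgebra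
  haveI : IsScalarTower ℂ A B := IsScalarTower.of_algebraMap_eq' φ.comp_algebraMap.symm
  rw [Module.Grassmannian.map_toSubmodule]
  have hc (v : A ⊗[ℂ] V) : AlgebraTensorModule.cancelBaseChange ℂ A B B V (1 ⊗ₜ v) = extMap V φ v := by
    induction v using TensorProduct.induction_on with
    | zero => simp
    | tmul a v =>
      rw [AlgebraTensorModule.cancelBaseChange_tmul, extMap_tmul, Algebra.smul_def, mul_one]; rfl
    | add x y hx hy => rw [tmul_add, map_add, map_add, hx, hy]
  apply le_antisymm
  · intro x hx
    obtain ⟨y, rfl⟩ := (AlgebraTensorModule.cancelBaseChange ℂ A B B V).surjective x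
    have hy : N.toSubmodule.mkQ.baseChange B y = 0 := by
      have : (N.toSubmodule.mkQ.baseChange B)
        ((AlgebraTensorModule.cancelBaseChange ℂ A B B V).symm
          (AlgebraTensorModule.cancelBaseChange ℂ A B B V y)) = 0 := hx
      simpa using this
    have hex : Function.Exact (N.toSubmodule.subtype.lTensor B) (N.toSubmodule.mkQ.lTensor B) :=
      lTensor_exact B (LinearMap.exact_subtype_mkQ _) (Submodule.mkQ_surjective _)
    obtain ⟨z, rfl⟩ := (hex y).1 hy
    clear hy hx
    induction z using TensorProduct.induction_on with
    | zero => simp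
    | add a b ha hb => rw [map_add, map_add]; exact add_mem ha hb
    | tmul b n =>
      have : (b ⊗ₜ[A] (n : A ⊗[ℂ] V) : B ⊗[A] (A ⊗[ℂ] V)) = b • (1 ⊗ₜ (n : A ⊗[ℂ] V)) := by
        simp [smul_tmul']
      rw [LinearMap.lTensor_tmul, Submodule.subtype_apply, this, map_smul, hc]
      exact Submodule.smul_mem _ _ (Submodule.subset_span ⟨n, n.2, rfl⟩)
  · refine Submodule.span_le.2 ?_
    rintro _ ⟨n, hn, rfl⟩
    change (N.toSubmodule.mkQ.baseChange B)
        ((AlgebraTensorModule.cancelBaseChange ℂ A B B V).symm (extMap V φ n)) = 0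
    rw [← hc, LinearEquiv.symm_apply_apply, LinearMap.baseChange_tmul, Submodule.mkQ_apply,
      (Submodule.Quotient.mk_eq_zero _).2 hn, tmul_zero]

end Algebra

/-- A `ℂ`-space, given by its functor of points `A ↦ X(A)` on commutative `ℂ`-algebras. A
`ℂ`-scheme is identified with its functor of points; by Yoneda's lemma morphisms (in particular
isomorphisms) of schemes are the natural transformations between these functors. -/
abbrev CSpace : Type 1 := CommAlgCat.{0} ℂ ⥤ Type

section Bundles

/-- A morphism of `ℂ`-algebras as a ring homomorphism. -/
abbrev ringHom {A B : CommAlgCat.{0} ℂ} (φ : A ⟶ B) : A →+* B := (φ.hom : A →+* B)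

/-- A vector bundle (locally free sheaf of finite rank) on `X`: for every affine point
`x : Spec A → X` a finitely generated projective `A`-module `x^* E`, compatibly with base change
along all morphisms `Spec B → Spec A` over `X`. -/
structure VecBundle (X : CSpace) : Type 1 where
  /-- The module `x^* E`. -/
  fib : ∀ {A : CommAlgCat.{0} ℂ}, X.obj A → Type
  [addCommGroup : ∀ {A : CommAlgCat.{0} ℂ} (x : X.obj A), AddCommGroup (fib x)]
  [module : ∀ {A : CommAlgCat.{0} ℂ} (x : X.obj A), Module A (fib x)]
  [finite : ∀ {A : CommAlgCat.{0} ℂ} (x : X.obj A), Module.Finite A (fib x)]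
  [projective : ∀ {A : CommAlgCat.{0} ℂ} (x : X.obj A), Module.Projective A (fib x)]
  /-- The comparison maps `x^* E → y^* E` where `y` is the restriction of `x` along `φ`. -/
  map : ∀ {A B : CommAlgCat.{0} ℂ} (φ : A ⟶ B) {x : X.obj A} {y : X.obj B} (_ : X.map φ x = y),
    fib x →ₛₗ[ringHom φ] fib y
  map_id : ∀ {A : CommAlgCat.{0} ℂ} {x : X.obj A} (h : X.map (𝟙 A) x = x) (v : fib x),
    map (𝟙 A) h v = v
  map_comp : ∀ {A B C : CommAlgCat.{0} ℂ} (φ : A ⟶ B) (ψ : B ⟶ C) {x : X.obj A} {y : X.obj B}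
    {z : X.obj C} (h : X.map φ x = y) (h' : X.map ψ y = z) (h'' : X.map (φ ≫ ψ) x = z)
    (v : fib x), map (φ ≫ ψ) h'' v = map ψ h' (map φ h v)
  baseChange : ∀ {A B : CommAlgCat.{0} ℂ} (φ : A ⟶ B) {x : X.obj A} {y : X.obj B}
    (h : X.map φ x = y), IsBaseChangeAlong (ringHom φ) (map φ h)

attribute [instance] VecBundle.addCommGroup VecBundle.module VecBundle.finite
  VecBundle.projective

namespace VecBundle

variable {X Y : CSpace}

/-- `E` has constant rank `r`. -/
def HasRank (E : VecBundle X) (r : ℕ) : Prop :=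
  ∀ {A : CommAlgCat.{0} ℂ} (x : X.obj A) (𝔭 : PrimeSpectrum A),
    Module.rankAtStalk (R := A) (E.fib x) 𝔭 = r

/-- Morphisms of vector bundles. -/
@[ext]
structure Hom (E F : VecBundle X) : Type 1 where
  /-- The map `x^* E → x^* F`. -/
  app : ∀ {A : CommAlgCat.{0} ℂ} (x : X.obj A), E.fib x →ₗ[A] F.fib x
  naturality : ∀ {A B : CommAlgCat.{0} ℂ} (φ : A ⟶ B) {x : X.obj A} {y : X.obj B}
    (h : X.map φ x = y) (v : E.fib x), app y (E.map φ h v) = F.map φ h (app x v)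

instance : Category (VecBundle X) where
  Hom := Hom
  id E := ⟨fun _ => LinearMap.id, fun _ _ _ _ _ => rfl⟩
  comp α β := ⟨fun x => β.app x ∘ₗ α.app x, fun φ _ _ h v => by
    simp only [LinearMap.comp_apply, α.naturality, β.naturality]⟩

/-- The sequence of vector bundles `0 → E → F → G → 0` is exact. As exact sequences of vector
bundles remain exact under pullback, this is tested on all affine points. -/
def IsShortExact {E F G : VecBundle X} (α : E ⟶ F) (β : F ⟶ G) : Prop :=
  ∀ {A : CommAlgCat.{0} ℂ} (x : X.obj A), Function.Injective (Hom.app α x) ∧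
    Function.Exact (Hom.app α x) (Hom.app β x) ∧ Function.Surjective (Hom.app β x)

/-- The group `H⁰(X, E)` of global sections of `E`: the compatible families of elements of the
modules `x^* E`. -/
def Sections (E : VecBundle X) :
    AddSubgroup (∀ (A : CommAlgCat.{0} ℂ) (x : X.obj A), E.fib x) where
  carrier := {s | ∀ {A B : CommAlgCat.{0} ℂ} (φ : A ⟶ B) {x : X.obj A} {y : X.obj B}
    (h : X.map φ x = y), E.map φ h (s A x) = s B y}
  add_mem' hs ht := fun φ _ _ h => by simp only [Pi.add_apply, map_add, hs φ h, ht φ h]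
  zero_mem' := fun _ _ _ _ => map_zero _
  neg_mem' hs := fun φ _ _ h => by simp only [Pi.neg_apply, map_neg, hs φ h]

/-- The value `x^* s` of a global section at an affine point. -/
abbrev Sections.eval {E : VecBundle X} (s : E.Sections) {A : CommAlgCat.{0} ℂ} (x : X.obj A) :
    E.fib x := s.1 A x

/-- `H⁰(X, E)` is a complex vector space. -/
instance (E : VecBundle X) : Module ℂ E.Sections where
  smul c s := ⟨fun A x => algebraMap ℂ A c • s.1 A x, fun φ _ _ h => by
    rw [LinearMap.map_smulₛₗ, s.2 φ h]
    congr 1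
    exact φ.hom.commutes c⟩
  one_smul s := Subtype.ext <| funext fun A => funext fun x => by
    change algebraMap ℂ A 1 • s.1 A x = s.1 A x
    rw [map_one, one_smul]
  mul_smul c d s := Subtype.ext <| funext fun A => funext fun x => by
    change algebraMap ℂ A (c * d) • s.1 A x = algebraMap ℂ A c • algebraMap ℂ A d • s.1 A x
    rw [map_mul, mul_smul]
  smul_zero c := Subtype.ext <| funext fun A => funext fun x => smul_zero _
  smul_add c s t := Subtype.ext <| funext fun A => funext fun x => smul_add _ _ _
  add_smul c d s := Subtype.ext <| funext fun A => funext fun x => by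
    change algebraMap ℂ A (c + d) • s.1 A x =
      algebraMap ℂ A c • s.1 A x + algebraMap ℂ A d • s.1 A x
    rw [map_add, add_smul]
  zero_smul s := Subtype.ext <| funext fun A => funext fun x => by
    change algebraMap ℂ A 0 • s.1 A x = 0
    rw [map_zero, zero_smul]

/-- The zero locus of a global section `s` of `E`: the largest closed subscheme on which `s`
vanishes. Its `A`-points are the `x ∈ X(A)` with `x^* s = 0`. -/
def zeroLocus {E : VecBundle X} (s : E.Sections) : Subfunctor X where
  obj A := {x | Sections.eval s x = 0}
  map {A B} φ x hx := by
    have h := s.2 φ (x := x) rfl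
    rw [show s.1 A x = 0 from hx, map_zero] at h
    exact h.symm

/-- The trivial bundle `V ⊗ O_X` for a finite-dimensional complex vector space `V`. -/
noncomputable def trivial (X : CSpace) (V : Type) [AddCommGroup V] [Module ℂ V]
    [Module.Finite ℂ V] : VecBundle X where
  fib {A} _ := A ⊗[ℂ] V
  map φ _ _ _ := extMap V φ.hom
  map_id _ v := by
    induction v using TensorProduct.induction_on with
    | zero => simp
    | tmul a v => rfl
    | add x y hx hy => rw [map_add, hx, hy]
  map_comp φ ψ _ _ _ _ _ _ v := by
    induction v using TensorProduct.induction_on with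
    | zero => simp
    | tmul a v => rfl
    | add x y hx hy => simp only [map_add, hx, hy]
  baseChange φ _ _ _ := extMap_isBaseChange V φ.hom

/-- The tensor product `E ⊗ F`. -/
noncomputable def tensor (E F : VecBundle X) : VecBundle X where
  fib {A} x := E.fib x ⊗[A] F.fib x
  map φ _ _ h := TensorProduct.map (E.map φ h) (F.map φ h)
  map_id h v := by
    induction v using TensorProduct.induction_on with
    | zero => simp
    | tmul a v => simp [E.map_id, F.map_id]
    | add x y hx hy => rw [map_add, hx, hy]
  map_comp φ ψ _ _ _ h h' h'' v := by
    induction v using TensorProduct.induction_on with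
    | zero => simp
    | tmul a v => simp [E.map_comp φ ψ h h', F.map_comp φ ψ h h']
    | add x y hx hy => simp only [map_add, hx, hy]
  baseChange φ _ _ h := (E.baseChange φ h).tensor (F.baseChange φ h)

/-- The element `a ⊗ b` of `x^* (E ⊗ F)`. -/
def tmulFib {E F : VecBundle X} {A : CommAlgCat.{0} ℂ} {x : X.obj A} (a : E.fib x) (b : F.fib x) :
    (E.tensor F).fib x :=
  a ⊗ₜ[A] b

theorem map_tmulFib {E F : VecBundle X} {A B : CommAlgCat.{0} ℂ} (φ : A ⟶ B) {x : X.obj A}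
    {y : X.obj B} (h : X.map φ x = y) (a : E.fib x) (b : F.fib x) :
    (E.tensor F).map φ h (tmulFib a b) = tmulFib (E.map φ h a) (F.map φ h b) := rfl

/-- The direct sum `E ⊕ F`. -/
def directSum (E F : VecBundle X) : VecBundle X where
  fib x := E.fib x × F.fib x
  map φ _ _ h := prodMapₛₗ (E.map φ h) (F.map φ h)
  map_id h v := by simp [prodMapₛₗ, E.map_id, F.map_id]
  map_comp φ ψ _ _ _ h h' h'' v := by
    simp [prodMapₛₗ, E.map_comp φ ψ h h', F.map_comp φ ψ h h']
  baseChange φ _ _ h := (E.baseChange φ h).prod (F.baseChange φ h)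

/-- The dual bundle `E^∨`. -/
noncomputable def dual (E : VecBundle X) : VecBundle X where
  fib {A} x := Module.Dual A (E.fib x)
  map φ _ _ h := dualMap (E.baseChange φ h)
  map_id {A x} h u := by
    apply dual_ext (E.baseChange (𝟙 A) h)
    intro m
    rw [dualMap_apply, E.map_id]
    rfl
  map_comp φ ψ _ _ _ h h' h'' u := by
    apply dual_ext (E.baseChange (φ ≫ ψ) h'')
    intro m
    rw [dualMap_apply, E.map_comp φ ψ h h' h'', dualMap_apply, dualMap_apply]
    rfl
  baseChange φ _ _ h := (E.baseChange φ h).dual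

/-- The symmetric square `Sym² E`. -/
def sym2 (E : VecBundle X) : VecBundle X where
  fib {A} x := SymSq A (E.fib x)
  projective {A} x := symSq_projective (by
    have : IsUnit (algebraMap ℂ A 2) := (IsUnit.mk0 (2 : ℂ) two_ne_zero).map _
    rwa [map_ofNat] at this)
  map φ _ _ h := symSqMap (E.map φ h)
  map_id h v := by
    obtain ⟨t, rfl⟩ := Submodule.Quotient.mk_surjective _ v
    exact congrArg _ ((E.tensor E).map_id h t)
  map_comp φ ψ _ _ _ h h' h'' v := by
    obtain ⟨t, rfl⟩ := Submodule.Quotient.mk_surjective _ v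
    exact congrArg _ ((E.tensor E).map_comp φ ψ h h' h'' t)
  baseChange φ _ _ h := (E.baseChange φ h).symSq

theorem pullback_aux (α : X ⟶ Y) {A B : CommAlgCat.{0} ℂ} {φ : A ⟶ B} {x : X.obj A}
    {y : X.obj B} (h : X.map φ x = y) : Y.map φ (α.app A x) = α.app B y := by
  rw [← h]
  exact (NatTrans.naturality_apply α φ x).symm

/-- The pullback `α^* E`. -/
def pullback (α : X ⟶ Y) (E : VecBundle Y) : VecBundle X where
  fib {A} x := E.fib (α.app A x)
  map φ _ _ h := E.map φ (pullback_aux α h)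
  map_id _ v := E.map_id _ v
  map_comp φ ψ _ _ _ _ _ _ v := E.map_comp φ ψ _ _ _ v
  baseChange φ _ _ _ := E.baseChange φ _

/-- The exterior tensor product `E ⊠ F = pr₁^* E ⊗ pr₂^* F` on `X × Y`. -/
noncomputable def box (E : VecBundle X) (F : VecBundle Y) :
    VecBundle (FunctorToTypes.prod X Y) :=
  (pullback FunctorToTypes.prod.fst E).tensor (pullback FunctorToTypes.prod.snd F)

end VecBundle

end Bundles

section ProjectiveBundle

/-- The line subbundles of a finitely generated projective module `M`: the direct summands of
rank one. -/
@[ext]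
structure LineSub (R M : Type) [CommRing R] [AddCommGroup M] [Module R M] : Type where
  /-- The submodule. -/
  carrier : Submodule R M
  projective_quot : Module.Projective R (M ⧸ carrier)
  rank_eq_one : ∀ 𝔭, Module.rankAtStalk (R := R) carrier 𝔭 = 1

/-- The base change of a line subbundle. -/
def LineSub.map {R S M N : Type} [CommRing R] [AddCommGroup M] [Module R M] [Module.Finite R M]
    [Module.Projective R M] [CommRing S] [AddCommGroup N] [Module S N] {φ : R →+* S}
    {g : M →ₛₗ[φ] N} (h : IsBaseChangeAlong φ g) (L : LineSub R M) : LineSub S N where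
  carrier := Submodule.span S (g '' L.carrier)
  projective_quot := by
    haveI := L.projective_quot
    exact (h.quot L.carrier _ (fun m hm => Submodule.subset_span (Set.mem_image_of_mem g hm)) le_rfl).projective
  rank_eq_one := by
    haveI := L.projective_quot
    haveI := finite_of_quot_projective L.carrier
    haveI := projective_of_quot_projective L.carrier
    exact (h.sub L.carrier _ (fun m hm => Submodule.subset_span (Set.mem_image_of_mem g hm)) le_rfl).rank_eq_one
      L.rank_eq_one

theorem projBundle.aux_id {X : CSpace} (E : VecBundle X) {A : CommAlgCat.{0} ℂ} {x : X.obj A}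
    (y : X.obj A) (h : X.map (𝟙 A) x = y) (hy : y = x) (L : LineSub A (E.fib x)) :
    (⟨y, L.map (E.baseChange (𝟙 A) h)⟩ : Σ x : X.obj A, LineSub A (E.fib x)) = ⟨x, L⟩ := by
  subst hy
  congr 1
  ext1
  change Submodule.span A _ = _
  have : (E.map (𝟙 A) h : E.fib y → E.fib y) = id := funext fun v => E.map_id h v
  rw [this, Set.image_id, Submodule.span_eq]

theorem projBundle.aux_comp {X : CSpace} (E : VecBundle X) {A B C : CommAlgCat.{0} ℂ}
    (φ : A ⟶ B) (ψ : B ⟶ C) {x : X.obj A} {y : X.obj B} {z z' : X.obj C} (h : X.map φ x = y)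
    (h' : X.map ψ y = z) (h'' : X.map (φ ≫ ψ) x = z') (hz : z' = z) (L : LineSub A (E.fib x)) :
    (⟨z', L.map (E.baseChange (φ ≫ ψ) h'')⟩ : Σ x : X.obj C, LineSub C (E.fib x)) =
      ⟨z, (L.map (E.baseChange φ h)).map (E.baseChange ψ h')⟩ := by
  subst hz
  congr 1
  ext1
  change Submodule.span C (E.map (φ ≫ ψ) h'' '' L.carrier) = Submodule.span C
    (E.map ψ h' '' (Submodule.span B (E.map φ h '' L.carrier) : Submodule B (E.fib y)))
  apply le_antisymm
  · refine Submodule.span_mono ?_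
    rintro _ ⟨v, hv, rfl⟩
    exact ⟨_, Submodule.subset_span ⟨v, hv, rfl⟩, (E.map_comp φ ψ h h' h'' v).symm⟩
  · refine Submodule.span_le.2 ?_
    rintro _ ⟨v, hv, rfl⟩
    induction hv using Submodule.span_induction with
    | mem v hv =>
      obtain ⟨u, hu, rfl⟩ := hv
      exact Submodule.subset_span ⟨u, hu, E.map_comp φ ψ h h' h'' u⟩
    | zero => rw [map_zero]; exact zero_mem _
    | add a b _ _ ha hb => rw [map_add]; exact add_mem ha hb
    | smul r a _ ha => rw [LinearMap.map_smulₛₗ]; exact Submodule.smul_mem _ _ ha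

/-- The projective bundle `ℙ_X(E)` of lines in the vector bundle `E`: a morphism `Spec A → ℙ_X(E)`
is a morphism `x : Spec A → X` together with a line subbundle of `x^* E`. -/
def projBundle {X : CSpace} (E : VecBundle X) : CSpace where
  obj A := Σ x : X.obj A, LineSub A (E.fib x)
  map φ := ↾fun z => ⟨X.map φ z.1, z.2.map (E.baseChange φ rfl)⟩
  map_id _ := ConcreteCategory.hom_ext _ _ fun z =>
    projBundle.aux_id E _ rfl (Functor.map_id_apply X _ z.1) z.2
  map_comp φ ψ := ConcreteCategory.hom_ext _ _ fun z =>
    projBundle.aux_comp E φ ψ rfl rfl rfl (Functor.map_comp_apply X φ ψ z.1) z.2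

/-- The projection `ℙ_X(E) → X`. -/
def projBundle.proj {X : CSpace} (E : VecBundle X) : projBundle E ⟶ X where
  app A := ↾fun z => z.1

end ProjectiveBundle

section DoubleCover

open VecBundle

/-- Points of the double cover. -/
theorem doubleCover.aux {X : CSpace} (M : VecBundle X) (f : (M.tensor M).Sections)
    {A B : CommAlgCat.{0} ℂ} (φ : A ⟶ B) {x : X.obj A} {x' : X.obj B} (h : X.map φ x = x')
    {y : M.fib x} (hy : tmulFib y y = Sections.eval f x) :
    tmulFib (M.map φ h y) (M.map φ h y) = Sections.eval f x' := by
  rw [← map_tmulFib, hy]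
  exact f.2 φ h

/-- The double cover of `X` defined by a line bundle `M` and a section `f` of `M ⊗ M`, branched
along the divisor `f = 0`: the subscheme `y ⊗ y = f` of the total space of `M`. -/
def doubleCover {X : CSpace} (M : VecBundle X) (f : (M.tensor M).Sections) : CSpace where
  obj A := Σ x : X.obj A, {y : M.fib x // tmulFib y y = Sections.eval f x}
  map φ := ↾fun z => ⟨X.map φ z.1, M.map φ rfl z.2.1, doubleCover.aux M f φ rfl z.2.2⟩
  map_id A := ConcreteCategory.hom_ext _ _ fun z => by
    obtain ⟨x, y, hy⟩ := z
    have key : ∀ (x' : X.obj A) (h : X.map (𝟙 A) x = x') (_ : x' = x),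
        (⟨x', M.map (𝟙 A) h y, doubleCover.aux M f (𝟙 A) h hy⟩ :
          Σ x : X.obj A, {y : M.fib x // tmulFib y y = Sections.eval f x}) = ⟨x, y, hy⟩ := by
      rintro x' h rfl
      congr 2
      exact M.map_id h y
    exact key _ rfl (Functor.map_id_apply X _ x)
  map_comp {A B C} φ ψ := ConcreteCategory.hom_ext _ _ fun z => by
    obtain ⟨x, y, hy⟩ := z
    have key : ∀ (x' : X.obj C) (h : X.map (φ ≫ ψ) x = x') (_ : x' = X.map ψ (X.map φ x)),
        (⟨x', M.map (φ ≫ ψ) h y, doubleCover.aux M f (φ ≫ ψ) h hy⟩ :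
          Σ x : X.obj C, {y : M.fib x // tmulFib y y = Sections.eval f x}) =
        ⟨X.map ψ (X.map φ x), M.map ψ rfl (M.map φ rfl y),
          doubleCover.aux M f ψ rfl (doubleCover.aux M f φ rfl hy)⟩ := by
      rintro x' h rfl
      congr 2
      exact M.map_comp φ ψ rfl rfl h y
    exact key _ rfl (Functor.map_comp_apply X φ ψ x)

/-- The covering map of the double cover. -/
def doubleCover.proj {X : CSpace} (M : VecBundle X) (f : (M.tensor M).Sections) :
    doubleCover M f ⟶ X where
  app A := ↾fun z => z.1

/-- The divisor of a section `f` of a line bundle on a smooth scheme is smooth: at every closed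
point `x` with `f(x) = 0` the differential of `f` is nonzero, that is, `f` does not vanish on some
tangent vector `Spec ℂ[ε] → X` at `x`. -/
def IsSmoothDivisor {X : CSpace} {M : VecBundle X} (f : M.Sections) : Prop :=
  ∀ x : X.obj (CommAlgCat.of ℂ ℂ), Sections.eval f x = 0 →
    ∃ y : X.obj (CommAlgCat.of ℂ (DualNumber ℂ)),
      X.map (CommAlgCat.ofHom (TrivSqZeroExt.fstHom ℂ ℂ ℂ)) y = x ∧ Sections.eval f y ≠ 0

end DoubleCover

/-- A property holds for the general element of a complex vector space `H`: `H` is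
finite-dimensional and the property holds on the nonempty Zariski open complement of some
hypersurface `F = 0`, where `F` is a nonzero polynomial in linear coordinates on `H`. -/
def ForGeneral {H : Type*} [AddCommGroup H] [Module ℂ H] (P : H → Prop) : Prop :=
  ∃ (n : ℕ) (b : Module.Basis (Fin n) ℂ H) (F : MvPolynomial (Fin n) ℂ), F ≠ 0 ∧
    ∀ s, MvPolynomial.eval (fun i => b.repr s i) F ≠ 0 → P s

section ProjectiveSpace

open VecBundle

/-- The projective space `ℙⁿ = ℙ(V)` of lines in `V = ℂⁿ⁺¹`: its `A`-points are the `A`-submodules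
of `A ⊗ V` whose quotient is locally free of rank `n`. -/
abbrev projectiveSpace (n : ℕ) : CSpace := 
  Module.Grassmannian.functor (R := ℂ) (M := Fin (n + 1) → ℂ) n

/-- The submodule `L ⊆ A ⊗ V` given by an `A`-point of `ℙ(V)`. -/
def line {n : ℕ} {A : CommAlgCat.{0} ℂ} (x : (projectiveSpace n).obj A) :
    Submodule A (A ⊗[ℂ] (Fin (n + 1) → ℂ)) :=
  Module.Grassmannian.toSubmodule x

instance {n : ℕ} {A : CommAlgCat.{0} ℂ} (x : (projectiveSpace n).obj A) :
    Module.Projective A ((A ⊗[ℂ] (Fin (n + 1) → ℂ)) ⧸ line x) :=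
  Module.Grassmannian.projective_quotient x

theorem line_map {n : ℕ} {A B : CommAlgCat.{0} ℂ} (φ : A ⟶ B) {x : (projectiveSpace n).obj A}
    {y : (projectiveSpace n).obj B} (h : (projectiveSpace n).map φ x = y) :
    line y = Submodule.span B (extMap (Fin (n + 1) → ℂ) φ.hom '' line x) := by
  rw [← h]
  exact grassmannian_map_eq (Fin (n + 1) → ℂ) n φ.hom x

theorem extMap_mem_line {n : ℕ} {A B : CommAlgCat.{0} ℂ} (φ : A ⟶ B)
    {x : (projectiveSpace n).obj A} {y : (projectiveSpace n).obj B}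
    (h : (projectiveSpace n).map φ x = y) :
    ∀ v ∈ line x, extMap (Fin (n + 1) → ℂ) φ.hom v ∈ line y := fun v hv => by
  rw [line_map φ h]
  exact Submodule.subset_span (Set.mem_image_of_mem _ hv)

/-- The trivial bundle `V ⊗ O` with fibre `V = ℂⁿ⁺¹` on `ℙⁿ = ℙ(V)`. -/
noncomputable abbrev trivV (n : ℕ) : VecBundle (projectiveSpace n) :=
  trivial (projectiveSpace n) (Fin (n + 1) → ℂ)

/-- The tautological line subbundle `O(-1) ⊆ V ⊗ O` on `ℙⁿ = ℙ(V)`. -/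
noncomputable def taut (n : ℕ) : VecBundle (projectiveSpace n) where
  fib x := line x
  finite x := finite_of_quot_projective (line x)
  projective x := projective_of_quot_projective (line x)
  map φ _ _ h := subMap (extMap _ φ.hom) _ _ (extMap_mem_line φ h)
  map_id h v := Subtype.ext ((trivV n).map_id h v.1)
  map_comp φ ψ _ _ _ h h' h'' v := Subtype.ext ((trivV n).map_comp φ ψ h h' h'' v.1)
  baseChange φ _ _ h := (extMap_isBaseChange _ φ.hom).sub _ _ _ (line_map φ h).le

/-- The tautological quotient bundle `Q = (V ⊗ O) / O(-1)` on `ℙⁿ = ℙ(V)`. -/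
noncomputable def tautQuot (n : ℕ) : VecBundle (projectiveSpace n) where
  fib {A} x := (A ⊗[ℂ] (Fin (n + 1) → ℂ)) ⧸ line x
  map φ _ _ h := quotMap (extMap _ φ.hom) _ _ (extMap_mem_line φ h)
  map_id h v := by
    obtain ⟨t, rfl⟩ := Submodule.Quotient.mk_surjective _ v
    exact congrArg _ ((trivV n).map_id h t)
  map_comp φ ψ _ _ _ h h' h'' v := by
    obtain ⟨t, rfl⟩ := Submodule.Quotient.mk_surjective _ v
    exact congrArg _ ((trivV n).map_comp φ ψ h h' h'' t)
  baseChange φ _ _ h := (extMap_isBaseChange _ φ.hom).quot _ _ _ (line_map φ h).le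

/-- `O(-2) = O(-1) ⊗ O(-1)`. -/
noncomputable abbrev ONegTwo (n : ℕ) : VecBundle (projectiveSpace n) :=
  (taut n).tensor (taut n)

/-- `O(1)`, the dual of `O(-1)`. -/
noncomputable abbrev OOne (n : ℕ) : VecBundle (projectiveSpace n) := (taut n).dual

/-- `O(2) = O(1) ⊗ O(1)`. -/
noncomputable abbrev OTwo (n : ℕ) : VecBundle (projectiveSpace n) :=
  (OOne n).tensor (OOne n)

/-- The structure sheaf `O` as a line bundle. -/
noncomputable abbrev OZero (n : ℕ) : VecBundle (projectiveSpace n) :=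
  trivial (projectiveSpace n) ℂ

/-- The inclusion `O(-1) → V ⊗ O`. -/
noncomputable def tautIncl (n : ℕ) : taut n ⟶ trivV n where
  app x := (line x).subtype
  naturality _ _ _ _ _ := rfl

/-- The projection `V ⊗ O → Q`. -/
noncomputable def tautProj (n : ℕ) : trivV n ⟶ tautQuot n where
  app x := (line x).mkQ
  naturality _ _ _ _ _ := rfl

variable {X : CSpace}

/-- The tensor product of two morphisms of vector bundles. -/
noncomputable def tensorMap {E E' F F' : VecBundle X} (α : E ⟶ E') (β : F ⟶ F') :
    E.tensor F ⟶ E'.tensor F' where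
  app x := TensorProduct.map (Hom.app α x) (Hom.app β x)
  naturality φ x y h v := by
    change TensorProduct.map (Hom.app α y) (Hom.app β y)
        (TensorProduct.map (E.map φ h) (F.map φ h) v) =
      TensorProduct.map (E'.map φ h) (F'.map φ h)
        (TensorProduct.map (Hom.app α x) (Hom.app β x) v)
    induction v using TensorProduct.induction_on with
    | zero => simp only [map_zero]
    | tmul a b => simp only [TensorProduct.map_tmul, Hom.naturality]
    | add a b ha hb => simp only [map_add, ha, hb]

/-- The quotient map `E ⊗ E → Sym² E`. -/
def sym2Proj (E : VecBundle X) : E.tensor E ⟶ E.sym2 where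
  app {A} x := (symRel A (E.fib x)).mkQ
  naturality _ _ _ _ _ := rfl

/-- The map `Sym² E → Sym² F` induced by `α : E → F`. -/
def sym2Map {E F : VecBundle X} (α : E ⟶ F) : E.sym2 ⟶ F.sym2 where
  app x := symSqMap (Hom.app α x)
  naturality φ x y h v := by
    obtain ⟨t, rfl⟩ := Submodule.Quotient.mk_surjective _ v
    exact congrArg _ (Hom.naturality (tensorMap α α) φ h t)

/-- The twisted Euler sequence `0 → O(-2) → V ⊗ O(-1) → Q(-1) → 0`: the first map. -/
noncomputable def eulerIncl (n : ℕ) : ONegTwo n ⟶ (trivV n).tensor (taut n) :=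
  tensorMap (tautIncl n) (𝟙 (taut n))

/-- The twisted Euler sequence `0 → O(-2) → V ⊗ O(-1) → Q(-1) → 0`: the second map. -/
noncomputable def eulerProj (n : ℕ) : (trivV n).tensor (taut n) ⟶ (tautQuot n).tensor (taut n) :=
  tensorMap (tautProj n) (𝟙 (taut n))

/-- The sequence `0 → V ⊗ O(-1) → Sym² V ⊗ O → Sym² Q → 0`: the first map `v ⊗ l ↦ v l`. -/
noncomputable def symIncl (n : ℕ) : (trivV n).tensor (taut n) ⟶ (trivV n).sym2 :=
  tensorMap (𝟙 (trivV n)) (tautIncl n) ≫ sym2Proj (trivV n)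

/-- The sequence `0 → V ⊗ O(-1) → Sym² V ⊗ O → Sym² Q → 0`: the second map. -/
noncomputable def symProj (n : ℕ) : (trivV n).sym2 ⟶ (tautQuot n).sym2 :=
  sym2Map (tautProj n)

/-- A completion of the two sequences above to a commutative diagram with exact rows and columns
```
0 → O(-2) → V ⊗ O(-1)  → Q(-1)  → 0
      ‖          ↓          ↓ j
0 → O(-2) → Sym² V ⊗ O → Λ      → 0
      ↓          ↓      b   ↓ p
0 →   0   →    Sym² Q  =  Sym² Q → 0
```
by a vector bundle `Λ` and the maps `b`, `j`, `p`. -/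
structure SnakeDiagram (n : ℕ) : Type 1 where
  /-- The bundle `Λ`. -/
  Λ : VecBundle (projectiveSpace n)
  /-- The map `Sym² V ⊗ O → Λ`. -/
  b : (trivV n).sym2 ⟶ Λ
  /-- The map `Q(-1) → Λ`. -/
  j : (tautQuot n).tensor (taut n) ⟶ Λ
  /-- The map `Λ → Sym² Q`. -/
  p : Λ ⟶ (tautQuot n).sym2
  row_exact : IsShortExact (eulerIncl n ≫ symIncl n) b
  column_exact : IsShortExact j p
  comm_top : symIncl n ≫ b = eulerProj n ≫ j
  comm_bottom : b ≫ p = symProj n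

/-- A homogeneous structure on a vector bundle `E` on `ℙ(V)`: a lift of the action of the algebraic
group `GL(V)` on `ℙ(V)` to an action on `E`. For every algebra `A`, every `g ∈ GL(V)(A)` and all
`x, y ∈ ℙ(V)(A)` with `g x = y` there is an isomorphism `x^* E → y^* E`, multiplicatively in `g` and
compatibly with base change. -/
structure GLLinearization {n : ℕ} (E : VecBundle (projectiveSpace n)) : Type 1 where
  /-- The action of `g`. -/
  act : ∀ {A : CommAlgCat.{0} ℂ}
    (g : (A ⊗[ℂ] (Fin (n + 1) → ℂ)) ≃ₗ[A] (A ⊗[ℂ] (Fin (n + 1) → ℂ)))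
    {x y : (projectiveSpace n).obj A} (_ : (line x).map g.toLinearMap = line y),
    E.fib x ≃ₗ[A] E.fib y
  act_one : ∀ {A : CommAlgCat.{0} ℂ} {x : (projectiveSpace n).obj A}
    (h : (line x).map (LinearEquiv.refl A (A ⊗[ℂ] (Fin (n + 1) → ℂ))).toLinearMap = line x)
    (v : E.fib x), act (LinearEquiv.refl A _) h v = v
  act_mul : ∀ {A : CommAlgCat.{0} ℂ}
    (g g' : (A ⊗[ℂ] (Fin (n + 1) → ℂ)) ≃ₗ[A] (A ⊗[ℂ] (Fin (n + 1) → ℂ)))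
    {x y z : (projectiveSpace n).obj A} (h : (line x).map g.toLinearMap = line y)
    (h' : (line y).map g'.toLinearMap = line z)
    (h'' : (line x).map (g ≪≫ₗ g').toLinearMap = line z) (v : E.fib x),
    act (g ≪≫ₗ g') h'' v = act g' h' (act g h v)
  act_map : ∀ {A B : CommAlgCat.{0} ℂ} (φ : A ⟶ B)
    (g : (A ⊗[ℂ] (Fin (n + 1) → ℂ)) ≃ₗ[A] (A ⊗[ℂ] (Fin (n + 1) → ℂ)))
    (g' : (B ⊗[ℂ] (Fin (n + 1) → ℂ)) ≃ₗ[B] (B ⊗[ℂ] (Fin (n + 1) → ℂ)))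
    (_ : ∀ v, g' (extMap _ φ.hom v) = extMap _ φ.hom (g v))
    {x y : (projectiveSpace n).obj A} {x' y' : (projectiveSpace n).obj B}
    (hx : (projectiveSpace n).map φ x = x') (hy : (projectiveSpace n).map φ y = y')
    (h : (line x).map g.toLinearMap = line y) (h' : (line x').map g'.toLinearMap = line y')
    (v : E.fib x), act g' h' (E.map φ hx v) = E.map φ hy (act g h v)

/-- `E(0,1) = E ⊠ O(1)` on `ℙᵐ × ℙⁿ` for a vector bundle `E` on `ℙᵐ`. -/
noncomputable abbrev twistZeroOne {m : ℕ} (E : VecBundle (projectiveSpace m)) (n : ℕ) :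
    VecBundle (FunctorToTypes.prod (projectiveSpace m) (projectiveSpace n)) :=
  E.box (OOne n)

/-- `O(0,2) = O ⊠ O(2)` on `ℙᵐ × ℙⁿ`. -/
noncomputable abbrev OZeroTwo (m n : ℕ) :
    VecBundle (FunctorToTypes.prod (projectiveSpace m) (projectiveSpace n)) :=
  (OZero m).box (OTwo n)

/-- The projection of a zero locus in `ℙᵐ × ℙⁿ` to `ℙᵐ`. -/
def zeroLocusProj {m n : ℕ}
    {E : VecBundle (FunctorToTypes.prod (projectiveSpace m) (projectiveSpace n))}
    (s : E.Sections) : (zeroLocus s).toFunctor ⟶ projectiveSpace m :=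
  (zeroLocus s).ι ≫ FunctorToTypes.prod.fst

end ProjectiveSpace

end FanoBundles

/-! Everything is tested on affine points: over `Spec A` a point of ℙ³ is a rank-one direct summand
`L` of `A⁴`, and a fibre of `Λ` is `Sym²(A⁴)` modulo `L²`.

The diagram. The map `b` has to be a cokernel of `O(-2) → Sym² V ⊗ O`. A retraction onto `L` splits
`L ⊗ L → Sym²` (`exists_leftInverse_symMulSub_rTensor`), so this cokernel is locally free of rank 10
- 1; `j` and `p` are induced maps (`snake_exists`). As `b` is an epimorphism with prescribed kernel,
it fixes the comparison isomorphism (`existsUnique_iso`). An element `g` of the linear group carries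
`L²` to `(gL)²`, hence acts on `Λ`.

Global sections. Evaluated on coordinate vectors, a section of O(4), O(0,2) or `Λ(0,1)` becomes
regular functions on a product of punctured affine spaces. These are polynomials by a Hartogs
argument (`PuncturedFunction.exists_poly`), bihomogeneous by scaling. For `Λ(0,1)` the functions are
the minors `ω_ab l_c l_d - ω_cd l_a l_b`, which detect `L²` inside `Sym² V`. Their syzygies
(`lambdaVal_cocycle`, `cocycle_eq_zero`) force every section to come from a matrix `σ` of scalars,
so H⁰(Λ(0,1)) comes from Sym² V ⊗ H⁰(O(1)) (`exists_lambdaSection`), and H⁰(Λ) from Sym² V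
(`exists_constLambda`).

Nonsplitting. An element of Sym² V that dies in Sym² Q at all four coordinate points is zero. A
splitting `r` would therefore give `t = r p t` for every section `t` of `Λ`, but the section of `2
e_0 e_1` has at `[e_0]` a nonzero value killed by `p`.

The projective bundle. The section of `σ` vanishes at `(L, m)` exactly when `σ(m)` lies in `L²`. If
`σ` is completed by a linear form to an isomorphism ℂ¹¹ ≅ ℂ¹⁰ × ℂ, this says that `m` is a line in
`L² ⊕ A` (`eval_lambdaSection_eq_zero_iff_le`).

The double cover. Completing the square along the kernel of `σ` (`complete_square`) turns a general
quadric, up to a nonzero scalar, into `u(w)² - Γ(σ w)`. On a line `m` in `L² ⊕ A` this equation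
keeps the projection `m → L²` from vanishing anywhere, so `m` is the graph of a linear form `h` on
`L²`, a value of O(2), with `h²` equal to the quartic defined by `Γ` on the Veronese image
(`exists_graphPoint`). Each `Γ` occurs (`branchMatrix_standard`), which gives the converse.
Smoothness is general because the quartics singular in a standard chart are values of 100
polynomials in 99 variables, hence satisfy a nontrivial relation (`exists_discriminant`). -/

namespace FanoBundles

open VecBundle

/-! ### Rank-one projective modules are invertible -/

section InvertibleModules

variable {R M N : Type*} [CommRing R] [AddCommGroup M] [Module R M] [AddCommGroup N] [Module R N]

/-- In a module of rank one, `f x • y = f y • x` for every linear form `f`. -/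
theorem smul_comm_of_rank_eq_one [Module.Finite R M] [Module.Projective R M]
    (h : ∀ p, Module.rankAtStalk (R := R) M p = 1) (f : Module.Dual R M) (x y : M) :
    f x • y = f y • x := by
  -- After localization at a maximal ideal the module is free on one generator, and both sides are
  -- the same product.
  refine Module.eq_of_localization_maximal (R := R) (M := M)
    (fun P _ => LocalizedModule P.primeCompl M)
    (fun P _ => LocalizedModule.mkLinearMap P.primeCompl M) _ _ fun P hP => ?_
  have hP' : P.IsPrime := hP.isPrime
  have h1 : Module.finrank (Localization.AtPrime P) (LocalizedModule P.primeCompl M) = 1 :=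
    h ⟨P, hP'⟩
  have : Module.Free (Localization.AtPrime P) (LocalizedModule P.primeCompl M) :=
    Module.free_of_flat_of_isLocalRing
  let b := Module.finBasisOfFinrankEq (Localization.AtPrime P) (LocalizedModule P.primeCompl M) h1
  let F : LocalizedModule P.primeCompl M →ₗ[Localization.AtPrime P] Localization.AtPrime P :=
    LinearMap.extendScalarsOfIsLocalization P.primeCompl (Localization.AtPrime P)
      (IsLocalizedModule.map P.primeCompl (LocalizedModule.mkLinearMap P.primeCompl M)
        (Algebra.linearMap R (Localization.AtPrime P)) f)
  have hF (z : M) : F (LocalizedModule.mkLinearMap P.primeCompl M z) =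
      algebraMap R (Localization.AtPrime P) (f z) :=
    IsLocalizedModule.map_apply ..
  have key (u w : LocalizedModule P.primeCompl M) : F u • w = F w • u := by
    rw [← b.sum_repr u, ← b.sum_repr w]
    simp only [Finset.univ_unique, Finset.sum_singleton, map_smul, smul_smul, smul_eq_mul]
    congr 1
    ring
  have := key (LocalizedModule.mkLinearMap P.primeCompl M x)
    (LocalizedModule.mkLinearMap P.primeCompl M y)
  rwa [hF, hF, algebraMap_smul, algebraMap_smul, ← map_smul, ← map_smul] at this

/-- The values of linear forms on a module of rank one generate the unit ideal. -/
theorem contractLeft_surjective_of_rank_eq_one [Module.Finite R M] [Module.Projective R M]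
    (h : ∀ p, Module.rankAtStalk (R := R) M p = 1) :
    Function.Surjective (contractLeft R M) := by
  rw [← LinearMap.range_eq_top]
  by_contra hne
  obtain ⟨P, hP, hle⟩ := Ideal.exists_le_maximal (LinearMap.range (contractLeft R M)) hne
  obtain ⟨n, p, i, -, -, hpi⟩ := Module.Finite.exists_comp_eq_id_of_projective R M
  have hP' : P.IsPrime := hP.isPrime
  -- If all values of linear forms lie in `P`, the dual basis expansion puts `M` inside `P M`.
  -- Nakayama then gives `r ≡ 1` modulo `P` annihilating `M`, so the localization at `P` vanishes,
  -- against rank one.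
  have htop : (⊤ : Submodule R M) ≤ P • ⊤ := by
    rintro x -
    have hx : x = ∑ k, i x k • p (Pi.single k 1) := by
      conv_lhs => rw [← LinearMap.id_apply (R := R) x, ← hpi, LinearMap.comp_apply,
        ← (Pi.basisFun R (Fin n)).sum_repr (i x)]
      simp
    rw [hx]
    exact Submodule.sum_mem _ fun k _ => Submodule.smul_mem_smul
      (hle ⟨(LinearMap.proj k ∘ₗ i) ⊗ₜ x, by simp⟩) trivial
  obtain ⟨r, hr, hr0⟩ := Submodule.exists_sub_one_mem_and_smul_eq_zero_of_fg_of_le_smul P ⊤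
    Module.Finite.fg_top htop
  have hrP : r ∉ P := fun hmem => hP.ne_top ((Ideal.eq_top_iff_one P).2 (by
    have := P.sub_mem hmem hr
    simpa using this))
  have : Subsingleton (LocalizedModule P.primeCompl M) := by
    rw [LocalizedModule.subsingleton_iff]
    exact fun m => ⟨r, hrP, hr0 m trivial⟩
  have h1 : Module.finrank (Localization.AtPrime P) (LocalizedModule P.primeCompl M) = 1 :=
    h ⟨P, hP'⟩
  rw [Module.finrank_zero_of_subsingleton] at h1
  exact zero_ne_one h1

/-- Choose `e` with contraction `1`. The exchange rule `f x • y = f y • x` and its dual version show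
that any tensor is its contraction times `e`, so contraction is injective as well as surjective. -/
theorem invertible_of_rank_eq_one [Module.Finite R M] [Module.Projective R M]
    (h : ∀ p, Module.rankAtStalk (R := R) M p = 1) : Module.Invertible R M := by
  have hsurj := contractLeft_surjective_of_rank_eq_one h
  obtain ⟨e, he⟩ := hsurj 1
  have hdual (f g : Module.Dual R M) (l : M) : g l • f = f l • g := by
    ext x
    have := congrArg f (smul_comm_of_rank_eq_one h g l x)
    simpa [mul_comm] using this
  have key (u : Module.Dual R M ⊗[R] M) : u = contractLeft R M u • e := by
    induction u using TensorProduct.induction_on with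
    | zero => simp
    | add a b ha hb => rw [map_add, add_smul, ← ha, ← hb]
    | tmul f l =>
      have (t : Module.Dual R M ⊗[R] M) :
          contractLeft R M t • (f ⊗ₜ[R] l) = f l • t := by
        induction t using TensorProduct.induction_on with
        | zero => simp
        | add a b ha hb => rw [map_add, add_smul, ha, hb, smul_add]
        | tmul g m =>
          rw [contractLeft_apply, ← tmul_smul, smul_comm_of_rank_eq_one h, tmul_smul, smul_tmul',
            hdual, smul_tmul']
      have h2 := this e
      rwa [he, one_smul] at h2
  refine ⟨fun u v huv => ?_, hsurj⟩
  rw [key u, key v, huv]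

theorem rank_eq_one_of_invertible [Module.Invertible R M] (p : PrimeSpectrum R) :
    Module.rankAtStalk (R := R) M p = 1 := by
  simp [Module.rankAtStalk, Module.Invertible.finrank_eq_one]

theorem smul_comm_of_invertible {M : Type} [AddCommMonoid M] [Module R M] [Module.Invertible R M]
    (f : M →ₗ[R] R) (x y : M) : f x • y = f y • x := by
  have h : x ⊗ₜ[R] y = y ⊗ₜ[R] x := Module.Invertible.tmul_comm ..
  simpa using congrArg (fun t => TensorProduct.lid R M (LinearMap.rTensor M f t)) h

/-- An ideal containing all values of linear forms on an invertible module is the unit ideal. -/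
theorem ideal_eq_top_of_invertible [Module.Invertible R M] (I : Ideal R)
    (hI : ∀ (f : M →ₗ[R] R) (m : M), f m ∈ I) : I = ⊤ := by
  rw [Ideal.eq_top_iff_one]
  obtain ⟨e, he⟩ := (Module.Invertible.bijective (R := R) (M := M)).2 1
  rw [← he]
  clear he
  induction e using TensorProduct.induction_on with
  | zero => simp
  | tmul f m => exact hI f m
  | add a b ha hb => rw [map_add]; exact add_mem ha hb

/-- Under the tensor-hom adjunction this map becomes `dualTensorHom`, which is bijective for
finitely generated projective `M`. -/
theorem dualDistrib_bijective [Module.Finite R M] [Module.Projective R M] :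
    Function.Bijective (TensorProduct.dualDistrib R M N) := by
  have h := dualTensorHom_bijective (R := R) (M := M) (N := Module.Dual R N)
  have hc : (TensorProduct.lift.equiv (RingHom.id R) M N R).symm.toLinearMap ∘ₗ
      TensorProduct.dualDistrib R M N = dualTensorHom R M (Module.Dual R N) := by
    ext f g m n
    simp
  rw [← hc] at h
  exact (Function.Bijective.of_comp_iff'
    (lift.equiv (RingHom.id R) M N R).symm.bijective (TensorProduct.dualDistrib R M N)).1 h

/-- Contraction of `N ⊗ M^∨` with an element of `M`. -/
noncomputable def contractDual (m : M) : N ⊗[R] Module.Dual R M →ₗ[R] N :=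
  (TensorProduct.rid R N).toLinearMap ∘ₗ
    LinearMap.lTensor N (Module.Dual.eval R M m)

@[simp] theorem contractDual_tmul (m : M) (n : N) (f : Module.Dual R M) :
    contractDual m (n ⊗ₜ f) = f m • n := by
  simp [contractDual]

/-- Tensors in `N ⊗ M^∨` are linear maps `M → N`. This allows a section of `E(0,1)` to be tested on
vectors of the line in the second factor. -/
theorem contractDual_ext [Module.Finite R M] [Module.Projective R M]
    {u w : N ⊗[R] Module.Dual R M} (h : ∀ m : M, contractDual m u = contractDual m w) : u = w := by
  have hb := (dualTensorHom_bijective (R := R) (M := M) (N := N)).1.comp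
    (TensorProduct.comm R N (Module.Dual R M)).injective
  refine hb (LinearMap.ext fun m => ?_)
  have key (t : N ⊗[R] Module.Dual R M) :
      dualTensorHom R M N (TensorProduct.comm R N (Module.Dual R M) t) m = contractDual m t := by
    induction t using TensorProduct.induction_on with
    | zero => simp
    | tmul a b => simp
    | add a b ha hb => simp only [map_add, LinearMap.add_apply, ha, hb]
  simp only [Function.comp_apply, key, h]

end InvertibleModules

/-! ### Direct summands and additivity of rank -/

section Summands

variable {R M N : Type*} [CommRing R] [AddCommGroup M] [Module R M] [AddCommGroup N] [Module R N]

theorem projective_quot_of_retraction [Module.Projective R M] (K : Submodule R M)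
    (r : M →ₗ[R] K) (hr : ∀ k : K, r k = k) : Module.Projective R (M ⧸ K) := by
  let s : M ⧸ K →ₗ[R] M := K.liftQ (LinearMap.id - K.subtype ∘ₗ r) (fun k hk => by
    simp [hr ⟨k, hk⟩])
  refine Module.Projective.of_split s K.mkQ ?_
  ext m
  simp [s]

theorem exists_linear_retraction (K : Submodule R M) [Module.Projective R (M ⧸ K)] :
    ∃ r : M →ₗ[R] K, ∀ k : K, r k = k := by
  obtain ⟨s, hs⟩ := Module.projective_lifting_property K.mkQ LinearMap.id K.mkQ_surjective
  have hmem (m : M) : m - s (K.mkQ m) ∈ K := by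
    refine (Submodule.Quotient.eq K).1 ?_
    exact (DFunLike.congr_fun hs (K.mkQ m)).symm
  refine ⟨LinearMap.codRestrict K (LinearMap.id - s ∘ₗ K.mkQ) hmem, fun k => ?_⟩
  ext
  have : K.mkQ k = 0 := by simp
  simp [LinearMap.codRestrict_apply, this]

/-- The rank is additive in a submodule with projective quotient. -/
theorem rankAtStalk_quot_add [Module.Finite R M] [Module.Projective R M] (K : Submodule R M)
    [Module.Projective R (M ⧸ K)] (p : PrimeSpectrum R) :
    Module.rankAtStalk (R := R) (M ⧸ K) p + Module.rankAtStalk (R := R) K p =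
      Module.rankAtStalk (R := R) M p := by
  obtain ⟨r, hr⟩ := exists_linear_retraction K
  have : Module.Finite R K := Module.Finite.of_surjective r fun k => ⟨k, hr k⟩
  have : Module.Projective R K := Module.Projective.of_split K.subtype r (LinearMap.ext hr)
  have hinj : Function.Injective (K.mkQ.prod r) := by
    rw [← LinearMap.ker_eq_bot, LinearMap.ker_eq_bot']
    intro m hm
    simp only [LinearMap.prod_apply, Function.prod_apply, Submodule.mkQ_apply, Prod.mk_eq_zero,
      Submodule.Quotient.mk_eq_zero] at hm
    have := hr ⟨m, hm.1⟩
    exact (congrArg Subtype.val (this.symm.trans hm.2) :)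
  have hsurj : Function.Surjective (K.mkQ.prod r) := by
    rintro ⟨q, k⟩
    obtain ⟨m, rfl⟩ := K.mkQ_surjective q
    refine ⟨m - r m + k, ?_⟩
    ext1
    · simp [(Submodule.Quotient.mk_eq_zero K).2 (r m).2, (Submodule.Quotient.mk_eq_zero K).2 k.2]
    · simp [hr]
  let e : M ≃ₗ[R] (M ⧸ K) × K := LinearEquiv.ofBijective _ ⟨hinj, hsurj⟩
  rw [Module.rankAtStalk_eq_of_equiv e, Module.rankAtStalk_prod]
  rfl

end Summands

/-! ### Coordinates on `A ⊗ ℂⁿ` -/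

section Coordinates

variable {A B : Type} [CommRing A] [CommRing B] [Algebra ℂ A] [Algebra ℂ B] {n : ℕ}

/-- The coordinates of an element of `A ⊗ ℂⁿ`. -/
noncomputable def coo (A : Type) [CommRing A] [Algebra ℂ A] (n : ℕ) :
    A ⊗[ℂ] (Fin n → ℂ) ≃ₗ[A] (Fin n → A) :=
  TensorProduct.piScalarRight ℂ A A (Fin n)

theorem coo_tmul (a : A) (v : Fin n → ℂ) (i : Fin n) : coo A n (a ⊗ₜ v) i = v i • a := by
  simp [coo]

theorem coo_extMap (φ : A →ₐ[ℂ] B) (u : A ⊗[ℂ] (Fin n → ℂ)) (i : Fin n) :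
    coo B n (extMap _ φ u) i = φ (coo A n u i) := by
  induction u using TensorProduct.induction_on with
  | zero => simp
  | tmul a v => simp [coo_tmul]
  | add x y hx hy => simp only [map_add, Pi.add_apply, hx, hy]

theorem extMap_coo_symm (φ : A →ₐ[ℂ] B) (v : Fin n → A) :
    extMap _ φ ((coo A n).symm v) = (coo B n).symm (fun i => φ (v i)) := by
  apply (coo B n).injective
  ext i
  rw [coo_extMap, LinearEquiv.apply_symm_apply, LinearEquiv.apply_symm_apply]

theorem rankAtStalk_tensor (p : PrimeSpectrum A) :
    Module.rankAtStalk (R := A) (A ⊗[ℂ] (Fin n → ℂ)) p = n := by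
  have : Nontrivial A := ⟨0, 1, fun h => p.2.ne_top ((Ideal.eq_top_iff_one _).2 (h ▸ zero_mem _))⟩
  rw [Module.rankAtStalk_eq_of_equiv (coo A n), Module.rankAtStalk_eq_finrank_of_free]
  simp

end Coordinates

/-! ### The symmetric square and multiplication by a line -/

section SymmetricSquare

variable {R M N P : Type} [CommRing R] [AddCommGroup M] [Module R M] [AddCommGroup N] [Module R N]
  [AddCommGroup P] [Module R P]

variable (R) in
/-- The product `x y` in the symmetric square. -/
def symMk (x y : M) : SymSq R M := Submodule.Quotient.mk (x ⊗ₜ[R] y)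

theorem symMk_comm (x y : M) : symMk R x y = symMk R y x :=
  (Submodule.Quotient.eq _).2 (Submodule.subset_span ⟨(x, y), rfl⟩)

theorem symMk_add_left (x x' y : M) : symMk R (x + x') y = symMk R x y + symMk R x' y := by
  simp [symMk, add_tmul]

theorem symMk_add_right (x y y' : M) : symMk R x (y + y') = symMk R x y + symMk R x y' := by
  simp [symMk, tmul_add]

theorem symMk_smul_left (r : R) (x y : M) : symMk R (r • x) y = r • symMk R x y := by
  rw [symMk, ← smul_tmul']; rfl

theorem symMk_smul_right (r : R) (x y : M) : symMk R x (r • y) = r • symMk R x y := by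
  rw [symMk, tmul_smul]; rfl

/-- The bilinear map `(x, y) ↦ x y`. -/
def symMkBilin (R M : Type) [CommRing R] [AddCommGroup M] [Module R M] :
    M →ₗ[R] M →ₗ[R] SymSq R M :=
  LinearMap.mk₂ R (symMk R) symMk_add_left symMk_smul_left symMk_add_right symMk_smul_right

@[simp] theorem symMkBilin_apply (x y : M) : symMkBilin R M x y = symMk R x y := rfl

theorem SymSq.induction {p : SymSq R M → Prop} (mk : ∀ x y, p (symMk R x y))
    (add : ∀ t t', p t → p t' → p (t + t')) (t : SymSq R M) : p t := by
  obtain ⟨u, rfl⟩ := Submodule.Quotient.mk_surjective _ t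
  induction u using TensorProduct.induction_on with
  | zero =>
    have h := mk 0 0
    rwa [symMk, zero_tmul] at h
  | tmul x y => exact mk x y
  | add x y hx hy => exact add _ _ hx hy

theorem SymSq.hom_ext {S : Type} [CommRing S] {φ : R →+* S} {Q : Type} [AddCommGroup Q] [Module S Q]
    {f g : SymSq R M →ₛₗ[φ] Q}
    (h : ∀ x y, f (symMk R x y) = g (symMk R x y)) : f = g := by
  refine LinearMap.ext fun t => ?_
  induction t using SymSq.induction with
  | mk x y => exact h x y
  | add t t' ht ht' => rw [map_add, map_add, ht, ht']

/-- The linear map on the symmetric square defined by a symmetric bilinear map. -/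
def symLift (f : M →ₗ[R] M →ₗ[R] P) (hf : ∀ x y, f x y = f y x) : SymSq R M →ₗ[R] P :=
  (symRel R M).liftQ (TensorProduct.lift f) (by
    refine Submodule.span_le.2 ?_
    rintro _ ⟨⟨x, y⟩, rfl⟩
    simp [hf x y])

@[simp] theorem symLift_symMk (f : M →ₗ[R] M →ₗ[R] P) (hf : ∀ x y, f x y = f y x) (x y : M) :
    symLift f hf (symMk R x y) = f x y := rfl

@[simp] theorem symSqMap_symMk {S : Type} [CommRing S] {φ : R →+* S} {Q : Type} [AddCommGroup Q]
    [Module S Q] (g : M →ₛₗ[φ] Q) (x y : M) :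
    symSqMap g (symMk R x y) = symMk S (g x) (g y) := rfl

/-- The multiplication `M ⊗ L → Sym² M` for a submodule `L` of `M`. -/
def symMulSub (L : Submodule R M) : M ⊗[R] L →ₗ[R] SymSq R M :=
  (symRel R M).mkQ ∘ₗ TensorProduct.map LinearMap.id L.subtype

@[simp] theorem symMulSub_tmul (L : Submodule R M) (m : M) (l : L) :
    symMulSub L (m ⊗ₜ l) = symMk R m l := rfl

/-- With a retraction `r` onto `L`, the inverse is `x y ↦ x ⊗ r y + y ⊗ r x - r x ⊗ r y`; the last
term removes the double count when a factor lies in `L`. It is symmetric because `l ⊗ l' = l' ⊗ l`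
in rank one. -/
theorem exists_leftInverse_symMulSub (L : Submodule R M) [Module.Projective R (M ⧸ L)]
    [Module.Invertible R L] :
    ∃ g : SymSq R M →ₗ[R] M ⊗[R] L, g ∘ₗ symMulSub L = LinearMap.id := by
  obtain ⟨r, hr⟩ := exists_linear_retraction L
  let g : M →ₗ[R] M →ₗ[R] M ⊗[R] L := (TensorProduct.mk R M L).compl₂ r
  let k : M →ₗ[R] M →ₗ[R] M ⊗[R] L := (TensorProduct.mk R M L).compl₁₂ (L.subtype ∘ₗ r) r
  have hcomm (l l' : L) : (l : M) ⊗ₜ[R] l' = (l' : M) ⊗ₜ[R] l :=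
    congrArg (TensorProduct.map L.subtype LinearMap.id)
      (Module.Invertible.tmul_comm (R := R) (m₁ := l) (m₂ := l'))
  have hsymm (x y : M) : (g + g.flip - k) x y = (g + g.flip - k) y x := by
    simp only [LinearMap.sub_apply, LinearMap.add_apply, LinearMap.flip_apply, k,
      LinearMap.compl₁₂_apply, TensorProduct.mk_apply, LinearMap.comp_apply, Submodule.subtype_apply,
      hcomm (r x) (r y)]
    rw [add_comm (g x y)]
  refine ⟨symLift (g + g.flip - k) hsymm, ?_⟩
  ext m l
  simp [g, k, hr, hcomm l (r m)]

theorem symMulSub_injective (L : Submodule R M) [Module.Projective R (M ⧸ L)]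
    [Module.Invertible R L] : Function.Injective (symMulSub L) := by
  obtain ⟨g, hg⟩ := exists_leftInverse_symMulSub L
  exact Function.LeftInverse.injective (g := g) fun t => DFunLike.congr_fun hg t

theorem symSqMap_surjective (f : M →ₗ[R] N) (hf : Function.Surjective f) :
    Function.Surjective (symSqMap f) := by
  intro t
  induction t using SymSq.induction with
  | mk x y =>
    obtain ⟨a, rfl⟩ := hf x
    obtain ⟨b, rfl⟩ := hf y
    exact ⟨symMk R a b, rfl⟩
  | add t t' ht ht' =>
    obtain ⟨a, rfl⟩ := ht
    obtain ⟨b, rfl⟩ := ht'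
    exact ⟨a + b, map_add _ _ _⟩

/-- For a section `s` of the quotient map, writing `s x`, `s y` for the lifts of the classes, `x y -
(s x)(s y) = (s x)(y - s y) + y (x - s x)`, and the second factors lie in `L`. -/
theorem symMulSub_exact (L : Submodule R M) [Module.Projective R (M ⧸ L)] :
    Function.Exact (symMulSub L) (symSqMap L.mkQ) := by
  obtain ⟨s, hs⟩ := Module.projective_lifting_property L.mkQ LinearMap.id L.mkQ_surjective
  have hmem (m : M) : m - s (L.mkQ m) ∈ L :=
    (Submodule.Quotient.eq L).1 (DFunLike.congr_fun hs (L.mkQ m)).symm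
  have key (t : SymSq R M) : t - symSqMap s (symSqMap L.mkQ t) ∈ LinearMap.range (symMulSub L) := by
    induction t using SymSq.induction with
    | mk x y =>
      refine ⟨s (L.mkQ x) ⊗ₜ ⟨_, hmem y⟩ + y ⊗ₜ ⟨_, hmem x⟩, ?_⟩
      have hsub (a b c : M) : symMk R a (b - c) = symMk R a b - symMk R a c :=
        map_sub (symMkBilin R M a) b c
      simp only [map_add, symMulSub_tmul, symSqMap_symMk, hsub]
      rw [symMk_comm y x, symMk_comm y]
      abel
    | add t t' ht ht' =>
      have := add_mem ht ht'
      rwa [map_add, map_add, add_sub_add_comm]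
  intro t
  constructor
  · intro ht
    have := key t
    rwa [ht, map_zero, sub_zero] at this
  · rintro ⟨u, rfl⟩
    induction u using TensorProduct.induction_on with
    | zero => simp
    | tmul m l =>
      rw [symMulSub_tmul, symSqMap_symMk]
      have : L.mkQ (l : M) = 0 := by simp
      rw [this, ← symMkBilin_apply, map_zero]
    | add a b ha hb => rw [map_add, map_add, ha, hb, add_zero]

end SymmetricSquare

/-! ### Coordinates on the symmetric square -/

section SymmetricCoordinates

variable {A B : Type} [CommRing A] [CommRing B] [Algebra ℂ A] [Algebra ℂ B] {n : ℕ}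

/-- The coordinate `x y ↦ (x_a y_b + x_b y_a) / 2` on `Sym² (A ⊗ ℂⁿ)`. -/
noncomputable def symCoo (A : Type) [CommRing A] [Algebra ℂ A] {n : ℕ} (a b : Fin n) :
    SymSq A (A ⊗[ℂ] (Fin n → ℂ)) →ₗ[A] A :=
  symLift (LinearMap.mk₂ A
    (fun x y => algebraMap ℂ A (1 / 2) * (coo A n x a * coo A n y b + coo A n x b * coo A n y a))
    (fun x x' y => by simp; ring) (fun r x y => by simp; ring)
    (fun x y y' => by simp; ring) (fun r x y => by simp; ring))
    (fun x y => by simp; ring)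

theorem symCoo_symMk (a b : Fin n) (x y : A ⊗[ℂ] (Fin n → ℂ)) :
    symCoo A a b (symMk A x y) =
      algebraMap ℂ A (1 / 2) * (coo A n x a * coo A n y b + coo A n x b * coo A n y a) := rfl

theorem half_add_half (A : Type) [CommRing A] [Algebra ℂ A] :
    algebraMap ℂ A (1 / 2) * 2 = 1 := by
  rw [← map_ofNat (algebraMap ℂ A) 2, ← map_mul]
  simp

theorem symCoo_symMk_self (a b : Fin n) (x : A ⊗[ℂ] (Fin n → ℂ)) :
    symCoo A a b (symMk A x x) = coo A n x a * coo A n x b := by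
  rw [symCoo_symMk, mul_comm (coo A n x b), ← two_mul, ← mul_assoc, half_add_half, one_mul]

theorem symCoo_comm (a b : Fin n) : symCoo A a b = symCoo A b a := by
  apply SymSq.hom_ext
  intro x y
  rw [symCoo_symMk, symCoo_symMk, add_comm]

theorem symCoo_symSqMap (φ : A →ₐ[ℂ] B) (a b : Fin n) (t : SymSq A (A ⊗[ℂ] (Fin n → ℂ))) :
    symCoo B a b (symSqMap (extMap _ φ) t) = φ (symCoo A a b t) := by
  induction t using SymSq.induction with
  | mk x y => simp [symCoo_symMk, coo_extMap, -one_div]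
  | add t t' ht ht' => simp only [map_add, ht, ht']

/-- The basis vectors of `A ⊗ ℂⁿ`. -/
noncomputable def stdVec (A : Type) [CommRing A] [Algebra ℂ A] {n : ℕ} (i : Fin n) :
    A ⊗[ℂ] (Fin n → ℂ) := (coo A n).symm (Pi.single i 1)

theorem coo_stdVec (i j : Fin n) : coo A n (stdVec A i) j = if j = i then 1 else 0 := by
  simp [stdVec, Pi.single_apply]

theorem sum_coo_stdVec (u : A ⊗[ℂ] (Fin n → ℂ)) : ∑ i, coo A n u i • stdVec A i = u := by
  apply (coo A n).injective
  ext j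
  simp [coo_stdVec]

/-- The sum runs over ordered pairs. The two terms of `symCoo` pick out `(c, d)` and `(d, c)`, where
`f` has the same value, and the factor `1 / 2` averages them. -/
theorem symCoo_sum (f : Sym2 (Fin n) → A) (c d : Fin n) :
    symCoo A c d (∑ a, ∑ b, f s(a, b) • symMk A (stdVec A a) (stdVec A b)) = f s(c, d) := by
  simp only [map_sum, map_smul, symCoo_symMk, coo_stdVec, smul_eq_mul]
  have (a b : Fin n) : f s(a, b) * (algebraMap ℂ A (1 / 2) *
      ((if c = a then 1 else 0) * (if d = b then 1 else 0) +
        (if d = a then 1 else 0) * (if c = b then 1 else 0))) =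
      (if c = a then if d = b then algebraMap ℂ A (1 / 2) * f s(a, b) else 0 else 0) +
      (if d = a then if c = b then algebraMap ℂ A (1 / 2) * f s(a, b) else 0 else 0) := by
    split_ifs <;> ring
  simp only [this, Finset.sum_add_distrib]
  simp only [Finset.sum_ite_irrel, Finset.sum_ite_eq, Finset.mem_univ, if_true,
    Finset.sum_const_zero, Sym2.eq_swap (a := d) (b := c), ← mul_two, mul_right_comm _ _ (2 : A),
    half_add_half, one_mul]

theorem symSq_eq_sum (t : SymSq A (A ⊗[ℂ] (Fin n → ℂ))) :
    ∑ a, ∑ b, symCoo A a b t • symMk A (stdVec A a) (stdVec A b) = t := by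
  induction t using SymSq.induction with
  | add t t' ht ht' =>
    conv_rhs => rw [← ht, ← ht']
    simp only [map_add, add_smul, Finset.sum_add_distrib]
  | mk x y =>
    have hx : symMk A x y = ∑ a, ∑ b, (coo A n x a * coo A n y b) •
        symMk A (stdVec A a) (stdVec A b) := by
      conv_lhs => rw [← sum_coo_stdVec x, ← sum_coo_stdVec y, ← symMkBilin_apply]
      simp only [map_sum, LinearMap.sum_apply, map_smul, LinearMap.smul_apply, symMkBilin_apply,
        smul_smul, Finset.smul_sum]
      rw [Finset.sum_comm]
      simp only [mul_comm]
    have hy : ∑ a, ∑ b, (coo A n x b * coo A n y a) •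
        symMk A (stdVec A a) (stdVec A b) = symMk A x y := by
      rw [hx, Finset.sum_comm]
      refine Finset.sum_congr rfl fun a _ => Finset.sum_congr rfl fun b _ => ?_
      rw [symMk_comm]
    simp only [symCoo_symMk, mul_smul (algebraMap ℂ A (1 / 2)), add_smul, ← Finset.smul_sum,
      Finset.sum_add_distrib]
    rw [hy, ← hx, ← two_smul A, ← mul_smul, half_add_half, one_smul]

/-- The coordinates of an element of `Sym² (A ⊗ ℂⁿ)`. -/
noncomputable def symSqCoords (A : Type) [CommRing A] [Algebra ℂ A] (n : ℕ) :
    SymSq A (A ⊗[ℂ] (Fin n → ℂ)) →ₗ[A] (Sym2 (Fin n) → A) where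
  toFun t z := z.lift ⟨fun a b => symCoo A a b t, fun a b => by simp only [symCoo_comm]⟩
  map_add' t t' := by
    ext z
    induction z with | _ a b => simp
  map_smul' r t := by
    ext z
    induction z with | _ a b => simp

/-- The isomorphism of `Sym² (A ⊗ ℂⁿ)` with a free module given by the coordinates. -/
noncomputable def symSqEquiv (A : Type) [CommRing A] [Algebra ℂ A] (n : ℕ) :
    SymSq A (A ⊗[ℂ] (Fin n → ℂ)) ≃ₗ[A] (Sym2 (Fin n) → A) where
  __ := symSqCoords A n
  invFun f := ∑ a, ∑ b, f s(a, b) • symMk A (stdVec A a) (stdVec A b)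
  left_inv t := symSq_eq_sum t
  right_inv f := by
    ext z
    induction z with | _ c d => exact symCoo_sum f c d

theorem symSqEquiv_apply (t : SymSq A (A ⊗[ℂ] (Fin n → ℂ))) (a b : Fin n) :
    symSqEquiv A n t s(a, b) = symCoo A a b t := rfl

theorem symCoo_ext {t t' : SymSq A (A ⊗[ℂ] (Fin n → ℂ))}
    (h : ∀ a b, symCoo A a b t = symCoo A a b t') : t = t' := by
  apply (symSqEquiv A n).injective
  ext z
  induction z with | _ a b => exact h a b

end SymmetricCoordinates

/-! ### Maps on quotients and a splitting of `L ⊗ L → Sym² M` -/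

section Quotients

variable {R M N P Q : Type*} [CommRing R] [AddCommGroup M] [Module R M] [AddCommGroup N]
  [Module R N] [AddCommGroup P] [Module R P] [AddCommGroup Q] [Module R Q]

theorem projective_quot_range {N : Type} [AddCommMonoid N] [Module R N] [Module.Projective R M]
    (f : N →ₗ[R] M) (g : M →ₗ[R] N)
    (h : g ∘ₗ f = LinearMap.id) : Module.Projective R (M ⧸ LinearMap.range f) := by
  refine projective_quot_of_retraction _ (f.rangeRestrict ∘ₗ g) ?_
  rintro ⟨_, n, rfl⟩
  ext
  exact congrArg f (DFunLike.congr_fun h n)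

/-- The map induced on the target of a surjection. -/
noncomputable def descLin (f : M →ₗ[R] N) (hf : Function.Surjective f) (g : M →ₗ[R] P)
    (hg : ∀ m, f m = 0 → g m = 0) : N →ₗ[R] P :=
  (LinearMap.ker f).liftQ g (fun m hm => hg m hm) ∘ₗ
    (f.quotKerEquivOfSurjective hf).symm.toLinearMap

theorem descLin_apply (f : M →ₗ[R] N) (hf : Function.Surjective f) (g : M →ₗ[R] P)
    (hg : ∀ m, f m = 0 → g m = 0) (m : M) : descLin f hf g hg (f m) = g m := by
  have : (f.quotKerEquivOfSurjective hf).symm (f m) = Submodule.Quotient.mk m := by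
    rw [LinearEquiv.symm_apply_eq]; rfl
  rw [descLin, LinearMap.comp_apply, LinearEquiv.coe_coe, this]
  exact Submodule.liftQ_apply _ _ _

/-- The left inverse onto `M ⊗ L` followed by a retraction `M → L` in the first factor. This
splitting is what makes the cokernel of `O(-2) → Sym² V ⊗ O` locally free. -/
theorem exists_leftInverse_symMulSub_rTensor {R M : Type} [CommRing R] [AddCommGroup M]
    [Module R M] (L : Submodule R M) [Module.Projective R (M ⧸ L)] [Module.Invertible R L] :
    ∃ g : SymSq R M →ₗ[R] L ⊗[R] L,
      ∀ t, g (symMulSub L (LinearMap.rTensor L L.subtype t)) = t := by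
  obtain ⟨g, hg⟩ := exists_leftInverse_symMulSub L
  obtain ⟨r, hr⟩ := exists_linear_retraction L
  refine ⟨LinearMap.rTensor L r ∘ₗ g, fun t => ?_⟩
  rw [LinearMap.comp_apply, show g (symMulSub L (LinearMap.rTensor L L.subtype t)) = _ from
    DFunLike.congr_fun hg _, LinearMap.id_apply, ← LinearMap.comp_apply, ← LinearMap.rTensor_comp,
    show r ∘ₗ L.subtype = LinearMap.id from LinearMap.ext hr, LinearMap.rTensor_id,
    LinearMap.id_apply]

end Quotients

/-! ### Morphisms and cokernels of vector bundles -/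

namespace VecBundle

variable {X : CSpace} {E F G H : VecBundle X}

theorem comp_app (α : E ⟶ F) (β : F ⟶ G) {A : CommAlgCat.{0} ℂ} (x : X.obj A) (v : E.fib x) :
    Hom.app (α ≫ β) x v = Hom.app β x (Hom.app α x v) := rfl

theorem hom_ext' {α β : E ⟶ F}
    (h : ∀ {A : CommAlgCat.{0} ℂ} (x : X.obj A) (v : E.fib x), Hom.app α x v = Hom.app β x v) :
    α = β := by
  apply Hom.ext
  funext A x
  exact LinearMap.ext fun v => h x v

/-- Factorization through a surjective morphism of bundles. -/
noncomputable def desc (β : F ⟶ G)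
    (hβ : ∀ {A : CommAlgCat.{0} ℂ} (x : X.obj A), Function.Surjective (Hom.app β x)) (γ : F ⟶ H)
    (hγ : ∀ {A : CommAlgCat.{0} ℂ} (x : X.obj A) (u : F.fib x),
      Hom.app β x u = 0 → Hom.app γ x u = 0) : G ⟶ H where
  app x := descLin (Hom.app β x) (hβ x) (Hom.app γ x) (hγ x)
  naturality φ x y h v := by
    obtain ⟨u, rfl⟩ := hβ x v
    rw [← Hom.naturality β, descLin_apply, descLin_apply, Hom.naturality γ]

theorem desc_app (β : F ⟶ G)
    (hβ : ∀ {A : CommAlgCat.{0} ℂ} (x : X.obj A), Function.Surjective (Hom.app β x)) (γ : F ⟶ H)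
    (hγ : ∀ {A : CommAlgCat.{0} ℂ} (x : X.obj A) (u : F.fib x),
      Hom.app β x u = 0 → Hom.app γ x u = 0) {A : CommAlgCat.{0} ℂ} (x : X.obj A) (u : F.fib x) :
    Hom.app (desc β hβ γ hγ) x (Hom.app β x u) = Hom.app γ x u :=
  descLin_apply ..

theorem comp_desc (β : F ⟶ G)
    (hβ : ∀ {A : CommAlgCat.{0} ℂ} (x : X.obj A), Function.Surjective (Hom.app β x)) (γ : F ⟶ H)
    (hγ : ∀ {A : CommAlgCat.{0} ℂ} (x : X.obj A) (u : F.fib x),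
      Hom.app β x u = 0 → Hom.app γ x u = 0) : β ≫ desc β hβ γ hγ = γ :=
  hom_ext' fun x u => desc_app β hβ γ hγ x u

theorem epi_of_surjective (β : F ⟶ G)
    (hβ : ∀ {A : CommAlgCat.{0} ℂ} (x : X.obj A), Function.Surjective (Hom.app β x)) : Epi β where
  left_cancellation γ γ' h := hom_ext' fun x v => by
    obtain ⟨u, rfl⟩ := hβ x v
    exact DFunLike.congr_fun (congrArg (fun α => Hom.app α x) h) u

/-- An isomorphism of bundles from compatible isomorphisms of the fibres. -/
def isoOfEquiv (e : ∀ {A : CommAlgCat.{0} ℂ} (x : X.obj A), E.fib x ≃ₗ[A] F.fib x)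
    (he : ∀ {A B : CommAlgCat.{0} ℂ} (φ : A ⟶ B) {x : X.obj A} {y : X.obj B}
      (h : X.map φ x = y) (v : E.fib x), e y (E.map φ h v) = F.map φ h (e x v)) : E ≅ F where
  hom := { app := fun x => (e x).toLinearMap, naturality := he }
  inv :=
    { app := fun x => (e x).symm.toLinearMap
      naturality := fun φ x y h v => by
        change (e y).symm _ = _
        rw [LinearEquiv.symm_apply_eq]
        refine Eq.trans ?_ (he φ h _).symm
        congr 1
        exact ((e x).apply_symm_apply v).symm }
  hom_inv_id := hom_ext' fun x v => (e x).symm_apply_apply v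
  inv_hom_id := hom_ext' fun x v => (e x).apply_symm_apply v

/-- The cokernel of a morphism of bundles with projective cokernels. -/
noncomputable def cokernelBundle (α : E ⟶ F)
    (hα : ∀ {A : CommAlgCat.{0} ℂ} (x : X.obj A),
      Module.Projective A (F.fib x ⧸ LinearMap.range (Hom.app α x))) : VecBundle X where
  fib x := F.fib x ⧸ LinearMap.range (Hom.app α x)
  projective x := hα x
  map φ x y h := quotMap (F.map φ h) _ _ (by
    rintro _ ⟨u, rfl⟩
    exact ⟨E.map φ h u, Hom.naturality α φ h u⟩)
  map_id h v := by
    obtain ⟨t, rfl⟩ := Submodule.Quotient.mk_surjective _ v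
    exact congrArg _ (F.map_id h t)
  map_comp φ ψ _ _ _ h h' h'' v := by
    obtain ⟨t, rfl⟩ := Submodule.Quotient.mk_surjective _ v
    exact congrArg _ (F.map_comp φ ψ h h' h'' t)
  -- The range over `B` is spanned by the image of the range over `A`, because `E` itself satisfies
  -- base change.
  baseChange {A B} φ x y h := (F.baseChange φ h).quot _ _ _ (by
    rintro _ ⟨u, rfl⟩
    have hu : u ∈ Submodule.span B (Set.range (E.map φ h)) := by
      rw [(E.baseChange φ h).span_range]; trivial
    induction hu using Submodule.span_induction with
    | mem u hu =>
      obtain ⟨w, rfl⟩ := hu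
      exact Submodule.subset_span ⟨Hom.app α x w, ⟨w, rfl⟩, (Hom.naturality α φ h w).symm⟩
    | zero => rw [map_zero]; exact zero_mem _
    | add a b _ _ ha hb => rw [map_add]; exact add_mem ha hb
    | smul r a _ ha => rw [map_smul]; exact Submodule.smul_mem _ _ ha)

/-- The projection to the cokernel. -/
noncomputable def cokernelProj (α : E ⟶ F)
    (hα : ∀ {A : CommAlgCat.{0} ℂ} (x : X.obj A),
      Module.Projective A (F.fib x ⧸ LinearMap.range (Hom.app α x))) :
    F ⟶ cokernelBundle α hα where
  app x := (LinearMap.range (Hom.app α x)).mkQ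
  naturality _ _ _ _ _ := rfl

theorem cokernel_isShortExact (α : E ⟶ F)
    (hα : ∀ {A : CommAlgCat.{0} ℂ} (x : X.obj A),
      Module.Projective A (F.fib x ⧸ LinearMap.range (Hom.app α x)))
    (hinj : ∀ {A : CommAlgCat.{0} ℂ} (x : X.obj A), Function.Injective (Hom.app α x)) :
    IsShortExact α (cokernelProj α hα) :=
  fun x => ⟨hinj x, LinearMap.exact_map_mkQ_range _, Submodule.mkQ_surjective _⟩

end VecBundle

open VecBundle

/-! ### Invertibility of the tautological line -/

section Lines

variable {n : ℕ} {A : CommAlgCat.{0} ℂ}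

theorem rankAtStalk_line (x : (projectiveSpace n).obj A) (p : PrimeSpectrum A) :
    Module.rankAtStalk (R := A) (line x) p = 1 := by
  have h := rankAtStalk_quot_add (line x) p
  rw [rankAtStalk_tensor] at h
  have h2 : Module.rankAtStalk (R := A) ((A ⊗[ℂ] (Fin (n + 1) → ℂ)) ⧸ line x) p = n :=
    Module.Grassmannian.rankAtStalk_eq x p
  omega

instance invertible_line (x : (projectiveSpace n).obj A) : Module.Invertible A (line x) := by
  have := finite_of_quot_projective (line x)
  have := projective_of_quot_projective (line x)
  exact invertible_of_rank_eq_one (rankAtStalk_line x)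

instance invertible_taut (x : (projectiveSpace n).obj A) : Module.Invertible A ((taut n).fib x) :=
  invertible_line x

end Lines

/-! ### The two exact sequences, the basis of `Sym² V`, and existence of the diagram -/

theorem euler_isShortExact (n : ℕ) : IsShortExact (eulerIncl n) (eulerProj n) := fun x =>
  ⟨Module.Flat.rTensor_preserves_injective_linearMap (M := line x) (line x).subtype
      (line x).subtype_injective,
    rTensor_exact (line x) (LinearMap.exact_subtype_mkQ (line x)) (line x).mkQ_surjective,
    LinearMap.rTensor_surjective (line x) (line x).mkQ_surjective⟩

theorem sym_isShortExact (n : ℕ) : IsShortExact (symIncl n) (symProj n) := fun x =>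
  ⟨symMulSub_injective (line x), symMulSub_exact (line x),
    symSqMap_surjective (line x).mkQ (line x).mkQ_surjective⟩

theorem card_sym2_fin_four : Fintype.card (Sym2 (Fin 4)) = 10 := by
  rw [Sym2.card]; rfl

/-- A numbering of the monomials of degree two in four variables. -/
noncomputable def monomialEquiv : Sym2 (Fin 4) ≃ Fin 10 :=
  Fintype.equivFinOfCardEq card_sym2_fin_four

/-- The first variable of a monomial of degree two. -/
noncomputable def fstVar (i : Fin 10) : Fin 4 := (monomialEquiv.symm i).out.1

/-- The second variable of a monomial of degree two. -/
noncomputable def sndVar (i : Fin 10) : Fin 4 := (monomialEquiv.symm i).out.2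

theorem monomialEquiv_symm (i : Fin 10) : monomialEquiv.symm i = s(fstVar i, sndVar i) :=
  (Quot.out_eq (monomialEquiv.symm i)).symm

theorem exists_monomial (a b : Fin 4) :
    ∃ i, (fstVar i = a ∧ sndVar i = b) ∨ (fstVar i = b ∧ sndVar i = a) := by
  refine ⟨monomialEquiv s(a, b), ?_⟩
  have := monomialEquiv_symm (monomialEquiv s(a, b))
  rw [Equiv.symm_apply_apply, Sym2.eq_iff] at this
  tauto

/-- The isomorphism `Sym² (A ⊗ ℂ⁴) ≃ A ⊗ ℂ¹⁰`. -/
noncomputable def symCoordEquiv (A : Type) [CommRing A] [Algebra ℂ A] :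
    SymSq A (A ⊗[ℂ] (Fin 4 → ℂ)) ≃ₗ[A] A ⊗[ℂ] (Fin 10 → ℂ) :=
  symSqEquiv A 4 ≪≫ₗ LinearEquiv.funCongrLeft A A monomialEquiv.symm ≪≫ₗ (coo A 10).symm

theorem coo_symCoordEquiv {A : Type} [CommRing A] [Algebra ℂ A]
    (t : SymSq A (A ⊗[ℂ] (Fin 4 → ℂ))) (i : Fin 10) :
    coo A 10 (symCoordEquiv A t) i = symCoo A (fstVar i) (sndVar i) t := by
  rw [symCoordEquiv, LinearEquiv.trans_apply, LinearEquiv.trans_apply,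
    LinearEquiv.apply_symm_apply, LinearEquiv.funCongrLeft_apply, LinearMap.funLeft_apply,
    monomialEquiv_symm, symSqEquiv_apply]

/-- The isomorphism `Sym² V ⊗ O ≅ O^{10}`. -/
noncomputable def symTrivialIso :
    (trivV 3).sym2 ≅ VecBundle.trivial (projectiveSpace 3) (Fin 10 → ℂ) :=
  isoOfEquiv (fun {A} _ => symCoordEquiv A) fun {A B} φ x y h v => by
    apply (coo B 10).injective
    ext i
    exact (coo_symCoordEquiv _ i).trans ((symCoo_symSqMap φ.hom _ _ v).trans
      (((coo_extMap φ.hom _ i).trans (congrArg φ.hom (coo_symCoordEquiv v i))).symm))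

theorem snake_leftInverse {n : ℕ} {A : CommAlgCat.{0} ℂ} (x : (projectiveSpace n).obj A) :
    ∃ g : (trivV n).sym2.fib x →ₗ[A] (ONegTwo n).fib x,
      g ∘ₗ Hom.app (eulerIncl n ≫ symIncl n) x = LinearMap.id := by
  obtain ⟨g, hg⟩ := exists_leftInverse_symMulSub_rTensor (line x)
  exact ⟨g, LinearMap.ext hg⟩

theorem snake_projective {n : ℕ} {A : CommAlgCat.{0} ℂ} (x : (projectiveSpace n).obj A) :
    Module.Projective A ((trivV n).sym2.fib x ⧸
      LinearMap.range (Hom.app (eulerIncl n ≫ symIncl n) x)) := by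
  obtain ⟨g, hg⟩ := snake_leftInverse x
  exact projective_quot_range _ g hg

/-- `Λ` is the cokernel of the composite `O(-2) → Sym² V ⊗ O`, with `j` and `p` induced on
quotients. The last column is exact by a chase that lifts along the surjections `eulerProj` and `b`.
-/
theorem snake_exists (n : ℕ) : Nonempty (SnakeDiagram n) := by
  have he {A : CommAlgCat.{0} ℂ} (x : (projectiveSpace n).obj A) := euler_isShortExact n x
  have hs {A : CommAlgCat.{0} ℂ} (x : (projectiveSpace n).obj A) := sym_isShortExact n x
  have hrow : IsShortExact (eulerIncl n ≫ symIncl n)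
      (cokernelProj (eulerIncl n ≫ symIncl n) snake_projective) :=
    cokernel_isShortExact (eulerIncl n ≫ symIncl n) snake_projective
    fun x => (hs x).1.comp (he x).1
  let b := cokernelProj (eulerIncl n ≫ symIncl n) snake_projective
  have hb {A : CommAlgCat.{0} ℂ} (x : (projectiveSpace n).obj A) := hrow x
  have hj {A : CommAlgCat.{0} ℂ} (x : (projectiveSpace n).obj A)
      (u : ((trivV n).tensor (taut n)).fib x) (hu : Hom.app (eulerProj n) x u = 0) :
      Hom.app (symIncl n ≫ b) x u = 0 := by
    obtain ⟨t, rfl⟩ := ((he x).2.1 u).1 hu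
    exact ((hb x).2.1 _).2 ⟨t, rfl⟩
  have hp {A : CommAlgCat.{0} ℂ} (x : (projectiveSpace n).obj A)
      (u : (trivV n).sym2.fib x) (hu : Hom.app b x u = 0) : Hom.app (symProj n) x u = 0 := by
    obtain ⟨t, rfl⟩ := ((hb x).2.1 u).1 hu
    exact ((hs x).2.1 _).2 ⟨_, rfl⟩
  let j := desc (eulerProj n) (fun x => (he x).2.2) (symIncl n ≫ b) hj
  let p := desc b (fun x => (hb x).2.2) (symProj n) hp
  have hjapp {A : CommAlgCat.{0} ℂ} (x : (projectiveSpace n).obj A)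
      (u : ((trivV n).tensor (taut n)).fib x) : Hom.app j x (Hom.app (eulerProj n) x u) =
      Hom.app b x (Hom.app (symIncl n) x u) :=
    desc_app (eulerProj n) (fun x => (he x).2.2) (symIncl n ≫ b) hj x u
  have hpapp {A : CommAlgCat.{0} ℂ} (x : (projectiveSpace n).obj A)
      (u : (trivV n).sym2.fib x) : Hom.app p x (Hom.app b x u) = Hom.app (symProj n) x u :=
    desc_app b (fun x => (hb x).2.2) (symProj n) hp x u
  refine ⟨⟨_, b, j, p, hrow, fun {A} x => ⟨?_, ?_, ?_⟩, ?_, ?_⟩⟩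
  · rw [← LinearMap.ker_eq_bot, LinearMap.ker_eq_bot']
    intro w hw
    obtain ⟨u, rfl⟩ := (he x).2.2 w
    rw [hjapp] at hw
    obtain ⟨t, ht⟩ := ((hb x).2.1 _).1 hw
    rw [← (hs x).1 ht]
    exact ((he x).2.1 _).2 ⟨t, rfl⟩
  · intro l
    constructor
    · intro hl
      obtain ⟨s, rfl⟩ := (hb x).2.2 l
      rw [hpapp] at hl
      obtain ⟨u, rfl⟩ := ((hs x).2.1 _).1 hl
      exact ⟨_, hjapp x u⟩
    · rintro ⟨w, rfl⟩
      obtain ⟨u, rfl⟩ := (he x).2.2 w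
      rw [hjapp, hpapp]
      exact ((hs x).2.1 _).2 ⟨u, rfl⟩
  · intro s
    obtain ⟨t, rfl⟩ := (hs x).2.2 s
    exact ⟨_, hpapp x t⟩
  · exact hom_ext' fun x u => (hjapp x u).symm
  · exact hom_ext' fun x u => hpapp x u

/-! ### Uniqueness of the diagram and rank of `Λ` -/

namespace SnakeDiagram

variable {n : ℕ} (D D' : SnakeDiagram n)

theorem b_surjective {A : CommAlgCat.{0} ℂ} (x : (projectiveSpace n).obj A) :
    Function.Surjective (Hom.app D.b x) :=
  (D.row_exact x).2.2

theorem b_eq_zero_iff {A : CommAlgCat.{0} ℂ} (x : (projectiveSpace n).obj A)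
    (u : (trivV n).sym2.fib x) : Hom.app D.b x u = 0 ↔
      ∃ t, Hom.app (eulerIncl n ≫ symIncl n) x t = u :=
  (D.row_exact x).2.1 u

/-- The comparison map between two completions. -/
noncomputable def comparison : D.Λ ⟶ D'.Λ :=
  desc D.b D.b_surjective D'.b fun x u hu =>
    (D'.b_eq_zero_iff x u).2 ((D.b_eq_zero_iff x u).1 hu)

theorem b_comparison : D.b ≫ D.comparison D' = D'.b :=
  comp_desc D.b D.b_surjective D'.b fun x u hu =>
    (D'.b_eq_zero_iff x u).2 ((D.b_eq_zero_iff x u).1 hu)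

/-- In both diagrams `b` is a cokernel of the same map, so compatibility with `b` alone determines
the isomorphism. Compatibility with `j` and `p` follows by cancelling the epimorphisms `eulerProj`
and `b`. -/
theorem existsUnique_iso : ∃! φ : D.Λ ≅ D'.Λ,
    D.b ≫ φ.hom = D'.b ∧ D.j ≫ φ.hom = D'.j ∧ φ.hom ≫ D'.p = D.p := by
  have hb := epi_of_surjective D.b D.b_surjective
  have hb' := epi_of_surjective D'.b D'.b_surjective
  have he := epi_of_surjective (eulerProj n) fun x => (euler_isShortExact n x).2.2
  refine ⟨⟨D.comparison D', D'.comparison D, ?_, ?_⟩, ⟨D.b_comparison D', ?_, ?_⟩, ?_⟩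
  · rw [← cancel_epi D.b, ← Category.assoc, b_comparison, b_comparison, Category.comp_id]
  · rw [← cancel_epi D'.b, ← Category.assoc, b_comparison, b_comparison, Category.comp_id]
  · rw [← cancel_epi (eulerProj n), ← Category.assoc, ← D.comm_top, ← D'.comm_top, Category.assoc,
      b_comparison]
  · rw [← cancel_epi D.b, ← Category.assoc, b_comparison, D.comm_bottom, D'.comm_bottom]
  · rintro φ ⟨hφ, -, -⟩
    ext1
    rw [← cancel_epi D.b, hφ, b_comparison]

/-- `Λ` is the quotient of `Sym² V ⊗ O`, of rank ten, by a copy of the invertible `O(-2)`. -/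
theorem hasRank_nine (D : SnakeDiagram 3) : D.Λ.HasRank 9 := by
  intro A x p
  have := snake_projective x
  obtain ⟨g, hg⟩ := snake_leftInverse x
  have hinj : Function.Injective (Hom.app (eulerIncl 3 ≫ symIncl 3) x) := (D.row_exact x).1
  let K := LinearMap.range (Hom.app (eulerIncl 3 ≫ symIncl 3) x)
  have h := rankAtStalk_quot_add K p
  have hK : Module.rankAtStalk (R := A) K p = 1 := by
    rw [← Module.rankAtStalk_eq_of_equiv (LinearEquiv.ofInjective _ hinj)]
    have : Module.Invertible A ((ONegTwo 3).fib x) :=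
      inferInstanceAs (Module.Invertible A ((taut 3).fib x ⊗[A] (taut 3).fib x))
    exact rank_eq_one_of_invertible p
  have hker : LinearMap.ker (Hom.app D.b x) = K := by
    ext u
    exact D.b_eq_zero_iff x u
  have e : ((trivV 3).sym2.fib x ⧸ K) ≃ₗ[A] D.Λ.fib x :=
    Submodule.quotEquivOfEq _ _ hker.symm ≪≫ₗ
      (Hom.app D.b x).quotKerEquivOfSurjective (D.b_surjective x)
  have hS : Module.rankAtStalk (R := A) ((trivV 3).sym2.fib x) p = 10 := by
    rw [Module.rankAtStalk_eq_of_equiv (show (trivV 3).sym2.fib x ≃ₗ[A] A ⊗[ℂ] (Fin 10 → ℂ) from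
      symCoordEquiv A), rankAtStalk_tensor]
  rw [← Module.rankAtStalk_eq_of_equiv e]
  omega

end SnakeDiagram

/-! ### The action of the general linear group on `Λ` -/

namespace SnakeDiagram

variable {n : ℕ} (D : SnakeDiagram n)

/-- The map `Sym² V → Λ` on fibres. -/
def bFib {A : CommAlgCat.{0} ℂ} (x : (projectiveSpace n).obj A) :
    SymSq A (A ⊗[ℂ] (Fin (n + 1) → ℂ)) →ₗ[A] D.Λ.fib x :=
  Hom.app D.b x

theorem bFib_surjective {A : CommAlgCat.{0} ℂ} (x : (projectiveSpace n).obj A) :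
    Function.Surjective (D.bFib x) :=
  D.b_surjective x

theorem bFib_map {A B : CommAlgCat.{0} ℂ} (φ : A ⟶ B) {x : (projectiveSpace n).obj A}
    {y : (projectiveSpace n).obj B} (h : (projectiveSpace n).map φ x = y)
    (u : SymSq A (A ⊗[ℂ] (Fin (n + 1) → ℂ))) :
    D.Λ.map φ h (D.bFib x u) = D.bFib y (symSqMap (extMap _ φ.hom) u) :=
  (Hom.naturality D.b φ h u).symm

/-- The inclusion `L ⊗ L → Sym² V` for a line `L`. -/
def lineSqIncl {A : CommAlgCat.{0} ℂ} (x : (projectiveSpace n).obj A) :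
    line x ⊗[A] line x →ₗ[A] SymSq A (A ⊗[ℂ] (Fin (n + 1) → ℂ)) :=
  symMulSub (line x) ∘ₗ LinearMap.rTensor (line x) (line x).subtype

@[simp] theorem lineSqIncl_tmul {A : CommAlgCat.{0} ℂ} (x : (projectiveSpace n).obj A)
    (l l' : line x) : lineSqIncl x (l ⊗ₜ l') = symMk A (l : A ⊗[ℂ] (Fin (n + 1) → ℂ)) l' := rfl

theorem bFib_eq_zero_iff {A : CommAlgCat.{0} ℂ} (x : (projectiveSpace n).obj A)
    (u : SymSq A (A ⊗[ℂ] (Fin (n + 1) → ℂ))) : D.bFib x u = 0 ↔ ∃ t, lineSqIncl x t = u :=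
  D.b_eq_zero_iff x u

theorem bFib_lineSqIncl {A : CommAlgCat.{0} ℂ} (x : (projectiveSpace n).obj A)
    (t : line x ⊗[A] line x) : D.bFib x (lineSqIncl x t) = 0 :=
  (D.bFib_eq_zero_iff x _).2 ⟨t, rfl⟩

theorem bFib_symMk {A : CommAlgCat.{0} ℂ} (x : (projectiveSpace n).obj A)
    {l l' : A ⊗[ℂ] (Fin (n + 1) → ℂ)} (hl : l ∈ line x) (hl' : l' ∈ line x) :
    D.bFib x (symMk A l l') = 0 :=
  D.bFib_lineSqIncl x (⟨l, hl⟩ ⊗ₜ ⟨l', hl'⟩)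

/-- A linear map taking one line into another takes the square of the first into the square of the
second, so its symmetric square descends to the fibres of `Λ`. -/
theorem bFib_symSqMap_eq_zero {A : CommAlgCat.{0} ℂ} {x y : (projectiveSpace n).obj A}
    (g : A ⊗[ℂ] (Fin (n + 1) → ℂ) →ₗ[A] A ⊗[ℂ] (Fin (n + 1) → ℂ))
    (hg : ∀ l ∈ line x, g l ∈ line y) (u : SymSq A (A ⊗[ℂ] (Fin (n + 1) → ℂ)))
    (hu : D.bFib x u = 0) : D.bFib y (symSqMap g u) = 0 := by
  obtain ⟨t, rfl⟩ := (D.bFib_eq_zero_iff x u).1 hu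
  clear hu
  induction t using TensorProduct.induction_on with
  | zero => simp
  | tmul l l' => exact D.bFib_symMk y (hg _ l.2) (hg _ l'.2)
  | add t t' ht ht' => rw [map_add, map_add, map_add, ht, ht', add_zero]

/-- The linear map of fibres of `Λ` induced by a linear map. -/
noncomputable def glLin {A : CommAlgCat.{0} ℂ} {x y : (projectiveSpace n).obj A}
    (g : A ⊗[ℂ] (Fin (n + 1) → ℂ) →ₗ[A] A ⊗[ℂ] (Fin (n + 1) → ℂ))
    (hg : ∀ l ∈ line x, g l ∈ line y) : D.Λ.fib x →ₗ[A] D.Λ.fib y :=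
  descLin (D.bFib x) (D.bFib_surjective x)
    (D.bFib y ∘ₗ (symSqMap g : SymSq A (A ⊗[ℂ] (Fin (n + 1) → ℂ)) →ₗ[A] _))
    (D.bFib_symSqMap_eq_zero g hg)

theorem glLin_apply {A : CommAlgCat.{0} ℂ} {x y : (projectiveSpace n).obj A}
    (g : A ⊗[ℂ] (Fin (n + 1) → ℂ) →ₗ[A] A ⊗[ℂ] (Fin (n + 1) → ℂ))
    (hg : ∀ l ∈ line x, g l ∈ line y) (u : SymSq A (A ⊗[ℂ] (Fin (n + 1) → ℂ))) :
    D.glLin g hg (D.bFib x u) = D.bFib y (symSqMap g u) :=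
  descLin_apply ..

theorem symSqMap_id' {R M : Type} [CommRing R] [AddCommGroup M] [Module R M] (t : SymSq R M) :
    symSqMap (LinearMap.id : M →ₗ[R] M) t = t := by
  induction t using SymSq.induction with
  | mk x y => rfl
  | add t t' ht ht' => rw [map_add, ht, ht']

theorem symSqMap_comp' {R M N P : Type} [CommRing R] [AddCommGroup M] [Module R M]
    [AddCommGroup N] [Module R N] [AddCommGroup P] [Module R P] (g : M →ₗ[R] N) (g' : N →ₗ[R] P)
    (t : SymSq R M) : symSqMap (g' ∘ₗ g) t = symSqMap g' (symSqMap g t) := by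
  induction t using SymSq.induction with
  | mk x y => rfl
  | add t t' ht ht' => rw [map_add, map_add, map_add, ht, ht']

theorem map_line_mem {A : CommAlgCat.{0} ℂ} {x y : (projectiveSpace n).obj A}
    {g : (A ⊗[ℂ] (Fin (n + 1) → ℂ)) ≃ₗ[A] (A ⊗[ℂ] (Fin (n + 1) → ℂ))}
    (h : (line x).map g.toLinearMap = line y) : ∀ l ∈ line x, g.toLinearMap l ∈ line y :=
  fun _ hl => h ▸ Submodule.mem_map_of_mem hl

theorem map_line_symm {A : CommAlgCat.{0} ℂ} {x y : (projectiveSpace n).obj A}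
    {g : (A ⊗[ℂ] (Fin (n + 1) → ℂ)) ≃ₗ[A] (A ⊗[ℂ] (Fin (n + 1) → ℂ))}
    (h : (line x).map g.toLinearMap = line y) : (line y).map g.symm.toLinearMap = line x := by
  rw [← h, ← Submodule.map_comp]
  simp

/-- The isomorphism of fibres of `Λ` induced by an element of `GL(V)`. -/
noncomputable def glEquiv {A : CommAlgCat.{0} ℂ} {x y : (projectiveSpace n).obj A}
    (g : (A ⊗[ℂ] (Fin (n + 1) → ℂ)) ≃ₗ[A] (A ⊗[ℂ] (Fin (n + 1) → ℂ)))
    (h : (line x).map g.toLinearMap = line y) : D.Λ.fib x ≃ₗ[A] D.Λ.fib y where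
  toLinearMap := D.glLin g.toLinearMap (map_line_mem h)
  invFun := D.glLin g.symm.toLinearMap (map_line_mem (map_line_symm h))
  left_inv v := by
    obtain ⟨u, rfl⟩ := D.bFib_surjective x v
    change D.glLin _ _ (D.glLin _ _ _) = _
    rw [glLin_apply, glLin_apply, ← symSqMap_comp', LinearEquiv.comp_coe,
      LinearEquiv.self_trans_symm, LinearEquiv.refl_toLinearMap, symSqMap_id']
  right_inv v := by
    obtain ⟨u, rfl⟩ := D.bFib_surjective y v
    change D.glLin _ _ (D.glLin _ _ _) = _
    rw [glLin_apply, glLin_apply, ← symSqMap_comp', LinearEquiv.comp_coe,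
      LinearEquiv.symm_trans_self, LinearEquiv.refl_toLinearMap, symSqMap_id']

theorem glEquiv_apply {A : CommAlgCat.{0} ℂ} {x y : (projectiveSpace n).obj A}
    (g : (A ⊗[ℂ] (Fin (n + 1) → ℂ)) ≃ₗ[A] (A ⊗[ℂ] (Fin (n + 1) → ℂ)))
    (h : (line x).map g.toLinearMap = line y) (u : SymSq A (A ⊗[ℂ] (Fin (n + 1) → ℂ))) :
    D.glEquiv g h (D.bFib x u) = D.bFib y (symSqMap g.toLinearMap u) :=
  D.glLin_apply _ (map_line_mem h) u

/-- The `GL(V)`-linearization of `Λ`. -/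
noncomputable def linearization : GLLinearization D.Λ where
  act g _ _ h := D.glEquiv g h
  act_one {A x} h v := by
    obtain ⟨u, rfl⟩ := D.bFib_surjective x v
    rw [glEquiv_apply, LinearEquiv.refl_toLinearMap, symSqMap_id']
  act_mul {A} g g' x y z h h' h'' v := by
    obtain ⟨u, rfl⟩ := D.bFib_surjective x v
    rw [glEquiv_apply, glEquiv_apply, glEquiv_apply, LinearEquiv.coe_trans, symSqMap_comp']
  act_map {A B} φ g g' hg x y x' y' hx hy h h' v := by
    obtain ⟨u, rfl⟩ := D.bFib_surjective x v
    rw [bFib_map, glEquiv_apply, glEquiv_apply, bFib_map]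
    congr 1
    induction u using SymSq.induction with
    | mk a b => simp only [symSqMap_symMk, LinearEquiv.coe_coe, hg]
    | add t t' ht ht' => simp only [map_add, ht, ht']

end SnakeDiagram

/-! ### Points of projective space with coordinates -/

section Points

variable {n : ℕ} {A B : CommAlgCat.{0} ℂ}

theorem point_ext {x y : (projectiveSpace n).obj A} (h : line x = line y) : x = y :=
  Module.Grassmannian.ext h

/-- The point of projective space given by a direct summand of rank one. -/
def mkPoint (K : Submodule A (A ⊗[ℂ] (Fin (n + 1) → ℂ)))
    (hK : Module.Projective A ((A ⊗[ℂ] (Fin (n + 1) → ℂ)) ⧸ K))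
    (h1 : ∀ p, Module.rankAtStalk (R := A) K p = 1) : (projectiveSpace n).obj A :=
  { toSubmodule := K
    finite_quotient := inferInstance
    projective_quotient := hK
    rankAtStalk_eq := fun p => by
      have h := rankAtStalk_quot_add K p
      rw [rankAtStalk_tensor, h1] at h
      simpa using h : Module.Grassmannian A (A ⊗[ℂ] (Fin (n + 1) → ℂ)) n }

/-- The vector of `A ⊗ ℂⁿ` with given coordinates. -/
noncomputable abbrev vec {A : Type} [CommRing A] [Algebra ℂ A] {n : ℕ} (v : Fin n → A) :
    A ⊗[ℂ] (Fin n → ℂ) := (coo A n).symm v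

@[simp] theorem coo_vec {A : Type} [CommRing A] [Algebra ℂ A] {n : ℕ} (v : Fin n → A) :
    coo A n (vec v) = v := (coo A n).apply_symm_apply v

theorem extMap_vec {A B : Type} [CommRing A] [CommRing B] [Algebra ℂ A] [Algebra ℂ B] {n : ℕ}
    (φ : A →ₐ[ℂ] B) (v : Fin n → A) : extMap _ φ (vec v) = vec fun i => φ (v i) :=
  extMap_coo_symm φ v

theorem vec_smul_injective {A : Type} [CommRing A] [Algebra ℂ A] {n : ℕ} {v : Fin n → A}
    (hv : ∃ i, IsUnit (v i)) : Function.Injective fun a : A => a • vec v := by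
  obtain ⟨i, hi⟩ := hv
  intro a b hab
  have := congrFun (congrArg (coo A n) hab) i
  simp only [map_smul, coo_vec, Pi.smul_apply, smul_eq_mul] at this
  exact hi.mul_right_cancel this

theorem projective_quot_span_vec {A : Type} [CommRing A] [Algebra ℂ A] {n : ℕ} {v : Fin n → A}
    (hv : ∃ i, IsUnit (v i)) :
    Module.Projective A ((A ⊗[ℂ] (Fin n → ℂ)) ⧸ Submodule.span A {vec v}) := by
  obtain ⟨i, u, hu⟩ := hv
  refine projective_quot_of_retraction _ (LinearMap.toSpanSingleton A _
    (⟨vec v, Submodule.mem_span_singleton_self _⟩ : Submodule.span A {vec v}) ∘ₗ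
      (LinearMap.mulLeft A ((u⁻¹ : Aˣ) : A) ∘ₗ LinearMap.proj i ∘ₗ (coo A n).toLinearMap)) ?_
  rintro ⟨k, hk⟩
  obtain ⟨a, rfl⟩ := Submodule.mem_span_singleton.1 hk
  ext
  simp [← hu]

theorem rankAtStalk_span_vec {A : Type} [CommRing A] [Algebra ℂ A] {n : ℕ} {v : Fin n → A}
    (hv : ∃ i, IsUnit (v i)) (p : PrimeSpectrum A) :
    Module.rankAtStalk (R := A) (Submodule.span A {vec v}) p = 1 := by
  have e : A ≃ₗ[A] Submodule.span A {vec v} :=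
    LinearEquiv.ofInjective (LinearMap.toSpanSingleton A _ (vec v)) (vec_smul_injective hv) ≪≫ₗ
      LinearEquiv.ofEq _ _ (LinearMap.range_toSpanSingleton (vec v))
  have : Module.Invertible A (Submodule.span A {vec v}) := Module.Invertible.congr e
  exact rank_eq_one_of_invertible p

/-- The point `[v_0 : ⋯ : v_n]`, where one coordinate is a unit. -/
noncomputable def framedPoint (v : Fin (n + 1) → A) (hv : ∃ i, IsUnit (v i)) :
    (projectiveSpace n).obj A :=
  mkPoint (Submodule.span A {vec v}) (projective_quot_span_vec hv) (rankAtStalk_span_vec hv)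

theorem line_framedPoint (v : Fin (n + 1) → A) (hv : ∃ i, IsUnit (v i)) :
    line (framedPoint v hv) = Submodule.span A {vec v} := rfl

theorem exists_isUnit_map (φ : A ⟶ B) {m : ℕ} {v : Fin m → A} (hv : ∃ i, IsUnit (v i)) :
    ∃ i, IsUnit (φ.hom (v i)) :=
  hv.imp fun _ h => h.map φ.hom

theorem map_framedPoint (φ : A ⟶ B) (v : Fin (n + 1) → A) (hv : ∃ i, IsUnit (v i)) :
    (projectiveSpace n).map φ (framedPoint v hv) =
      framedPoint (fun i => φ.hom (v i)) (exists_isUnit_map φ hv) := by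
  apply point_ext
  rw [line_map φ rfl, line_framedPoint, line_framedPoint]
  apply le_antisymm
  · refine Submodule.span_le.2 ?_
    rintro _ ⟨u, hu, rfl⟩
    obtain ⟨a, rfl⟩ := Submodule.mem_span_singleton.1 hu
    rw [LinearMap.map_smulₛₗ, extMap_vec]
    exact Submodule.smul_mem _ _ (Submodule.mem_span_singleton_self _)
  · refine Submodule.span_le.2 ?_
    rintro _ rfl
    rw [← extMap_vec]
    exact Submodule.subset_span ⟨_, Submodule.mem_span_singleton_self _, rfl⟩

theorem framedPoint_smul (v : Fin (n + 1) → A) (hv : ∃ i, IsUnit (v i)) (a : A) (ha : IsUnit a)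
    (hav : ∃ i, IsUnit ((a • v) i)) : framedPoint (a • v) hav = framedPoint v hv := by
  apply point_ext
  rw [line_framedPoint, line_framedPoint, vec, map_smul]
  exact Submodule.span_singleton_smul_eq ha _

/-- Over a local ring all points of projective space have coordinates. -/
theorem exists_framedPoint_of_isLocalRing [IsLocalRing A] (x : (projectiveSpace n).obj A) :
    ∃ v hv, x = framedPoint v hv := by
  have := finite_of_quot_projective (line x)
  have := projective_of_quot_projective (line x)
  have : Module.Free A (line x) := Module.free_of_flat_of_isLocalRing (R := A) (P := line x)
  obtain ⟨e⟩ := Module.Invertible.free_iff_linearEquiv.1 this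
  obtain ⟨r, hr⟩ := exists_linear_retraction (line x)
  let l := e.symm 1
  have hl (k : line x) : k = e k • l := by
    rw [← map_smul, smul_eq_mul, mul_one, LinearEquiv.symm_apply_apply]
  have hspan : line x = Submodule.span A {vec (coo A (n + 1) l)} := by
    rw [vec, LinearEquiv.symm_apply_apply]
    apply le_antisymm
    · intro k hk
      rw [Submodule.mem_span_singleton]
      exact ⟨e ⟨k, hk⟩, (congrArg Subtype.val (hl ⟨k, hk⟩)).symm⟩
    · rw [Submodule.span_singleton_le_iff_mem]
      exact l.2
  refine ⟨coo A (n + 1) l, ?_, point_ext hspan⟩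
  -- If all coordinates of the generator were nonunits, every linear form on the line, extended by
  -- the retraction to the free module, would take values in the maximal ideal. That contradicts
  -- invertibility.
  by_contra! hv
  refine (IsLocalRing.maximalIdeal.isMaximal A).ne_top
    (ideal_eq_top_of_invertible (M := line x) _ fun f m => ?_)
  have hf : f m = e m * ∑ i, coo A (n + 1) l i * f (r (stdVec A i)) := by
    conv_lhs => rw [hl m, ← hr l, ← sum_coo_stdVec (l : A ⊗[ℂ] (Fin (n + 1) → ℂ))]
    simp
  rw [hf]
  exact Ideal.mul_mem_left _ _ (Ideal.sum_mem _ fun i _ => Ideal.mul_mem_right _ _ (hv i))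

end Points

/-! ### Sections are determined over local rings -/

section SectionExtensionality

variable {X : CSpace} (E : VecBundle X)

theorem map_dual_eq_zero {A B : CommAlgCat.{0} ℂ} (φ : A ⟶ B) {x : X.obj A} {y : X.obj B}
    (h : X.map φ x = y) (m : E.fib x) (hm : E.map φ h m = 0) (f : Module.Dual A (E.fib x)) :
    φ.hom (f m) = 0 := by
  have := dualMap_apply (E.baseChange φ h) f m
  rw [hm, map_zero] at this
  exact this.symm

/-- The localization of an algebra at a maximal ideal. -/
noncomputable def locMap (A : CommAlgCat.{0} ℂ) (P : Ideal A) [P.IsPrime] :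
    A ⟶ CommAlgCat.of ℂ (Localization.AtPrime P) :=
  CommAlgCat.ofHom (IsScalarTower.toAlgHom ℂ A (Localization.AtPrime P))

/-- Linear forms separate elements of a finitely generated projective module, and an element of `A`
is zero once it is zero in every localization at a maximal ideal. -/
theorem fib_eq_of_localization {A : CommAlgCat.{0} ℂ} {x : X.obj A} (m m' : E.fib x)
    (h : ∀ (P : Ideal A) [P.IsMaximal], E.map (locMap A P) rfl m = E.map (locMap A P) rfl m') :
    m = m' := by
  rw [← sub_eq_zero]
  refine (Module.forall_dual_apply_eq_zero_iff A _).1 fun f => ?_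
  refine eq_zero_of_localization _ fun P hP => ?_
  refine map_dual_eq_zero E (locMap A P) rfl (m - m') ?_ f
  rw [map_sub, h P, sub_self]

/-- Over local rings all points have coordinates, so this reduces equality of sections to equality
at framed points. -/
theorem sections_ext_of_isLocalRing {E : VecBundle X} {s t : E.Sections}
    (h : ∀ {A : CommAlgCat.{0} ℂ} [IsLocalRing A] (x : X.obj A),
      Sections.eval s x = Sections.eval t x) : s = t := by
  refine Subtype.ext (funext fun A => funext fun x => ?_)
  refine fib_eq_of_localization E _ _ fun P _ => ?_
  have : IsLocalRing (CommAlgCat.of ℂ (Localization.AtPrime P)) :=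
    inferInstanceAs (IsLocalRing (Localization.AtPrime P))
  exact (s.2 (locMap A P) rfl).trans ((h _).trans (t.2 (locMap A P) rfl).symm)

end SectionExtensionality

/-! ### Regular functions on products of punctured affine spaces -/

section NaturalFunctions

open MvPolynomial

/-- A regular function on `(𝔸^{a+2} ∖ 0) × (𝔸^{b+2} ∖ 0)`, given on points with an invertible
coordinate in each factor. -/
structure PuncturedFunction (a b : ℕ) where
  /-- The value at a point. -/
  val : ∀ {A : CommAlgCat.{0} ℂ} (v : Fin (a + 2) → A) (w : Fin (b + 2) → A),
    (∃ i, IsUnit (v i)) → (∃ j, IsUnit (w j)) → A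
  natural : ∀ {A B : CommAlgCat.{0} ℂ} (φ : A ⟶ B) (v : Fin (a + 2) → A) (w : Fin (b + 2) → A)
    (hv : ∃ i, IsUnit (v i)) (hw : ∃ j, IsUnit (w j)),
    φ.hom (val v w hv hw) = val (fun i => φ.hom (v i)) (fun j => φ.hom (w j))
      (exists_isUnit_map φ hv) (exists_isUnit_map φ hw)

variable {a b : ℕ}

/-- The polynomial ring in two groups of variables. -/
abbrev BiPoly (a b : ℕ) : Type := MvPolynomial (Fin (a + 2) ⊕ Fin (b + 2)) ℂ

/-- The field of rational functions in two groups of variables. -/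
noncomputable abbrev ratField (a b : ℕ) : CommAlgCat.{0} ℂ :=
  CommAlgCat.of ℂ (FractionRing (BiPoly a b))

/-- The generic value of a variable. -/
noncomputable def genericVar (a b : ℕ) (s : Fin (a + 2) ⊕ Fin (b + 2)) : ratField a b :=
  algebraMap (BiPoly a b) (FractionRing (BiPoly a b)) (X s)

theorem isUnit_genericVar (s : Fin (a + 2) ⊕ Fin (b + 2)) : IsUnit (genericVar a b s) :=
  IsUnit.mk0 (G₀ := FractionRing (BiPoly a b)) _
    ((map_ne_zero_iff _ (IsFractionRing.injective _ _)).2 (X_ne_zero s))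

theorem aeval_generic (p : BiPoly a b) :
    aeval (Sum.elim (fun i => genericVar a b (.inl i)) (fun j => genericVar a b (.inr j))) p =
      algebraMap (BiPoly a b) (FractionRing (BiPoly a b)) p := by
  have : (Sum.elim (fun i => genericVar a b (.inl i)) (fun j => genericVar a b (.inr j))) =
      fun s => algebraMap (BiPoly a b) (FractionRing (BiPoly a b)) (X s) := by
    ext s
    cases s <;> rfl
  rw [this]
  exact aeval_algebraMap_apply (FractionRing (BiPoly a b)) X p |>.trans (by rw [aeval_X_left_apply])

/-- The generic point, whose coordinates are the variables in the fraction field, already separates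
polynomials. -/
theorem bipoly_ext {p q : BiPoly a b}
    (h : ∀ {A : CommAlgCat.{0} ℂ} (v : Fin (a + 2) → A) (w : Fin (b + 2) → A),
      (∃ i, IsUnit (v i)) → (∃ j, IsUnit (w j)) →
        aeval (Sum.elim v w) p = aeval (Sum.elim v w) q) : p = q := by
  have := h (fun i => genericVar a b (.inl i)) (fun j => genericVar a b (.inr j))
    ⟨0, isUnit_genericVar _⟩ ⟨0, isUnit_genericVar _⟩
  rw [aeval_generic, aeval_generic] at this
  exact IsFractionRing.injective _ _ this

namespace PuncturedFunction

variable (G : PuncturedFunction a b)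

/-- The value at the generic point. -/
noncomputable def generic : FractionRing (BiPoly a b) :=
  G.val (A := ratField a b) (fun i => genericVar a b (.inl i)) (fun j => genericVar a b (.inr j))
    ⟨0, isUnit_genericVar _⟩ ⟨0, isUnit_genericVar _⟩

section Chart

variable {R : Type} [CommRing R] [Algebra (BiPoly a b) R]

variable (R) in
/-- A variable on a chart. -/
noncomputable def chartVar (s : Fin (a + 2) ⊕ Fin (b + 2)) : R := algebraMap (BiPoly a b) R (X s)

theorem isUnit_chartVar_mul (i : Fin (a + 2)) (j : Fin (b + 2))
    [IsLocalization.Away (X (.inl i) * X (.inr j) : BiPoly a b) R] :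
    IsUnit (chartVar (a := a) (b := b) R (.inl i) * chartVar (a := a) (b := b) R (.inr j)) := by
  have := IsLocalization.Away.algebraMap_isUnit (S := R) (X (.inl i) * X (.inr j) : BiPoly a b)
  rwa [map_mul] at this

variable [Algebra ℂ R]

variable (R) in
/-- The value at the universal point of a chart. -/
noncomputable def onChart (i : Fin (a + 2)) (j : Fin (b + 2))
    [IsLocalization.Away (X (.inl i) * X (.inr j) : BiPoly a b) R] : R :=
  G.val (A := CommAlgCat.of ℂ R) (fun k => chartVar R (.inl k)) (fun k => chartVar R (.inr k))
    ⟨i, isUnit_of_mul_isUnit_left (isUnit_chartVar_mul i j)⟩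
    ⟨j, isUnit_of_mul_isUnit_right (isUnit_chartVar_mul i j)⟩

/-- By naturality, the value at the universal point of a chart specializes to the value at every
point classified by a homomorphism out of the chart ring. -/
theorem val_eq_of_hom {A : CommAlgCat.{0} ℂ} (v : Fin (a + 2) → A) (w : Fin (b + 2) → A)
    (hv : ∃ i, IsUnit (v i)) (hw : ∃ j, IsUnit (w j)) {i : Fin (a + 2)} {j : Fin (b + 2)}
    [IsLocalization.Away (X (.inl i) * X (.inr j) : BiPoly a b) R]
    (φ : R →ₐ[ℂ] A) (hφ : ∀ p : BiPoly a b,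
      φ (algebraMap (BiPoly a b) R p) = aeval (Sum.elim v w) p) :
    φ (G.onChart R i j) = G.val v w hv hw := by
  have hunit := isUnit_chartVar_mul (R := R) i j
  refine (G.natural (A := CommAlgCat.of ℂ R) (CommAlgCat.ofHom φ) (fun k => chartVar R (.inl k))
    (fun k => chartVar R (.inr k)) ⟨i, isUnit_of_mul_isUnit_left hunit⟩
    ⟨j, isUnit_of_mul_isUnit_right hunit⟩).trans ?_
  congr 1
  · ext k
    exact (hφ (X (.inl k))).trans (by simp)
  · ext k
    exact (hφ (X (.inr k))).trans (by simp)

variable [IsScalarTower ℂ (BiPoly a b) R]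

theorem exists_hom_of_chart {A : CommAlgCat.{0} ℂ} (v : Fin (a + 2) → A) (w : Fin (b + 2) → A)
    {i : Fin (a + 2)} {j : Fin (b + 2)}
    [IsLocalization.Away (X (.inl i) * X (.inr j) : BiPoly a b) R]
    (hi : IsUnit (v i)) (hj : IsUnit (w j)) :
    ∃ φ : R →ₐ[ℂ] A, ∀ p : BiPoly a b,
      φ (algebraMap (BiPoly a b) R p) = aeval (Sum.elim v w) p := by
  let f := IsLocalization.liftAlgHom (M := Submonoid.powers (X (.inl i) * X (.inr j) : BiPoly a b))
    (S := R) (f := (aeval (Sum.elim v w) : BiPoly a b →ₐ[ℂ] A)) (by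
      rintro ⟨_, k, rfl⟩
      simpa using ((hi.mul hj).pow k))
  exact ⟨f, fun p => IsLocalization.lift_eq _ p⟩

variable (R) in
-- The generic point factors through every chart, and the chart ring embeds in the fraction field.
-- Identities on a chart can thus be checked generically.
theorem exists_generic_hom (i : Fin (a + 2)) (j : Fin (b + 2))
    [IsLocalization.Away (X (.inl i) * X (.inr j) : BiPoly a b) R] :
    ∃ φ : R →ₐ[ℂ] FractionRing (BiPoly a b), φ (G.onChart R i j) = G.generic ∧
      (∀ p : BiPoly a b, φ (algebraMap (BiPoly a b) R p) =
          algebraMap (BiPoly a b) (FractionRing (BiPoly a b)) p) ∧ Function.Injective φ := by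
  obtain ⟨φ, hφ⟩ := exists_hom_of_chart (R := R) (A := ratField a b)
    (fun i => genericVar a b (.inl i)) (fun j => genericVar a b (.inr j))
    (isUnit_genericVar (.inl i)) (isUnit_genericVar (.inr j))
  have hφ' (p : BiPoly a b) := (hφ p).trans (aeval_generic p)
  refine ⟨φ, G.val_eq_of_hom _ _ _ _ φ hφ, hφ', ?_⟩
  rw [injective_iff_map_eq_zero]
  intro y hy
  obtain ⟨⟨p, s⟩, hps⟩ := IsLocalization.surj
    (Submonoid.powers (X (.inl i) * X (.inr j) : BiPoly a b)) y
  have h1 : φ (algebraMap (BiPoly a b) R p) = 0 := by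
    rw [← hps]
    refine (map_mul φ _ _).trans ?_
    rw [hy, zero_mul]
  have hp : p = 0 := IsFractionRing.injective (BiPoly a b) (FractionRing (BiPoly a b))
    ((hφ' p).symm.trans (h1.trans (map_zero _).symm))
  simp only [hp, map_zero] at hps
  exact (IsLocalization.map_units R s).mul_left_eq_zero.1 hps

end Chart

theorem exists_chart (i : Fin (a + 2)) (j : Fin (b + 2)) :
    ∃ (R : Type) (_ : CommRing R) (_ : Algebra ℂ R) (_ : Algebra (BiPoly a b) R)
      (_ : IsScalarTower ℂ (BiPoly a b) R),
      IsLocalization.Away (X (.inl i) * X (.inr j) : BiPoly a b) R :=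
  ⟨Localization.Away (X (.inl i) * X (.inr j) : BiPoly a b), inferInstance, inferInstance,
    inferInstance, inferInstance, inferInstance⟩

theorem exists_clear_denominators (i : Fin (a + 2)) (j : Fin (b + 2)) :
    ∃ (N : ℕ) (s : BiPoly a b), G.generic * algebraMap (BiPoly a b) (FractionRing (BiPoly a b))
      ((X (.inl i) * X (.inr j)) ^ N) =
      algebraMap (BiPoly a b) (FractionRing (BiPoly a b)) s := by
  obtain ⟨R, _, _, _, _, _⟩ := exists_chart i j
  obtain ⟨φ, h1, h2, -⟩ := G.exists_generic_hom R i j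
  obtain ⟨⟨s, ⟨_, N, rfl⟩⟩, hs⟩ := IsLocalization.surj
    (Submonoid.powers (X (.inl i) * X (.inr j) : BiPoly a b)) (G.onChart R i j)
  refine ⟨N, s, ?_⟩
  have h3 := congrArg φ hs
  rw [← h2 s, ← h3, ← h1, ← h2]
  exact (map_mul φ _ _).symm

theorem isRelPrime_X {σ : Type} {s t : σ} (h : s ≠ t) :
    IsRelPrime (X s : MvPolynomial σ ℂ) (X t) := by
  rw [(X_prime (R := ℂ) (i := s)).irreducible.isRelPrime_iff_not_dvd, X_dvd_X]
  simpa using h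

/-- A Hartogs argument. On the charts `(0, 0)` and `(1, 1)` the generic value has denominators
powers of `X_0 Y_0` and of `X_1 Y_1`. Both factors have at least two coordinates, so these are
coprime and the generic value is a polynomial, which then agrees with the function on every chart.
-/
theorem exists_poly : ∃ p : BiPoly a b, ∀ {A : CommAlgCat.{0} ℂ} (v : Fin (a + 2) → A)
    (w : Fin (b + 2) → A) (hv : ∃ i, IsUnit (v i)) (hw : ∃ j, IsUnit (w j)),
    G.val v w hv hw = aeval (Sum.elim v w) p := by
  obtain ⟨N, s, hs⟩ := G.exists_clear_denominators 0 0
  obtain ⟨M, t, ht⟩ := G.exists_clear_denominators 1 1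
  have hst : s * (X (.inl 1) * X (.inr 1)) ^ M = t * (X (.inl 0) * X (.inr 0)) ^ N := by
    apply IsFractionRing.injective (BiPoly a b) (FractionRing (BiPoly a b))
    rw [map_mul, map_mul, ← hs, ← ht, mul_right_comm]
  have hrel : IsRelPrime ((X (.inl 0) * X (.inr 0) : BiPoly a b) ^ N)
      ((X (.inl 1) * X (.inr 1)) ^ M) := by
    refine IsRelPrime.pow (IsRelPrime.mul_left ?_ ?_) <;>
      exact IsRelPrime.mul_right (isRelPrime_X (by simp)) (isRelPrime_X (by simp))
  obtain ⟨p, rfl⟩ := hrel.dvd_of_dvd_mul_right (Dvd.intro_left _ hst.symm)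
  have hp : G.generic = algebraMap (BiPoly a b) (FractionRing (BiPoly a b)) p := by
    rw [map_mul, mul_comm] at hs
    refine mul_left_cancel₀ ?_ hs
    rw [map_ne_zero_iff _ (IsFractionRing.injective (BiPoly a b) (FractionRing (BiPoly a b)))]
    exact pow_ne_zero _ (mul_ne_zero (X_ne_zero _) (X_ne_zero _))
  refine ⟨p, fun v w ⟨i, hi⟩ ⟨j, hj⟩ => ?_⟩
  obtain ⟨R, _, _, _, _, _⟩ := exists_chart i j
  obtain ⟨φ, h1, h2, h3⟩ := G.exists_generic_hom R i j
  have hc : G.onChart R i j = algebraMap (BiPoly a b) R p := by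
    apply h3
    rw [h1, hp, h2]
  obtain ⟨ψ, hψ⟩ := exists_hom_of_chart (R := R) (i := i) (j := j) v w hi hj
  rw [← G.val_eq_of_hom (R := R) (i := i) (j := j) v w ⟨i, hi⟩ ⟨j, hj⟩ ψ hψ, hc, hψ]

end PuncturedFunction

theorem coeff_rescale {σ : Type} [Fintype σ] (c : σ → ℂ) (p : MvPolynomial σ ℂ) (m : σ →₀ ℕ) :
    coeff m (aeval (fun s => C (c s) * X s : σ → MvPolynomial σ ℂ) p) =
      (∏ s, c s ^ m s) * coeff m p := by
  induction p using MvPolynomial.induction_on' with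
  | add p q hp hq => rw [map_add, coeff_add, coeff_add, hp, hq, mul_add]
  | monomial n r =>
    have : aeval (fun s => C (c s) * X s : σ → MvPolynomial σ ℂ) (monomial n r) =
        monomial n ((∏ s, c s ^ n s) * r) := by
      rw [aeval_monomial, Finsupp.prod_fintype _ _ (by simp)]
      simp only [mul_pow, Finset.prod_mul_distrib]
      rw [monomial_eq (s := n), Finsupp.prod_fintype _ _ (by simp), C_mul, map_prod]
      simp only [map_pow, algebraMap_eq]
      ring
    classical
    rw [this, coeff_monomial, coeff_monomial]
    split_ifs with h
    · rw [h]
    · rw [mul_zero]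

/-- A polynomial is bihomogeneous of bidegree `(d, e)`. -/
def IsBihomogeneous (p : BiPoly a b) (d e : ℕ) : Prop :=
  ∀ m, coeff m p ≠ 0 → ∑ i, m (.inl i) = d ∧ ∑ j, m (.inr j) = e

/-- Scaling multiplies the coefficient of a monomial of bidegree `(k, l)` by `c^k c'^l`. Scaling one
group of variables by `2` and fixing the other reads off each degree, since powers of two are
distinct. -/
theorem isBihomogeneous_of_scale (p : BiPoly a b) (d e : ℕ)
    (h : ∀ {A : CommAlgCat.{0} ℂ} (v : Fin (a + 2) → A) (w : Fin (b + 2) → A),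
      (∃ i, IsUnit (v i)) → (∃ j, IsUnit (w j)) → ∀ c c' : ℂ, c ≠ 0 → c' ≠ 0 →
        aeval (Sum.elim (algebraMap ℂ A c • v) (algebraMap ℂ A c' • w)) p =
          algebraMap ℂ A (c ^ d * c' ^ e) * aeval (Sum.elim v w) p) :
    IsBihomogeneous p d e := by
  have key (c c' : ℂ) (hc : c ≠ 0) (hc' : c' ≠ 0) :
      aeval (fun s => C (Sum.elim (fun _ => c) (fun _ => c') s) * X s :
        Fin (a + 2) ⊕ Fin (b + 2) → BiPoly a b) p = C (c ^ d * c' ^ e) * p := by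
    apply bipoly_ext
    intro A v w hv hw
    rw [map_mul, algHom_C, ← h v w hv hw c c' hc hc', ← AlgHom.comp_apply]
    congr 1
    ext s
    cases s <;> simp [Algebra.smul_def]
  intro m hm
  have hpow (c c' : ℂ) (hc : c ≠ 0) (hc' : c' ≠ 0) :
      c ^ (∑ i, m (.inl i)) * c' ^ (∑ j, m (.inr j)) = c ^ d * c' ^ e := by
    have := congrArg (coeff m) (key c c' hc hc')
    rw [coeff_rescale, coeff_C_mul] at this
    have := mul_right_cancel₀ hm this
    simpa [Fintype.prod_sum_type, Finset.prod_pow_eq_pow_sum] using this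
  have hinj {k l : ℕ} (hkl : (2 : ℂ) ^ k = 2 ^ l) : k = l := by
    have h' : ((2 ^ k : ℕ) : ℂ) = ((2 ^ l : ℕ) : ℂ) := by push_cast; exact hkl
    exact Nat.pow_right_injective le_rfl (Nat.cast_injective h')
  constructor
  · have := hpow 2 1 two_ne_zero one_ne_zero
    simp only [one_pow, mul_one] at this
    exact hinj this
  · have := hpow 1 2 one_ne_zero two_ne_zero
    simp only [one_pow, one_mul] at this
    exact hinj this

end NaturalFunctions

/-! ### Operations on global sections -/

section SectionConstructions

variable {X Y : CSpace} {E F : VecBundle X}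

/-- Evaluation of sections at a point. -/
def evalHom (E : VecBundle X) {A : CommAlgCat.{0} ℂ} (x : X.obj A) : E.Sections →+ E.fib x where
  toFun s := Sections.eval s x
  map_zero' := rfl
  map_add' _ _ := rfl

theorem eval_sum_smul {ι : Type*} [Fintype ι] (c : ι → ℂ) (s : ι → E.Sections)
    {A : CommAlgCat.{0} ℂ} (x : X.obj A) :
    Sections.eval (∑ i, c i • s i) x = ∑ i, algebraMap ℂ A (c i) • Sections.eval (s i) x :=
  map_sum (evalHom E x) _ _

/-- The tensor product of two sections. -/
noncomputable def tensorSection (s : E.Sections) (t : F.Sections) : (E.tensor F).Sections :=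
  ⟨fun _ x => tmulFib (Sections.eval s x) (Sections.eval t x), fun φ x y h => by
    rw [map_tmulFib]
    exact congrArg₂ tmulFib (s.2 φ h) (t.2 φ h)⟩

/-- The pullback of a section. -/
def pullbackSection (α : X ⟶ Y) {E : VecBundle Y} (s : E.Sections) : (pullback α E).Sections :=
  ⟨fun A x => Sections.eval s (α.app A x), fun φ _ _ h => s.2 φ (pullback_aux α h)⟩

/-- The image of a section under a morphism of bundles. -/
def mapSection (α : E ⟶ F) (s : E.Sections) : F.Sections :=
  ⟨fun _ x => Hom.app α x (Sections.eval s x), fun φ x y h => by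
    rw [← Hom.naturality α φ h]
    exact congrArg _ (s.2 φ h)⟩

/-- The constant section of a trivial bundle. -/
noncomputable def constSection (X : CSpace) {V : Type} [AddCommGroup V] [Module ℂ V]
    [Module.Finite ℂ V] (v : V) : (VecBundle.trivial X V).Sections :=
  ⟨fun A _ => (1 : A) ⊗ₜ[ℂ] v, fun {A B} φ x y h => by
    change extMap V φ.hom ((1 : A) ⊗ₜ[ℂ] v) = (1 : B) ⊗ₜ[ℂ] v
    rw [extMap_tmul, map_one]⟩

/-- The section of a direct sum given by two sections. -/
def prodSection (s : E.Sections) (t : F.Sections) : (E.directSum F).Sections :=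
  ⟨fun _ x => (Sections.eval s x, Sections.eval t x), fun φ _ _ h =>
    Prod.ext (s.2 φ h) (t.2 φ h)⟩

end SectionConstructions

/-! ### Coordinates as sections of `O(1)` -/

section LinearForms

variable {n : ℕ} {A B : CommAlgCat.{0} ℂ}

/-- The restriction of a coordinate to a line. -/
noncomputable def lineForm (x : (projectiveSpace n).obj A) (j : Fin (n + 1)) :
    line x →ₗ[A] A :=
  LinearMap.proj j ∘ₗ (coo A (n + 1)).toLinearMap ∘ₗ (line x).subtype

theorem lineForm_apply (x : (projectiveSpace n).obj A) (j : Fin (n + 1)) (l : line x) :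
    lineForm x j l = coo A (n + 1) l j := rfl

/-- The image of an element of a line under base change. -/
noncomputable def lineMap (φ : A ⟶ B) {x : (projectiveSpace n).obj A}
    {y : (projectiveSpace n).obj B} (h : (projectiveSpace n).map φ x = y) :
    line x →ₛₗ[ringHom φ] line y :=
  subMap (extMap _ φ.hom) _ _ (extMap_mem_line φ h)

theorem coo_lineMap (φ : A ⟶ B) {x : (projectiveSpace n).obj A}
    {y : (projectiveSpace n).obj B} (h : (projectiveSpace n).map φ x = y) (l : line x)
    (j : Fin (n + 1)) : coo B (n + 1) (lineMap φ h l : B ⊗[ℂ] (Fin (n + 1) → ℂ)) j =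
      φ.hom (coo A (n + 1) (l : A ⊗[ℂ] (Fin (n + 1) → ℂ)) j) :=
  coo_extMap φ.hom _ j

/-- The base change of linear forms on a line. -/
noncomputable def OOneMap (φ : A ⟶ B) {x : (projectiveSpace n).obj A}
    {y : (projectiveSpace n).obj B} (h : (projectiveSpace n).map φ x = y) :
    Module.Dual A (line x) →ₛₗ[ringHom φ] Module.Dual B (line y) :=
  (OOne n).map φ h

theorem OOne_map_apply (φ : A ⟶ B) {x : (projectiveSpace n).obj A}
    {y : (projectiveSpace n).obj B} (h : (projectiveSpace n).map φ x = y)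
    (f : Module.Dual A (line x)) (l : line x) :
    OOneMap φ h f (lineMap φ h l) = φ.hom (f l) :=
  dualMap_apply ((taut n).baseChange φ h) f l

/-- The coordinates as sections of `O(1)`. -/
noncomputable def coordSection (n : ℕ) (j : Fin (n + 1)) : (OOne n).Sections :=
  ⟨fun _ x => lineForm x j, fun φ x y h => by
    apply dual_ext ((taut n).baseChange φ h)
    intro l
    refine (OOne_map_apply φ h (lineForm x j) l).trans ?_
    exact (coo_lineMap φ h l j).symm⟩

/-- The generator of the line through a point with coordinates. -/
noncomputable def framedVec (v : Fin (n + 1) → A) (hv : ∃ i, IsUnit (v i)) :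
    line (framedPoint v hv) :=
  ⟨vec v, Submodule.mem_span_singleton_self _⟩

theorem exists_smul_framedVec (v : Fin (n + 1) → A) (hv : ∃ i, IsUnit (v i))
    (l : line (framedPoint v hv)) : ∃ a : A, l = a • framedVec v hv := by
  obtain ⟨a, ha⟩ := Submodule.mem_span_singleton.1 l.2
  exact ⟨a, Subtype.ext ha.symm⟩

theorem lineMap_framedVec (φ : A ⟶ B) (v : Fin (n + 1) → A) (hv : ∃ i, IsUnit (v i)) :
    lineMap φ (map_framedPoint φ v hv) (framedVec v hv) =
      framedVec (fun i => φ.hom (v i)) (exists_isUnit_map φ hv) :=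
  Subtype.ext (extMap_vec φ.hom v)

@[simp] theorem coo_framedVec (v : Fin (n + 1) → A) (hv : ∃ i, IsUnit (v i)) :
    coo A (n + 1) (framedVec v hv : A ⊗[ℂ] (Fin (n + 1) → ℂ)) = v := coo_vec v

end LinearForms

/-! ### Tensors of linear forms as multilinear forms -/

section QuadraticForms

variable {R M : Type*} [CommRing R] [AddCommGroup M] [Module R M]

/-- Elements of `M^∨ ⊗ M^∨` as bilinear forms. -/
noncomputable def toForm :
    Module.Dual R M ⊗[R] Module.Dual R M →ₗ[R] Module.Dual R (M ⊗[R] M) :=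
  TensorProduct.dualDistrib R M M

/-- Elements of `(M^∨ ⊗ M^∨) ⊗ (M^∨ ⊗ M^∨)` as bilinear forms on `M ⊗ M`. -/
noncomputable def toQuarticForm :
    (Module.Dual R M ⊗[R] Module.Dual R M) ⊗[R] (Module.Dual R M ⊗[R] Module.Dual R M) →ₗ[R]
      Module.Dual R ((M ⊗[R] M) ⊗[R] (M ⊗[R] M)) :=
  TensorProduct.dualDistrib R (M ⊗[R] M) (M ⊗[R] M) ∘ₗ
    TensorProduct.map (TensorProduct.dualDistrib R M M) (TensorProduct.dualDistrib R M M)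

theorem toQuarticForm_injective [Module.Finite R M] [Module.Projective R M] :
    Function.Injective (toQuarticForm (R := R) (M := M)) := by
  let e := LinearEquiv.ofBijective _ (dualDistrib_bijective (R := R) (M := M) (N := M))
  exact (dualDistrib_bijective (R := R) (M := M ⊗[R] M) (N := M ⊗[R] M)).1.comp
    (TensorProduct.congr e e).injective

theorem toQuarticForm_tmul (u u' : Module.Dual R M ⊗[R] Module.Dual R M) (t t' : M ⊗[R] M) :
    toQuarticForm (u ⊗ₜ u') (t ⊗ₜ t') = toForm u t * toForm u' t' := by
  simp [toQuarticForm, toForm]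

theorem toForm_tmul (f g : Module.Dual R M) (m m' : M) :
    toForm (f ⊗ₜ g) (m ⊗ₜ m') = f m * g m' := by
  simp [toForm]

/-- Elements of `(A ⊗ ℂ) ⊗ (M^∨ ⊗ M^∨)` as bilinear forms. -/
noncomputable def toQuadForm {A : Type} [CommRing A] [Algebra ℂ A] {M : Type} [AddCommGroup M]
    [Module A M] :
    (A ⊗[ℂ] ℂ) ⊗[A] (Module.Dual A M ⊗[A] Module.Dual A M) →ₗ[A] Module.Dual A (M ⊗[A] M) :=
  toForm ∘ₗ (TensorProduct.lid A _).toLinearMap ∘ₗ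
    LinearMap.rTensor _ (AlgebraTensorModule.rid ℂ A A).toLinearMap

theorem toQuadForm_injective {A : Type} [CommRing A] [Algebra ℂ A] {M : Type} [AddCommGroup M]
    [Module A M] [Module.Finite A M] [Module.Projective A M] :
    Function.Injective (toQuadForm (A := A) (M := M)) := by
  exact (dualDistrib_bijective (R := A) (M := M) (N := M)).1.comp
    ((TensorProduct.lid A _).injective.comp
      (LinearEquiv.rTensor (Module.Dual A M ⊗[A] Module.Dual A M)
        (AlgebraTensorModule.rid ℂ A A)).injective)

theorem toQuadForm_tmul {A : Type} [CommRing A] [Algebra ℂ A] {M : Type} [AddCommGroup M]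
    [Module A M] (a : A) (c : ℂ) (u : Module.Dual A M ⊗[A] Module.Dual A M) (t : M ⊗[A] M) :
    toQuadForm ((a ⊗ₜ[ℂ] c) ⊗ₜ[A] u) t = (c • a) * toForm u t := by
  simp [toQuadForm]

end QuadraticForms

/-! ### Multilinear forms under base change -/

section SemilinearForms

variable {R S M N : Type} [CommRing R] [CommRing S] [AddCommGroup M] [AddCommGroup N]
  [Module R M] [Module S N] {φ : R →+* S}

theorem toForm_semilinear (g : M →ₛₗ[φ] N) (d : Module.Dual R M →ₛₗ[φ] Module.Dual S N)
    (hd : ∀ f m, d f (g m) = φ (f m)) (u : Module.Dual R M ⊗[R] Module.Dual R M) (m m' : M) :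
    toForm (TensorProduct.map d d u) (g m ⊗ₜ g m') = φ (toForm u (m ⊗ₜ m')) := by
  induction u using TensorProduct.induction_on with
  | zero => simp
  | tmul f f' => rw [TensorProduct.map_tmul, toForm_tmul, toForm_tmul, hd, hd, map_mul]
  | add u u' hu hu' => simp only [map_add, LinearMap.add_apply, hu, hu']

theorem toQuarticForm_semilinear (g : M →ₛₗ[φ] N) (d : Module.Dual R M →ₛₗ[φ] Module.Dual S N)
    (hd : ∀ f m, d f (g m) = φ (f m))
    (u : (Module.Dual R M ⊗[R] Module.Dual R M) ⊗[R] (Module.Dual R M ⊗[R] Module.Dual R M))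
    (m₁ m₂ m₃ m₄ : M) :
    toQuarticForm (TensorProduct.map (TensorProduct.map d d) (TensorProduct.map d d) u)
      ((g m₁ ⊗ₜ g m₂) ⊗ₜ (g m₃ ⊗ₜ g m₄)) =
      φ (toQuarticForm u ((m₁ ⊗ₜ m₂) ⊗ₜ (m₃ ⊗ₜ m₄))) := by
  induction u using TensorProduct.induction_on with
  | zero => simp
  | tmul f f' =>
    rw [TensorProduct.map_tmul, toQuarticForm_tmul, toQuarticForm_tmul, toForm_semilinear g d hd,
      toForm_semilinear g d hd, map_mul]
  | add u u' hu hu' => simp only [map_add, LinearMap.add_apply, hu, hu']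

theorem toQuadForm_semilinear {A B : Type} [CommRing A] [CommRing B] [Algebra ℂ A] [Algebra ℂ B]
    {M N : Type} [AddCommGroup M] [AddCommGroup N] [Module A M] [Module B N] (φ : A →ₐ[ℂ] B)
    (g : M →ₛₗ[(φ : A →+* B)] N) (d : Module.Dual A M →ₛₗ[(φ : A →+* B)] Module.Dual B N)
    (hd : ∀ f m, d f (g m) = φ (f m))
    (u : (A ⊗[ℂ] ℂ) ⊗[A] (Module.Dual A M ⊗[A] Module.Dual A M)) (m m' : M) :
    toQuadForm (TensorProduct.map (extMap ℂ φ) (TensorProduct.map d d) u) (g m ⊗ₜ g m') =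
      φ (toQuadForm u (m ⊗ₜ m')) := by
  induction u using TensorProduct.induction_on with
  | zero => simp
  | tmul f f' =>
    induction f using TensorProduct.induction_on with
    | zero => simp
    | tmul a c =>
      rw [TensorProduct.map_tmul, extMap_tmul, toQuadForm_tmul, toQuadForm_tmul,
        toForm_semilinear g d hd, map_mul, map_smul]
      rfl
    | add f f' hf hf' => simp only [add_tmul, map_add, LinearMap.add_apply, hf, hf']
  | add u u' hu hu' => simp only [map_add, LinearMap.add_apply, hu, hu']

end SemilinearForms

/-! ### Values of sections of `O(4)` -/

section Quartics

variable {n : ℕ}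

/-- Values of sections of `O(4)`. -/
noncomputable def quarticEval (f : ((OTwo n).tensor (OTwo n)).Sections) {A : CommAlgCat.{0} ℂ}
    (x : (projectiveSpace n).obj A) :
    (line x ⊗[A] line x) ⊗[A] (line x ⊗[A] line x) →ₗ[A] A :=
  toQuarticForm (R := A) (M := line x) (Sections.eval f x)

theorem finite_line {A : CommAlgCat.{0} ℂ} (x : (projectiveSpace n).obj A) :
    Module.Finite A (line x) := finite_of_quot_projective (line x)

theorem projective_line {A : CommAlgCat.{0} ℂ} (x : (projectiveSpace n).obj A) :
    Module.Projective A (line x) := projective_of_quot_projective (line x)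

theorem eval_eq_of_quarticEval (f : ((OTwo n).tensor (OTwo n)).Sections)
    (g : ((OTwo n).tensor (OTwo n)).Sections) {A : CommAlgCat.{0} ℂ}
    (x : (projectiveSpace n).obj A) (h : quarticEval f x = quarticEval g x) :
    Sections.eval f x = Sections.eval g x :=
  have := finite_line x
  have := projective_line x
  toQuarticForm_injective (R := A) (M := line x) h

theorem quarticEval_map {A B : CommAlgCat.{0} ℂ} (f : ((OTwo n).tensor (OTwo n)).Sections)
    (φ : A ⟶ B) {x : (projectiveSpace n).obj A}
    {y : (projectiveSpace n).obj B} (h : (projectiveSpace n).map φ x = y) (l₁ l₂ l₃ l₄ : line x) :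
    quarticEval f y
      ((lineMap φ h l₁ ⊗ₜ lineMap φ h l₂) ⊗ₜ (lineMap φ h l₃ ⊗ₜ lineMap φ h l₄)) =
      φ.hom (quarticEval f x ((l₁ ⊗ₜ l₂) ⊗ₜ (l₃ ⊗ₜ l₄))) := by
  have key := toQuarticForm_semilinear (R := A) (S := B) (M := line x) (N := line y)
    (lineMap φ h) (OOneMap φ h) (OOne_map_apply φ h)
  refine Eq.trans ?_ (key (Sections.eval f x) l₁ l₂ l₃ l₄)
  exact congrArg (fun z => toQuarticForm (R := B) (M := line y) z _) (f.2 φ h).symm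

/-- The monomials of degree four, as products of two monomials of degree two. -/
noncomputable def quarticMonomial (i k : Fin 10) : ((OTwo 3).tensor (OTwo 3)).Sections :=
  tensorSection
    (tensorSection (coordSection 3 (fstVar i)) (coordSection 3 (sndVar i)))
    (tensorSection (coordSection 3 (fstVar k)) (coordSection 3 (sndVar k)))

/-- The section of `O(4)` given by a matrix of coefficients. -/
noncomputable def quarticSection (Γ : Fin 10 → Fin 10 → ℂ) : ((OTwo 3).tensor (OTwo 3)).Sections :=
  ∑ p : Fin 10 × Fin 10, Γ p.1 p.2 • quarticMonomial p.1 p.2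

theorem quarticEval_quarticSection (Γ : Fin 10 → Fin 10 → ℂ) {A : CommAlgCat.{0} ℂ}
    (x : (projectiveSpace 3).obj A) (l₁ l₂ l₃ l₄ : line x) :
    quarticEval (quarticSection Γ) x ((l₁ ⊗ₜ l₂) ⊗ₜ (l₃ ⊗ₜ l₄)) =
      ∑ p : Fin 10 × Fin 10, algebraMap ℂ A (Γ p.1 p.2) *
        ((coo A 4 l₁ (fstVar p.1) * coo A 4 l₂ (sndVar p.1)) *
          (coo A 4 l₃ (fstVar p.2) * coo A 4 l₄ (sndVar p.2))) := by
  have h1 : quarticEval (quarticSection Γ) x = ∑ p : Fin 10 × Fin 10, algebraMap ℂ A (Γ p.1 p.2) •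
      quarticEval (quarticMonomial p.1 p.2) x := by
    have := eval_sum_smul (fun p : Fin 10 × Fin 10 => Γ p.1 p.2)
      (fun p => quarticMonomial p.1 p.2) x
    refine (congrArg (fun z => toQuarticForm (R := A) (M := line x) z) this).trans ?_
    refine (map_sum (toQuarticForm (R := A) (M := line x)) _ _).trans ?_
    exact Finset.sum_congr rfl fun p _ => map_smul (toQuarticForm (R := A) (M := line x)) _ _
  rw [h1, LinearMap.sum_apply]
  refine Finset.sum_congr rfl fun p _ => ?_
  rw [LinearMap.smul_apply, smul_eq_mul]
  congr 1

end Quartics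

/-! ### Values of sections of `O(0,2)` -/

section Quadrics

variable {m n : ℕ}

/-- Values of sections of `O(0,2)`. -/
noncomputable def quadEval (s : (OZeroTwo m n).Sections) {A : CommAlgCat.{0} ℂ}
    (x : (projectiveSpace m).obj A) (y : (projectiveSpace n).obj A) :
    line y ⊗[A] line y →ₗ[A] A :=
  toQuadForm (A := A) (M := line y) (Sections.eval s ⟨x, y⟩)

theorem eval_eq_of_quadEval (s t : (OZeroTwo m n).Sections) {A : CommAlgCat.{0} ℂ}
    (x : (projectiveSpace m).obj A) (y : (projectiveSpace n).obj A)
    (h : quadEval s x y = quadEval t x y) :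
    Sections.eval s ⟨x, y⟩ = Sections.eval t ⟨x, y⟩ :=
  have := finite_line y
  have := projective_line y
  toQuadForm_injective (A := A) (M := line y) h

theorem quadEval_map {A B : CommAlgCat.{0} ℂ} (s : (OZeroTwo m n).Sections)
    (φ : A ⟶ B) {x : (projectiveSpace m).obj A} {x' : (projectiveSpace m).obj B}
    {y : (projectiveSpace n).obj A} {y' : (projectiveSpace n).obj B}
    (hx : (projectiveSpace m).map φ x = x') (h : (projectiveSpace n).map φ y = y')
    (l l' : line y) :
    quadEval s x' y' (lineMap φ h l ⊗ₜ lineMap φ h l') = φ.hom (quadEval s x y (l ⊗ₜ l')) := by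
  have hz : (FunctorToTypes.prod (projectiveSpace m) (projectiveSpace n)).map φ
      (⟨x, y⟩ : (FunctorToTypes.prod (projectiveSpace m) (projectiveSpace n)).obj A) = ⟨x', y'⟩ :=
    Prod.ext hx h
  have key := toQuadForm_semilinear (A := A) (B := B) (M := line y) (N := line y') φ.hom
    (lineMap φ h) (OOneMap φ h) (OOne_map_apply φ h)
  refine Eq.trans ?_ (key (Sections.eval s ⟨x, y⟩) l l')
  exact congrArg (fun z => toQuadForm (A := B) (M := line y') z _) (s.2 φ hz).symm

/-- The monomials of degree two as sections of `O(0,2)`. -/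
noncomputable def quadMonomial (m n : ℕ) (i j : Fin (n + 1)) : (OZeroTwo m n).Sections :=
  tensorSection
    (pullbackSection FunctorToTypes.prod.fst (constSection (projectiveSpace m) (1 : ℂ)))
    (pullbackSection FunctorToTypes.prod.snd (tensorSection (coordSection n i) (coordSection n j)))

theorem quadEval_quadMonomial (i j : Fin (n + 1)) {A : CommAlgCat.{0} ℂ}
    (x : (projectiveSpace m).obj A) (y : (projectiveSpace n).obj A) (l l' : line y) :
    quadEval (quadMonomial m n i j) x y (l ⊗ₜ l') = coo A (n + 1) l i * coo A (n + 1) l' j := by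
  have h : quadEval (quadMonomial m n i j) x y = toQuadForm (A := A) (M := line y)
      (((1 : A) ⊗ₜ[ℂ] (1 : ℂ)) ⊗ₜ[A] (lineForm y i ⊗ₜ[A] lineForm y j)) := rfl
  rw [h, toQuadForm_tmul, one_smul, one_mul, toForm_tmul, lineForm_apply, lineForm_apply]

/-- The section of `O(0,2)` given by a matrix. -/
noncomputable def quadSection (m : ℕ) {n : ℕ} (B : Fin (n + 1) → Fin (n + 1) → ℂ) :
    (OZeroTwo m n).Sections :=
  ∑ p : Fin (n + 1) × Fin (n + 1), B p.1 p.2 • quadMonomial m n p.1 p.2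

theorem quadEval_quadSection (B : Fin (n + 1) → Fin (n + 1) → ℂ) {A : CommAlgCat.{0} ℂ}
    (x : (projectiveSpace m).obj A) (y : (projectiveSpace n).obj A) (l l' : line y) :
    quadEval (quadSection m B) x y (l ⊗ₜ l') = ∑ p : Fin (n + 1) × Fin (n + 1),
      algebraMap ℂ A (B p.1 p.2) * (coo A (n + 1) l p.1 * coo A (n + 1) l' p.2) := by
  have h1 : quadEval (quadSection m B) x y = ∑ p : Fin (n + 1) × Fin (n + 1),
      algebraMap ℂ A (B p.1 p.2) • quadEval (quadMonomial m n p.1 p.2) x y := by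
    have := eval_sum_smul (fun p : Fin (n + 1) × Fin (n + 1) => B p.1 p.2)
      (fun p => quadMonomial m n p.1 p.2)
      (⟨x, y⟩ : (FunctorToTypes.prod (projectiveSpace m) (projectiveSpace n)).obj A)
    refine (congrArg (fun z => toQuadForm (A := A) (M := line y) z) this).trans ?_
    refine (map_sum (toQuadForm (A := A) (M := line y)) _ _).trans ?_
    exact Finset.sum_congr rfl fun p _ => map_smul (toQuadForm (A := A) (M := line y)) _ _
  rw [h1, LinearMap.sum_apply]
  refine Finset.sum_congr rfl fun p _ => ?_
  rw [LinearMap.smul_apply, smul_eq_mul, quadEval_quadMonomial]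

end Quadrics

/-! ### Bihomogeneous polynomials as combinations of monomials -/

section Monomials

open MvPolynomial

variable {α β : Type} [Fintype α] [Fintype β]

theorem exists_eq_single_inl_add {m : α ⊕ β →₀ ℕ} {d e : ℕ} (h : ∑ i, m (.inl i) = d + 1)
    (h' : ∑ j, m (.inr j) = e) : ∃ i m', m = Finsupp.single (.inl i) 1 + m' ∧
      ∑ i, m' (.inl i) = d ∧ ∑ j, m' (.inr j) = e := by
  classical
  obtain ⟨i, -, hi⟩ := Finset.exists_ne_zero_of_sum_ne_zero (by omega : ∑ i, m (.inl i) ≠ 0)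
  have hm : m = Finsupp.single (.inl i) 1 + (m - Finsupp.single (.inl i) 1) := by
    rw [add_tsub_cancel_of_le]
    exact Finsupp.single_le_iff.2 (Nat.one_le_iff_ne_zero.2 hi)
  refine ⟨i, _, hm, ?_, ?_⟩
  · rw [hm] at h
    simp only [Finsupp.add_apply, Finset.sum_add_distrib, Finsupp.single_apply, Sum.inl.injEq,
      Finset.sum_ite_eq, Finset.mem_univ, if_true] at h
    omega
  · rw [hm] at h'
    simpa [Finset.sum_add_distrib, Finsupp.single_apply] using h'

theorem exists_eq_single_inr_add {m : α ⊕ β →₀ ℕ} {d e : ℕ} (h : ∑ i, m (.inl i) = d)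
    (h' : ∑ j, m (.inr j) = e + 1) : ∃ j m', m = Finsupp.single (.inr j) 1 + m' ∧
      ∑ i, m' (.inl i) = d ∧ ∑ j, m' (.inr j) = e := by
  classical
  obtain ⟨i, -, hi⟩ := Finset.exists_ne_zero_of_sum_ne_zero (by omega : ∑ i, m (.inr i) ≠ 0)
  have hm : m = Finsupp.single (.inr i) 1 + (m - Finsupp.single (.inr i) 1) := by
    rw [add_tsub_cancel_of_le]
    exact Finsupp.single_le_iff.2 (Nat.one_le_iff_ne_zero.2 hi)
  refine ⟨i, _, hm, ?_, ?_⟩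
  · rw [hm] at h
    simpa [Finset.sum_add_distrib, Finsupp.single_apply] using h
  · rw [hm] at h'
    simp only [Finsupp.add_apply, Finset.sum_add_distrib, Finsupp.single_apply, Sum.inr.injEq,
      Finset.sum_ite_eq, Finset.mem_univ, if_true] at h'
    omega

theorem eq_zero_of_degrees {m : α ⊕ β →₀ ℕ} (h : ∑ i, m (.inl i) = 0)
    (h' : ∑ j, m (.inr j) = 0) : m = 0 := by
  ext s
  cases s with
  | inl i => exact (Finset.sum_eq_zero_iff.1 h) i (Finset.mem_univ i)
  | inr j => exact (Finset.sum_eq_zero_iff.1 h') j (Finset.mem_univ j)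

theorem mem_span_of_monomial_mem {σ : Type} {S : Submodule ℂ (MvPolynomial σ ℂ)}
    {p : MvPolynomial σ ℂ} (h : ∀ m, coeff m p ≠ 0 → monomial m (1 : ℂ) ∈ S) : p ∈ S := by
  rw [← support_sum_monomial_coeff p]
  refine Submodule.sum_mem _ fun m hm => ?_
  have : monomial m (coeff m p) = coeff m p • monomial m (1 : ℂ) := by
    rw [smul_monomial, smul_eq_mul, mul_one]
  rw [this]
  exact S.smul_mem _ (h m (mem_support_iff.1 hm))

theorem monomial_single_add {σ : Type} (s : σ) (m : σ →₀ ℕ) :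
    monomial (Finsupp.single s 1 + m) (1 : ℂ) = X s * monomial m 1 := by
  rw [X, monomial_mul, one_mul]

/-- A form of degree four is a combination of products of pairs of quadratic monomials. -/
theorem exists_quartic_coeff {p : BiPoly 2 0} (hp : IsBihomogeneous p 4 0) :
    ∃ Γ : Fin 10 → Fin 10 → ℂ, p = ∑ q : Fin 10 × Fin 10, Γ q.1 q.2 •
      ((X (.inl (fstVar q.1)) * X (.inl (sndVar q.1))) *
        (X (.inl (fstVar q.2)) * X (.inl (sndVar q.2)))) := by
  have : p ∈ Submodule.span ℂ (Set.range fun q : Fin 10 × Fin 10 =>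
      ((X (.inl (fstVar q.1)) * X (.inl (sndVar q.1))) *
        (X (.inl (fstVar q.2)) * X (.inl (sndVar q.2))) : BiPoly 2 0)) := by
    refine mem_span_of_monomial_mem fun m hm => ?_
    obtain ⟨h, h'⟩ := hp m hm
    obtain ⟨a, m, rfl, h, h'⟩ := exists_eq_single_inl_add h h'
    obtain ⟨b, m, rfl, h, h'⟩ := exists_eq_single_inl_add h h'
    obtain ⟨c, m, rfl, h, h'⟩ := exists_eq_single_inl_add h h'
    obtain ⟨d, m, rfl, h, h'⟩ := exists_eq_single_inl_add h h'
    obtain rfl := eq_zero_of_degrees h h'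
    obtain ⟨i, hi⟩ := exists_monomial a b
    obtain ⟨k, hk⟩ := exists_monomial c d
    refine Submodule.subset_span ⟨(i, k), ?_⟩
    simp only [monomial_single_add, monomial_zero', C_1, mul_one]
    obtain ⟨rfl, rfl⟩ | ⟨rfl, rfl⟩ := hi <;> obtain ⟨rfl, rfl⟩ | ⟨rfl, rfl⟩ := hk <;> ring
  obtain ⟨Γ, hΓ⟩ := (Submodule.mem_span_range_iff_exists_fun ℂ).1 this
  exact ⟨fun i k => Γ (i, k), hΓ.symm⟩

theorem exists_quadric_coeff {a b : ℕ} {p : BiPoly a b} (hp : IsBihomogeneous p 0 2) :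
    ∃ B : Fin (b + 2) → Fin (b + 2) → ℂ, p = ∑ q : Fin (b + 2) × Fin (b + 2), B q.1 q.2 •
      (X (.inr q.1) * X (.inr q.2)) := by
  have : p ∈ Submodule.span ℂ (Set.range fun q : Fin (b + 2) × Fin (b + 2) =>
      (X (.inr q.1) * X (.inr q.2) : BiPoly a b)) := by
    refine mem_span_of_monomial_mem fun m hm => ?_
    obtain ⟨h, h'⟩ := hp m hm
    obtain ⟨i, m, rfl, h, h'⟩ := exists_eq_single_inr_add h h'
    obtain ⟨j, m, rfl, h, h'⟩ := exists_eq_single_inr_add h h'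
    obtain rfl := eq_zero_of_degrees h h'
    refine Submodule.subset_span ⟨(i, j), ?_⟩
    simp only [monomial_single_add, monomial_zero', C_1, mul_one]
  obtain ⟨B, hB⟩ := (Submodule.mem_span_range_iff_exists_fun ℂ).1 this
  exact ⟨fun i k => B (i, k), hB.symm⟩

end Monomials

/-! ### Classification of sections of `O(4)` and `O(0,2)` -/

section Classification

variable {n : ℕ}

/-- The value of a quartic on a vector of a line. -/
noncomputable def quarticVal (f : ((OTwo n).tensor (OTwo n)).Sections) {A : CommAlgCat.{0} ℂ}
    (x : (projectiveSpace n).obj A) (l : line x) : A :=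
  quarticEval f x ((l ⊗ₜ l) ⊗ₜ (l ⊗ₜ l))

theorem quarticVal_smul (f : ((OTwo n).tensor (OTwo n)).Sections) {A : CommAlgCat.{0} ℂ}
    (x : (projectiveSpace n).obj A) (l : line x) (a : A) :
    quarticVal f x (a • l) = a ^ 4 * quarticVal f x l := by
  simp only [quarticVal, smul_tmul_smul, map_smul, smul_eq_mul]
  ring

theorem quarticVal_congr (f : ((OTwo n).tensor (OTwo n)).Sections) {A : CommAlgCat.{0} ℂ}
    {x y : (projectiveSpace n).obj A} (h : x = y) {l : line x} {l' : line y}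
    (hl : (l : A ⊗[ℂ] (Fin (n + 1) → ℂ)) = l') : quarticVal f x l = quarticVal f y l' := by
  subst h
  rw [Subtype.ext hl]

theorem quarticVal_map (f : ((OTwo n).tensor (OTwo n)).Sections) {A B : CommAlgCat.{0} ℂ}
    (φ : A ⟶ B) {x : (projectiveSpace n).obj A} {y : (projectiveSpace n).obj B}
    (h : (projectiveSpace n).map φ x = y) (l : line x) :
    quarticVal f y (lineMap φ h l) = φ.hom (quarticVal f x l) :=
  quarticEval_map f φ h l l l l

theorem exists_isUnit_smul {A : Type*} [CommRing A] {m : ℕ} {v : Fin m → A} {a : A}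
    (ha : IsUnit a) (hv : ∃ i, IsUnit (v i)) : ∃ i, IsUnit ((a • v) i) :=
  hv.imp fun _ h => ha.mul h

theorem isUnit_algebraMap {A : Type*} [CommRing A] [Algebra ℂ A] {c : ℂ} (hc : c ≠ 0) :
    IsUnit (algebraMap ℂ A c) := (IsUnit.mk0 c hc).map _

theorem coe_framedVec_smul {A : CommAlgCat.{0} ℂ} (v : Fin (n + 1) → A) (hv : ∃ i, IsUnit (v i))
    (a : A) (ha : IsUnit a) :
    (framedVec (a • v) (exists_isUnit_smul ha hv) : A ⊗[ℂ] (Fin (n + 1) → ℂ)) =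
      (a • framedVec v hv : line (framedPoint v hv)) :=
  map_smul (coo A (n + 1)).symm a v

theorem quarticVal_framed_map (f : ((OTwo n).tensor (OTwo n)).Sections) {A B : CommAlgCat.{0} ℂ}
    (φ : A ⟶ B) (v : Fin (n + 1) → A) (hv : ∃ i, IsUnit (v i)) :
    φ.hom (quarticVal f (framedPoint v hv) (framedVec v hv)) =
      quarticVal f (framedPoint (fun i => φ.hom (v i)) (exists_isUnit_map φ hv))
        (framedVec _ (exists_isUnit_map φ hv)) := by
  rw [← lineMap_framedVec φ v hv, quarticVal_map]

theorem quarticVal_framed_smul (f : ((OTwo n).tensor (OTwo n)).Sections) {A : CommAlgCat.{0} ℂ}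
    (v : Fin (n + 1) → A) (hv : ∃ i, IsUnit (v i)) (a : A) (ha : IsUnit a)
    (hav : ∃ i, IsUnit ((a • v) i)) :
    quarticVal f (framedPoint (a • v) hav) (framedVec (a • v) hav) =
      a ^ 4 * quarticVal f (framedPoint v hv) (framedVec v hv) := by
  rw [← quarticVal_smul]
  exact quarticVal_congr f (framedPoint_smul v hv a ha hav) (coe_framedVec_smul v hv a ha)

/-- The line of a framed point is spanned by `framedVec`, so bilinear maps on it are determined by
one value. -/
theorem linearMap_ext_framed {A : CommAlgCat.{0} ℂ} (v : Fin (n + 1) → A)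
    (hv : ∃ i, IsUnit (v i)) {M : Type*} [AddCommGroup M] [Module A M]
    {α β : line (framedPoint v hv) ⊗[A] line (framedPoint v hv) →ₗ[A] M}
    (h : α (framedVec v hv ⊗ₜ framedVec v hv) = β (framedVec v hv ⊗ₜ framedVec v hv)) : α = β := by
  apply TensorProduct.ext'
  intro l l'
  obtain ⟨a, rfl⟩ := exists_smul_framedVec v hv l
  obtain ⟨a', rfl⟩ := exists_smul_framedVec v hv l'
  simp only [smul_tmul_smul, map_smul, h]

theorem quarticEval_ext_framed (f g : ((OTwo n).tensor (OTwo n)).Sections) {A : CommAlgCat.{0} ℂ}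
    (v : Fin (n + 1) → A) (hv : ∃ i, IsUnit (v i))
    (h : quarticVal f (framedPoint v hv) (framedVec v hv) =
      quarticVal g (framedPoint v hv) (framedVec v hv)) :
    quarticEval f (framedPoint v hv) = quarticEval g (framedPoint v hv) := by
  apply TensorProduct.ext
  refine linearMap_ext_framed v hv (linearMap_ext_framed v hv ?_)
  exact h

theorem quarticVal_quarticSection (Γ : Fin 10 → Fin 10 → ℂ) {A : CommAlgCat.{0} ℂ}
    (v : Fin 4 → A) (hv : ∃ i, IsUnit (v i)) :
    quarticVal (quarticSection Γ) (framedPoint v hv) (framedVec v hv) =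
      ∑ p : Fin 10 × Fin 10, algebraMap ℂ A (Γ p.1 p.2) *
        ((v (fstVar p.1) * v (sndVar p.1)) * (v (fstVar p.2) * v (sndVar p.2))) := by
  rw [quarticVal, quarticEval_quarticSection]
  have h : coo A 4 (framedVec v hv : A ⊗[ℂ] (Fin (3 + 1) → ℂ)) = v := coo_framedVec v hv
  simp only [h]

/-- The value on the coordinate vector is a regular function of `v` that scales with weight four,
hence a quartic form. Over local rings this single value determines the section. -/
theorem exists_quarticSection (f : ((OTwo 3).tensor (OTwo 3)).Sections) :
    ∃ Γ, f = quarticSection Γ := by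
  -- The second punctured space is a dummy: the function ignores `w` and has degree zero in it.
  let G : PuncturedFunction 2 0 :=
    { val := fun v w hv hw => quarticVal f (framedPoint (n := 3) v hv) (framedVec (n := 3) v hv)
      natural := fun φ v w hv hw => quarticVal_framed_map f φ v hv }
  obtain ⟨p, hp⟩ := G.exists_poly
  have hval {A : CommAlgCat.{0} ℂ} (v : Fin 4 → A) (w : Fin 2 → A) (hv) (hw : ∃ i, IsUnit (w i)) :
      MvPolynomial.aeval (Sum.elim v w) p =
        quarticVal f (framedPoint (n := 3) v hv) (framedVec (n := 3) v hv) := (hp v w hv hw).symm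
  have hb : IsBihomogeneous p 4 0 := by
    refine isBihomogeneous_of_scale p 4 0 fun {A} v w hv hw c c' hc hc' => ?_
    rw [hval _ _ (exists_isUnit_smul (isUnit_algebraMap hc) hv)
      (exists_isUnit_smul (isUnit_algebraMap hc') hw), hval v w hv hw,
      quarticVal_framed_smul f v hv _ (isUnit_algebraMap hc), pow_zero, mul_one, map_pow]
  obtain ⟨Γ, rfl⟩ := exists_quartic_coeff hb
  refine ⟨Γ, sections_ext_of_isLocalRing fun {A} _ x => ?_⟩
  obtain ⟨v, hv, rfl⟩ := exists_framedPoint_of_isLocalRing x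
  apply eval_eq_of_quarticEval
  apply quarticEval_ext_framed
  rw [← hval v (fun _ => 1) hv ⟨0, isUnit_one⟩, quarticVal_quarticSection, map_sum]
  simp [Algebra.smul_def]

variable {m : ℕ}

/-- The value of a section of `O(0,2)` on a vector of a line. -/
noncomputable def quadVal (s : (OZeroTwo m n).Sections) {A : CommAlgCat.{0} ℂ}
    (x : (projectiveSpace m).obj A) (y : (projectiveSpace n).obj A) (l : line y) : A :=
  quadEval s x y (l ⊗ₜ l)

theorem quadVal_smul (s : (OZeroTwo m n).Sections) {A : CommAlgCat.{0} ℂ}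
    (x : (projectiveSpace m).obj A) (y : (projectiveSpace n).obj A) (l : line y) (a : A) :
    quadVal s x y (a • l) = a ^ 2 * quadVal s x y l := by
  simp only [quadVal, smul_tmul_smul, map_smul, smul_eq_mul]
  ring

theorem quadVal_congr (s : (OZeroTwo m n).Sections) {A : CommAlgCat.{0} ℂ}
    {x x' : (projectiveSpace m).obj A} {y y' : (projectiveSpace n).obj A} (h : x = x')
    (h' : y = y') {l : line y} {l' : line y'}
    (hl : (l : A ⊗[ℂ] (Fin (n + 1) → ℂ)) = l') : quadVal s x y l = quadVal s x' y' l' := by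
  subst h h'
  rw [Subtype.ext hl]

theorem quadVal_framed_map (s : (OZeroTwo m n).Sections) {A B : CommAlgCat.{0} ℂ}
    (φ : A ⟶ B) (v : Fin (m + 1) → A) (hv : ∃ i, IsUnit (v i)) (w : Fin (n + 1) → A)
    (hw : ∃ i, IsUnit (w i)) :
    φ.hom (quadVal s (framedPoint v hv) (framedPoint w hw) (framedVec w hw)) =
      quadVal s (framedPoint (fun i => φ.hom (v i)) (exists_isUnit_map φ hv))
        (framedPoint (fun i => φ.hom (w i)) (exists_isUnit_map φ hw))
        (framedVec _ (exists_isUnit_map φ hw)) := by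
  rw [← lineMap_framedVec φ w hw]
  exact (quadEval_map s φ (map_framedPoint φ v hv) (map_framedPoint φ w hw) _ _).symm

theorem quadVal_framed_smul (s : (OZeroTwo m n).Sections) {A : CommAlgCat.{0} ℂ}
    (v : Fin (m + 1) → A) (hv : ∃ i, IsUnit (v i)) (w : Fin (n + 1) → A)
    (hw : ∃ i, IsUnit (w i)) (a b : A) (ha : IsUnit a) (hb : IsUnit b)
    (hav : ∃ i, IsUnit ((a • v) i)) (hbw : ∃ i, IsUnit ((b • w) i)) :
    quadVal s (framedPoint (a • v) hav) (framedPoint (b • w) hbw) (framedVec (b • w) hbw) =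
      b ^ 2 * quadVal s (framedPoint v hv) (framedPoint w hw) (framedVec w hw) := by
  rw [← quadVal_smul]
  exact quadVal_congr s (framedPoint_smul v hv a ha hav) (framedPoint_smul w hw b hb hbw)
    (coe_framedVec_smul w hw b hb)

/-- The value on `w` has bidegree `(0, 2)`; degree zero in the first group removes the dependence on
the point of the first factor. -/
theorem exists_quadSection (s : (OZeroTwo (m + 1) (n + 1)).Sections) :
    ∃ B, s = quadSection (m + 1) B := by
  let G : PuncturedFunction m n :=
    { val := fun v w hv hw => quadVal s (framedPoint v hv) (framedPoint w hw) (framedVec w hw)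
      natural := fun φ v w hv hw => quadVal_framed_map s φ v hv w hw }
  obtain ⟨p, hp⟩ := G.exists_poly
  have hval {A : CommAlgCat.{0} ℂ} (v : Fin (m + 2) → A) (w : Fin (n + 2) → A) (hv) (hw) :
      MvPolynomial.aeval (Sum.elim v w) p =
        quadVal s (framedPoint v hv) (framedPoint w hw) (framedVec w hw) := (hp v w hv hw).symm
  have hb : IsBihomogeneous p 0 2 := by
    refine isBihomogeneous_of_scale p 0 2 fun {A} v w hv hw c c' hc hc' => ?_
    rw [hval _ _ (exists_isUnit_smul (isUnit_algebraMap hc) hv)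
      (exists_isUnit_smul (isUnit_algebraMap hc') hw), hval v w hv hw,
      quadVal_framed_smul s v hv w hw _ _ (isUnit_algebraMap hc) (isUnit_algebraMap hc'),
      pow_zero, one_mul, map_pow]
  obtain ⟨B, rfl⟩ := exists_quadric_coeff hb
  refine ⟨B, sections_ext_of_isLocalRing fun {A} _ z => ?_⟩
  obtain ⟨x, y⟩ := z
  obtain ⟨v, hv, rfl⟩ := exists_framedPoint_of_isLocalRing x
  obtain ⟨w, hw, rfl⟩ := exists_framedPoint_of_isLocalRing y
  apply eval_eq_of_quadEval
  refine linearMap_ext_framed w hw ((hval v w hv hw).symm.trans ?_)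
  rw [quadEval_quadSection, map_sum]
  simp [Algebra.smul_def]

end Classification

/-! ### Sections of `E(0,1)` contracted with vectors -/

theorem contractDual_semilinear {R S M M' N N' : Type} [CommRing R] [CommRing S]
    [AddCommGroup M] [AddCommGroup M'] [AddCommGroup N] [AddCommGroup N'] [Module R M]
    [Module R N] [Module S M'] [Module S N'] {φ : R →+* S} (g : N →ₛₗ[φ] N') (k : M →ₛₗ[φ] M')
    (d : Module.Dual R M →ₛₗ[φ] Module.Dual S M') (hd : ∀ f m, d f (k m) = φ (f m))
    (t : N ⊗[R] Module.Dual R M) (m : M) :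
    contractDual (k m) (TensorProduct.map g d t) = g (contractDual m t) := by
  induction t using TensorProduct.induction_on with
  | zero => simp
  | tmul a f => rw [TensorProduct.map_tmul, contractDual_tmul, contractDual_tmul, hd,
      LinearMap.map_smulₛₗ]
  | add t t' ht ht' => simp only [map_add, ht, ht']

theorem contractDual_smul {R M N : Type} [CommRing R] [AddCommGroup M] [AddCommGroup N]
    [Module R M] [Module R N] (a : R) (m : M) (t : N ⊗[R] Module.Dual R M) :
    contractDual (a • m) t = a • contractDual m t := by
  induction t using TensorProduct.induction_on with
  | zero => simp
  | tmul n f => rw [contractDual_tmul, contractDual_tmul, map_smul, smul_assoc]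
  | add t t' ht ht' => simp only [map_add, ht, ht', smul_add]

section TwistedSections

variable {m n : ℕ} {E : VecBundle (projectiveSpace m)} {A B : CommAlgCat.{0} ℂ}

/-- The contraction of a section of `E(0,1)` with a vector of a line. -/
noncomputable def twistVal (s : (twistZeroOne E n).Sections) (x : (projectiveSpace m).obj A)
    (y : (projectiveSpace n).obj A) (w : line y) : E.fib x :=
  contractDual (R := A) (M := line y) (N := E.fib x) w (Sections.eval s ⟨x, y⟩)

theorem twistVal_smul (s : (twistZeroOne E n).Sections) (x : (projectiveSpace m).obj A)
    (y : (projectiveSpace n).obj A) (a : A) (w : line y) :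
    twistVal s x y (a • w) = a • twistVal s x y w :=
  contractDual_smul (R := A) (M := line y) (N := E.fib x) a w _

theorem twistVal_sub (s t : (twistZeroOne E n).Sections) (x : (projectiveSpace m).obj A)
    (y : (projectiveSpace n).obj A) (w : line y) :
    twistVal (s - t) x y w = twistVal s x y w - twistVal t x y w :=
  map_sub (contractDual (R := A) (M := line y) (N := E.fib x) w) _ _

theorem twistVal_sum_smul {ι : Type} [Fintype ι] (c : ι → ℂ)
    (s : ι → (twistZeroOne E n).Sections) (x : (projectiveSpace m).obj A)
    (y : (projectiveSpace n).obj A) (w : line y) :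
    twistVal (∑ i, c i • s i) x y w = ∑ i, algebraMap ℂ A (c i) • twistVal (s i) x y w := by
  have := eval_sum_smul c s
    (⟨x, y⟩ : (FunctorToTypes.prod (projectiveSpace m) (projectiveSpace n)).obj A)
  refine (congrArg (contractDual (R := A) (M := line y) (N := E.fib x) w) this).trans ?_
  refine (map_sum (contractDual (R := A) (M := line y) (N := E.fib x) w) _ _).trans ?_
  exact Finset.sum_congr rfl fun p _ =>
    map_smul (contractDual (R := A) (M := line y) (N := E.fib x) w) _ _

theorem twistVal_map (s : (twistZeroOne E n).Sections) (φ : A ⟶ B)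
    {x : (projectiveSpace m).obj A} {x' : (projectiveSpace m).obj B}
    {y : (projectiveSpace n).obj A} {y' : (projectiveSpace n).obj B}
    (hx : (projectiveSpace m).map φ x = x') (hy : (projectiveSpace n).map φ y = y')
    (w : line y) :
    E.map φ hx (twistVal s x y w) = twistVal s x' y' (lineMap φ hy w) := by
  have hz : (FunctorToTypes.prod (projectiveSpace m) (projectiveSpace n)).map φ
      (⟨x, y⟩ : (FunctorToTypes.prod (projectiveSpace m) (projectiveSpace n)).obj A) = ⟨x', y'⟩ :=
    Prod.ext hx hy
  have key := contractDual_semilinear (R := A) (S := B) (M := line y) (M' := line y')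
    (N := E.fib x) (N' := E.fib x') (E.map φ hx)
    (lineMap φ hy) (OOneMap φ hy) (OOne_map_apply φ hy)
  refine (key (Sections.eval s ⟨x, y⟩) w).symm.trans ?_
  exact congrArg (contractDual (R := B) (M := line y') (N := E.fib x') (lineMap φ hy w)) (s.2 φ hz)

theorem eval_eq_of_twistVal (s t : (twistZeroOne E n).Sections) (x : (projectiveSpace m).obj A)
    (y : (projectiveSpace n).obj A) (h : ∀ w, twistVal s x y w = twistVal t x y w) :
    Sections.eval s ⟨x, y⟩ = Sections.eval t ⟨x, y⟩ :=
  have := finite_line y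
  have := projective_line y
  contractDual_ext (R := A) (M := line y) (N := E.fib x) h

/-- The product of a section of `E` and a coordinate. -/
noncomputable def twistSection (t : E.Sections) (n : ℕ) (j : Fin (n + 1)) :
    (twistZeroOne E n).Sections :=
  tensorSection (pullbackSection FunctorToTypes.prod.fst t)
    (pullbackSection FunctorToTypes.prod.snd (coordSection n j))

theorem twistVal_twistSection (t : E.Sections) (j : Fin (n + 1)) (x : (projectiveSpace m).obj A)
    (y : (projectiveSpace n).obj A) (w : line y) :
    twistVal (twistSection t n j) x y w = lineForm y j w • Sections.eval t x := by
  have h : twistVal (twistSection t n j) x y w =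
      contractDual (R := A) (M := line y) (N := E.fib x) w
        ((Sections.eval t x : E.fib x) ⊗ₜ[A] (lineForm y j : Module.Dual A (line y))) := rfl
  rw [h, contractDual_tmul]

end TwistedSections

/-! ### Minors detecting `L²` inside `Sym² V` -/

section MinorForms

variable {n : ℕ} {A B : CommAlgCat.{0} ℂ} (D : SnakeDiagram n)

/-- Since `L` is invertible, coordinates of any two of its vectors satisfy `u_i v_j = v_i u_j`.
Hence the coordinates of an element of `L²` are proportional to the products `l_a l_b`. -/
theorem symCoo_lineSqIncl (x : (projectiveSpace n).obj A) (l : line x) (a b c d : Fin (n + 1))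
    (t : line x ⊗[A] line x) :
    symCoo A a b (SnakeDiagram.lineSqIncl x t) * (lineForm x c l * lineForm x d l) =
      symCoo A c d (SnakeDiagram.lineSqIncl x t) * (lineForm x a l * lineForm x b l) := by
  induction t using TensorProduct.induction_on with
  | zero => simp
  | add t t' ht ht' => simp only [map_add, add_mul, ht, ht']
  | tmul u v =>
    have key (i j : Fin (n + 1)) (u v : line x) :
        lineForm x i u * lineForm x j v = lineForm x i v * lineForm x j u := by
      have := congrArg (lineForm x j) (smul_comm_of_invertible (lineForm x i) u v)
      simpa using this
    rw [SnakeDiagram.lineSqIncl_tmul, symCoo_symMk, symCoo_symMk]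
    simp only [← lineForm_apply]
    linear_combination algebraMap ℂ A (1 / 2) * (lineForm x b v * lineForm x d l * key a c u l
      + lineForm x a v * lineForm x d l * key b c u l
      + lineForm x c u * lineForm x a l * key b d v l + lineForm x c u * lineForm x b l * key a d v l
      + lineForm x a l * lineForm x b l * key c d u v)

/-- The linear form `ω ↦ ω_{ab} l_c l_d - ω_{cd} l_a l_b` on the fibres of `Λ`. -/
noncomputable def minorForm (x : (projectiveSpace n).obj A) (l : line x) (a b c d : Fin (n + 1)) :
    D.Λ.fib x →ₗ[A] A :=
  descLin (D.bFib x) (D.bFib_surjective x)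
    ((lineForm x c l * lineForm x d l) • symCoo A a b -
      (lineForm x a l * lineForm x b l) • symCoo A c d) fun u hu => by
    obtain ⟨t, rfl⟩ := (D.bFib_eq_zero_iff x u).1 hu
    have := symCoo_lineSqIncl x l a b c d t
    rw [LinearMap.sub_apply, LinearMap.smul_apply, LinearMap.smul_apply, smul_eq_mul, smul_eq_mul,
      mul_comm, this, mul_comm, sub_self]

theorem minorForm_bFib (x : (projectiveSpace n).obj A) (l : line x) (a b c d : Fin (n + 1))
    (u : SymSq A (A ⊗[ℂ] (Fin (n + 1) → ℂ))) :
    minorForm D x l a b c d (D.bFib x u) = (lineForm x c l * lineForm x d l) * symCoo A a b u -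
      (lineForm x a l * lineForm x b l) * symCoo A c d u :=
  descLin_apply ..

theorem minorForm_smul (x : (projectiveSpace n).obj A) (r : A) (l : line x)
    (a b c d : Fin (n + 1)) (ξ : D.Λ.fib x) :
    minorForm D x (r • l) a b c d ξ = r ^ 2 * minorForm D x l a b c d ξ := by
  obtain ⟨u, rfl⟩ := D.bFib_surjective x ξ
  simp only [minorForm_bFib, map_smul, smul_eq_mul]
  ring

theorem minorForm_map (φ : A ⟶ B) {x : (projectiveSpace n).obj A} {y : (projectiveSpace n).obj B}
    (h : (projectiveSpace n).map φ x = y) (l : line x) (a b c d : Fin (n + 1)) (ξ : D.Λ.fib x) :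
    minorForm D y (lineMap φ h l) a b c d (D.Λ.map φ h ξ) =
      φ.hom (minorForm D x l a b c d ξ) := by
  obtain ⟨u, rfl⟩ := D.bFib_surjective x ξ
  rw [D.bFib_map, minorForm_bFib, minorForm_bFib]
  simp only [symCoo_symSqMap, lineForm_apply, coo_lineMap, map_sub, map_mul]

/-- When `v_i` is a unit, the minors against the pair `(i, i)` say that the lift is `u_ii / v_i²`
times `v²`, an element of `L²`. -/
theorem eq_zero_of_minorForm (v : Fin (n + 1) → A) (hv : ∃ i, IsUnit (v i))
    (ξ : D.Λ.fib (framedPoint v hv))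
    (h : ∀ a b c d, minorForm D (framedPoint v hv) (framedVec v hv) a b c d ξ = 0) : ξ = 0 := by
  obtain ⟨u, rfl⟩ := D.bFib_surjective _ ξ
  obtain ⟨i, r, hr⟩ := hv
  refine (D.bFib_eq_zero_iff _ u).2 ⟨((r⁻¹ : Aˣ) * (r⁻¹ : Aˣ) * symCoo A i i u : A) •
    (framedVec v ⟨i, r, hr⟩ ⊗ₜ framedVec v ⟨i, r, hr⟩), ?_⟩
  rw [map_smul, SnakeDiagram.lineSqIncl_tmul]
  refine symCoo_ext fun a b => ?_
  have := h a b i i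
  rw [minorForm_bFib] at this
  simp only [lineForm_apply, coo_framedVec] at this
  rw [map_smul, symCoo_symMk_self, coo_framedVec, smul_eq_mul, ← mul_one (symCoo A a b u),
    ← one_mul (1 : A), ← r.inv_mul, hr]
  linear_combination - (r⁻¹ : Aˣ) * (r⁻¹ : Aˣ) * this

end MinorForms

/-! ### Sections of `Λ(0,1)` as bihomogeneous polynomials -/

theorem coo_symCoordEquiv_monomial {A : Type} [CommRing A] [Algebra ℂ A]
    (t : SymSq A (A ⊗[ℂ] (Fin 4 → ℂ))) (a b : Fin 4) :
    coo A 10 (symCoordEquiv A t) (monomialEquiv s(a, b)) = symCoo A a b t := by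
  rw [symCoordEquiv, LinearEquiv.trans_apply, LinearEquiv.trans_apply,
    LinearEquiv.apply_symm_apply, LinearEquiv.funCongrLeft_apply, LinearMap.funLeft_apply,
    Equiv.symm_apply_apply, symSqEquiv_apply]

theorem symCoo_symCoordEquiv_symm {A : Type} [CommRing A] [Algebra ℂ A]
    (u : A ⊗[ℂ] (Fin 10 → ℂ)) (a b : Fin 4) :
    symCoo A a b ((symCoordEquiv A).symm u) = coo A 10 u (monomialEquiv s(a, b)) := by
  rw [← coo_symCoordEquiv_monomial, LinearEquiv.apply_symm_apply]

theorem one_tmul_single {A : Type} [CommRing A] [Algebra ℂ A] {n : ℕ} (i : Fin n) :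
    (1 : A) ⊗ₜ[ℂ] (Pi.single i 1 : Fin n → ℂ) = stdVec A i := by
  apply (coo A n).injective
  ext j
  rw [coo_tmul, coo_stdVec, Pi.single_apply]
  simp

theorem vec_eq_sum {A : Type} [CommRing A] [Algebra ℂ A] {n : ℕ} (v : Fin n → A) :
    vec v = ∑ i, v i • stdVec A i := by
  conv_lhs => rw [← sum_coo_stdVec (vec v)]
  simp only [coo_vec]

namespace SnakeDiagram

variable (D : SnakeDiagram 3) {A B : CommAlgCat.{0} ℂ}

/-- The map `O^{10} → Λ` on fibres. -/
noncomputable def lamFib (x : (projectiveSpace 3).obj A) :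
    A ⊗[ℂ] (Fin 10 → ℂ) →ₗ[A] D.Λ.fib x :=
  D.bFib x ∘ₗ (symCoordEquiv A).symm.toLinearMap

/-- The sections of `Λ` induced by `Sym² V`. -/
noncomputable def constLambda (u : Fin 10 → ℂ) : D.Λ.Sections :=
  mapSection (symTrivialIso.inv ≫ D.b) (constSection _ u)

theorem eval_constLambda (u : Fin 10 → ℂ) (x : (projectiveSpace 3).obj A) :
    Sections.eval (D.constLambda u) x = D.lamFib x ((1 : A) ⊗ₜ u) := rfl

/-- The section of `Λ(0,1)` given by a matrix. -/
noncomputable def lambdaSection {n : ℕ} (σ : Fin 10 → Fin (n + 1) → ℂ) :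
    (twistZeroOne D.Λ n).Sections :=
  ∑ p : Fin 10 × Fin (n + 1), σ p.1 p.2 • twistSection (D.constLambda (Pi.single p.1 1)) n p.2

/-- The linear map given by a matrix of complex numbers. -/
noncomputable def _root_.FanoBundles.scalarMulVec (A : Type) [CommRing A] [Algebra ℂ A] {k l : ℕ}
    (σ : Fin k → Fin l → ℂ) (w : Fin l → A) : Fin k → A :=
  fun i => ∑ j, algebraMap ℂ A (σ i j) * w j

theorem twistVal_lambdaSection {n : ℕ} (σ : Fin 10 → Fin (n + 1) → ℂ)
    (x : (projectiveSpace 3).obj A) (y : (projectiveSpace n).obj A) (w : line y) :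
    twistVal (D.lambdaSection σ) x y w =
      D.lamFib x (vec (scalarMulVec A σ (coo A (n + 1) (w : A ⊗[ℂ] (Fin (n + 1) → ℂ))))) := by
  have h1 := twistVal_sum_smul (fun p : Fin 10 × Fin (n + 1) => σ p.1 p.2)
    (fun p => twistSection (D.constLambda (Pi.single p.1 1)) n p.2) x y w
  refine h1.trans ?_
  rw [vec_eq_sum, map_sum, Fintype.sum_prod_type]
  refine Finset.sum_congr rfl fun i _ => ?_
  rw [map_smul, scalarMulVec, Finset.sum_smul]
  refine Finset.sum_congr rfl fun j _ => ?_
  rw [twistVal_twistSection, eval_constLambda, one_tmul_single, mul_smul, lineForm_apply]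

/-- The coordinates of a section of `Λ(0,1)` with respect to vectors of lines. -/
noncomputable def lambdaVal {n : ℕ} (s : (twistZeroOne D.Λ n).Sections)
    (x : (projectiveSpace 3).obj A) (y : (projectiveSpace n).obj A) (l : line x) (w : line y)
    (a b c d : Fin 4) : A :=
  minorForm D x l a b c d (twistVal s x y w)

variable {n : ℕ}

theorem lambdaVal_congr (s : (twistZeroOne D.Λ n).Sections)
    {x x' : (projectiveSpace 3).obj A} {y y' : (projectiveSpace n).obj A} (hx : x = x')
    (hy : y = y') {l : line x} {l' : line x'} {w : line y} {w' : line y'}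
    (hl : (l : A ⊗[ℂ] (Fin (3 + 1) → ℂ)) = l') (hw : (w : A ⊗[ℂ] (Fin (n + 1) → ℂ)) = w')
    (a b c d : Fin 4) : D.lambdaVal s x y l w a b c d = D.lambdaVal s x' y' l' w' a b c d := by
  subst hx hy
  rw [Subtype.ext hl, Subtype.ext hw]

theorem lambdaVal_smul (s : (twistZeroOne D.Λ n).Sections)
    (x : (projectiveSpace 3).obj A) (y : (projectiveSpace n).obj A) (l : line x) (w : line y)
    (r r' : A) (a b c d : Fin 4) :
    D.lambdaVal s x y (r • l) (r' • w) a b c d = r ^ 2 * r' * D.lambdaVal s x y l w a b c d := by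
  rw [lambdaVal, minorForm_smul, twistVal_smul, map_smul, smul_eq_mul, mul_assoc, lambdaVal]

theorem lambdaVal_framed_map (s : (twistZeroOne D.Λ n).Sections) (φ : A ⟶ B)
    (v : Fin 4 → A) (hv : ∃ i, IsUnit (v i)) (w : Fin (n + 1) → A) (hw : ∃ i, IsUnit (w i))
    (a b c d : Fin 4) :
    φ.hom (D.lambdaVal s (framedPoint (n := 3) v hv) (framedPoint w hw) (framedVec v hv)
        (framedVec w hw) a b c d) =
      D.lambdaVal s (framedPoint (n := 3) (fun i => φ.hom (v i)) (exists_isUnit_map φ hv))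
        (framedPoint (fun i => φ.hom (w i)) (exists_isUnit_map φ hw))
        (framedVec _ (exists_isUnit_map φ hv)) (framedVec _ (exists_isUnit_map φ hw)) a b c d := by
  have h1 := lineMap_framedVec (n := 3) φ v hv
  have h2 := lineMap_framedVec φ w hw
  rw [lambdaVal, ← minorForm_map D φ (map_framedPoint (n := 3) φ v hv),
    twistVal_map s φ (map_framedPoint (n := 3) φ v hv) (map_framedPoint φ w hw), h1, h2]
  rfl

theorem lambdaVal_framed_smul (s : (twistZeroOne D.Λ n).Sections)
    (v : Fin 4 → A) (hv : ∃ i, IsUnit (v i)) (w : Fin (n + 1) → A)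
    (hw : ∃ i, IsUnit (w i)) (r r' : A) (hr : IsUnit r) (hr' : IsUnit r')
    (hrv : ∃ i, IsUnit ((r • v) i)) (hrw : ∃ i, IsUnit ((r' • w) i)) (a b c d : Fin 4) :
    D.lambdaVal s (framedPoint (n := 3) (r • v) hrv) (framedPoint (r' • w) hrw)
        (framedVec (r • v) hrv) (framedVec (r' • w) hrw) a b c d =
      r ^ 2 * r' * D.lambdaVal s (framedPoint (n := 3) v hv) (framedPoint w hw) (framedVec v hv)
        (framedVec w hw) a b c d := by
  rw [← lambdaVal_smul]
  exact D.lambdaVal_congr s (framedPoint_smul (n := 3) v hv r hr hrv)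
    (framedPoint_smul w hw r' hr' hrw)
    (coe_framedVec_smul (n := 3) v hv r hr) (coe_framedVec_smul w hw r' hr') a b c d

/-- After lifting the value to `Sym² V` these are genuine 2 × 2 determinants, and the identity is
their syzygy. Up to the factor `l_e²` it expresses every minor through those against `(e, e)`. -/
theorem lambdaVal_cocycle (s : (twistZeroOne D.Λ n).Sections)
    (x : (projectiveSpace 3).obj A) (y : (projectiveSpace n).obj A) (l : line x) (w : line y)
    (a b c d e : Fin 4) :
    lineForm x e l * lineForm x e l * D.lambdaVal s x y l w a b c d =
      lineForm x c l * lineForm x d l * D.lambdaVal s x y l w a b e e -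
        lineForm x a l * lineForm x b l * D.lambdaVal s x y l w c d e e := by
  rw [lambdaVal, lambdaVal, lambdaVal]
  obtain ⟨u, hu⟩ := D.bFib_surjective x (twistVal s x y w)
  rw [← hu]
  simp only [minorForm_bFib]
  ring

theorem lambdaVal_sub (s t : (twistZeroOne D.Λ n).Sections)
    (x : (projectiveSpace 3).obj A) (y : (projectiveSpace n).obj A) (l : line x) (w : line y)
    (a b c d : Fin 4) :
    D.lambdaVal (s - t) x y l w a b c d =
      D.lambdaVal s x y l w a b c d - D.lambdaVal t x y l w a b c d := by
  rw [lambdaVal, twistVal_sub, map_sub]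
  rfl

theorem lambdaVal_lambdaSection (σ : Fin 10 → Fin (n + 1) → ℂ)
    (v : Fin 4 → A) (hv : ∃ i, IsUnit (v i)) (w : Fin (n + 1) → A) (hw : ∃ i, IsUnit (w i))
    (a b c d : Fin 4) :
    D.lambdaVal (D.lambdaSection σ) (framedPoint (n := 3) v hv) (framedPoint w hw) (framedVec v hv)
      (framedVec w hw) a b c d =
      v c * v d * scalarMulVec A σ w (monomialEquiv s(a, b)) -
        v a * v b * scalarMulVec A σ w (monomialEquiv s(c, d)) := by
  have h : coo A 4 (framedVec v hv : A ⊗[ℂ] (Fin (3 + 1) → ℂ)) = v := coo_framedVec v hv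
  rw [lambdaVal, twistVal_lambdaSection, coo_framedVec, lamFib, LinearMap.comp_apply,
    minorForm_bFib]
  simp only [lineForm_apply, h, LinearEquiv.coe_coe]
  have h2 (a b : Fin 4) : symCoo A a b ((symCoordEquiv A).symm (vec (scalarMulVec A σ w))) =
      scalarMulVec A σ w (monomialEquiv s(a, b)) := by rw [symCoo_symCoordEquiv_symm, coo_vec]
  exact congrArg₂ (fun z z' => v c * v d * z - v a * v b * z') (h2 a b) (h2 c d)

/-- Local rings suffice, where all points have coordinates; there the lines are spanned by framed
vectors and the minors separate elements of `Λ`. -/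
theorem section_eq_of_lambdaVal {s t : (twistZeroOne D.Λ n).Sections}
    (h : ∀ {A : CommAlgCat.{0} ℂ} (v : Fin 4 → A) (hv : ∃ i, IsUnit (v i)) (w : Fin (n + 1) → A)
      (hw : ∃ i, IsUnit (w i)) (a b c d : Fin 4),
      D.lambdaVal s (framedPoint (n := 3) v hv) (framedPoint w hw) (framedVec v hv)
        (framedVec w hw) a b c d = D.lambdaVal t (framedPoint (n := 3) v hv) (framedPoint w hw)
        (framedVec v hv) (framedVec w hw) a b c d) : s = t := by
  refine sections_ext_of_isLocalRing fun {A} _ z => ?_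
  obtain ⟨x, y⟩ := z
  obtain ⟨v, hv, rfl⟩ := exists_framedPoint_of_isLocalRing x
  obtain ⟨w, hw, rfl⟩ := exists_framedPoint_of_isLocalRing y
  refine eval_eq_of_twistVal s t _ _ fun w' => ?_
  obtain ⟨r, rfl⟩ := exists_smul_framedVec w hw w'
  rw [twistVal_smul, twistVal_smul]
  congr 1
  rw [← sub_eq_zero]
  refine eq_zero_of_minorForm D v hv _ fun a b c d => ?_
  rw [map_sub, sub_eq_zero]
  exact h v hv w hw a b c d

/-- A minor of the value is quadratic in the vector of the first line and linear in that of the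
second, which gives the bidegree of the polynomial. -/
theorem exists_lambda_poly (s : (twistZeroOne D.Λ (n + 1)).Sections) (a b c d : Fin 4) :
    ∃ p : BiPoly 2 n, IsBihomogeneous p 2 1 ∧ ∀ {A : CommAlgCat.{0} ℂ} (v : Fin 4 → A)
      (hv : ∃ i, IsUnit (v i)) (w : Fin (n + 1 + 1) → A) (hw : ∃ i, IsUnit (w i)),
      D.lambdaVal s (framedPoint (n := 3) v hv) (framedPoint w hw) (framedVec v hv)
        (framedVec w hw) a b c d = MvPolynomial.aeval (Sum.elim v w) p := by
  let G : PuncturedFunction 2 n :=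
    { val := fun v w hv hw => D.lambdaVal s (framedPoint (n := 3) v hv) (framedPoint w hw)
        (framedVec (n := 3) v hv) (framedVec w hw) a b c d
      natural := fun φ v w hv hw => D.lambdaVal_framed_map s φ v hv w hw a b c d }
  obtain ⟨p, hp⟩ := G.exists_poly
  have hval {A : CommAlgCat.{0} ℂ} (v : Fin 4 → A) (w : Fin (n + 2) → A) (hv) (hw) :
      D.lambdaVal s (framedPoint (n := 3) v hv) (framedPoint w hw) (framedVec v hv)
        (framedVec w hw) a b c d = MvPolynomial.aeval (Sum.elim v w) p := hp v w hv hw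
  refine ⟨p, isBihomogeneous_of_scale p 2 1 fun {A} v w hv hw c c' hc hc' => ?_,
    fun {A} v hv w hw => hval v w hv hw⟩
  rw [← hval _ _ (exists_isUnit_smul (isUnit_algebraMap hc) hv)
      (exists_isUnit_smul (isUnit_algebraMap hc') hw), ← hval v w hv hw,
      D.lambdaVal_framed_smul s v hv w hw _ _ (isUnit_algebraMap hc) (isUnit_algebraMap hc'),
      map_mul, map_pow, map_pow, pow_one]

end SnakeDiagram

/-! ### Polynomials satisfying the syzygies of the minors -/

section CocyclePolynomials

open MvPolynomial

variable {n : ℕ}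

/-- The exponent of `x_a x_b z_j`. -/
noncomputable def cubicExp (a b : Fin 4) (j : Fin (n + 2)) : Fin 4 ⊕ Fin (n + 2) →₀ ℕ :=
  Finsupp.single (.inl a) 1 + (Finsupp.single (.inl b) 1 + Finsupp.single (.inr j) 1)

theorem cubicExp_inl (a b c : Fin 4) (j : Fin (n + 2)) :
    cubicExp a b j (.inl c) = (if a = c then 1 else 0) + (if b = c then 1 else 0) := by
  simp [cubicExp, Finsupp.single_apply]

theorem cubicExp_inr (a b : Fin 4) (j k : Fin (n + 2)) :
    cubicExp a b j (.inr k) = if j = k then 1 else 0 := by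
  simp [cubicExp, Finsupp.single_apply]

theorem cubicExp_eq_iff {a b c : Fin 4} {j k : Fin (n + 2)} :
    cubicExp a b j = cubicExp c c k ↔ (a = c ∧ b = c) ∧ j = k := by
  constructor
  · intro h
    have h1 := DFunLike.congr_fun h (.inl c)
    have h2 := DFunLike.congr_fun h (.inr j)
    rw [cubicExp_inl, cubicExp_inl] at h1
    rw [cubicExp_inr, cubicExp_inr] at h2
    split_ifs at h1 h2 <;> simp_all
  · rintro ⟨⟨rfl, rfl⟩, rfl⟩
    rfl

theorem exists_cubicExp {p : BiPoly 2 n} (hp : IsBihomogeneous p 2 1)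
    {m : Fin 4 ⊕ Fin (n + 2) →₀ ℕ} (hm : coeff m p ≠ 0) : ∃ a b j, m = cubicExp a b j := by
  obtain ⟨h, h'⟩ := hp m hm
  obtain ⟨a, m, rfl, h, h'⟩ := exists_eq_single_inl_add h h'
  obtain ⟨b, m, rfl, h, h'⟩ := exists_eq_single_inl_add h h'
  obtain ⟨j, m, rfl, h, h'⟩ := exists_eq_single_inr_add h h'
  obtain rfl := eq_zero_of_degrees h h'
  exact ⟨a, b, j, by rw [add_zero]; rfl⟩

theorem exists_cubicExp_self {p : BiPoly 2 n} (hp : IsBihomogeneous p 2 1)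
    {m : Fin 4 ⊕ Fin (n + 2) →₀ ℕ} (hm : coeff m p ≠ 0) {c : Fin 4} (hc : 2 ≤ m (.inl c)) :
    ∃ j, m = cubicExp c c j := by
  obtain ⟨a, b, j, rfl⟩ := exists_cubicExp hp hm
  rw [cubicExp_inl] at hc
  refine ⟨j, ?_⟩
  split_ifs at hc <;> simp_all

theorem coeff_sq_mul {σ : Type} (s : σ) (p : MvPolynomial σ ℂ) (m : σ →₀ ℕ) :
    coeff (m + Finsupp.single s 2) (X s * X s * p) = coeff m p := by
  have : X s * X s = (monomial (Finsupp.single s 2) 1 : MvPolynomial σ ℂ) := by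
    rw [X, monomial_mul, ← Finsupp.single_add, one_mul]
  rw [this, add_comm, coeff_monomial_mul, one_mul]

theorem coeff_sq_mul_eq_zero {σ : Type} (s : σ) (p : MvPolynomial σ ℂ) {m : σ →₀ ℕ}
    (hm : m s < 2) : coeff m (X s * X s * p) = 0 := by
  have : X s * X s = (monomial (Finsupp.single s 2) 1 : MvPolynomial σ ℂ) := by
    rw [X, monomial_mul, ← Finsupp.single_add, one_mul]
  classical
  rw [this, coeff_monomial_mul', if_neg]
  rw [Finsupp.single_le_iff]
  omega

/-- The polynomials satisfying the cocycle relation vanish if suitable coefficients vanish. -/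
theorem cocycle_eq_zero {P : Fin 4 → Fin 4 → BiPoly 2 n}
    {Q : Fin 4 → Fin 4 → Fin 4 → Fin 4 → BiPoly 2 n}
    (hP : ∀ a b, IsBihomogeneous (P a b) 2 1)
    (hrel : ∀ a b c d, X (.inl 0) * X (.inl 0) * Q a b c d =
      X (.inl c) * X (.inl d) * P a b - X (.inl a) * X (.inl b) * P c d)
    (h0 : ∀ a b j, coeff (cubicExp 0 0 j) (P a b) = 0)
    (h1 : ∀ j, coeff (cubicExp 1 1 j) (P 1 1) = 0) (a b : Fin 4) : P a b = 0 := by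
  -- Monomials of degree below two in `x_0` do not see the left side of the relation, so there the
  -- coefficients of `p` are those of `R` shifted by `x_c²`.
  have step {c : Fin 4} (hc : c ≠ 0) (R p q : BiPoly 2 n)
      (h : X (.inl 0) * X (.inl 0) * q = X (.inl c) * X (.inl c) * p - R)
      (m : Fin 4 ⊕ Fin (n + 2) →₀ ℕ) (hm : m (.inl 0) < 2) :
      coeff m p = coeff (m + Finsupp.single (.inl c) 2) R := by
    have := congrArg (coeff (m + Finsupp.single (.inl c) 2)) h
    rw [coeff_sub, coeff_sq_mul, coeff_sq_mul_eq_zero _ _ (by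
      simpa [Finsupp.single_apply, hc] using Nat.le_of_lt_succ hm)]
      at this
    exact (sub_eq_zero.1 this.symm)
  -- The relation against `(2, 2)` shows that a monomial of `P 1 1` not divisible by `x_0²` is
  -- divisible by `x_1²`. The two possible kinds of coefficients vanish by `h0` and `h1`.
  have h11 : P 1 1 = 0 := by
    ext m
    rw [coeff_zero]
    by_contra hm
    by_cases hlt : m (.inl 0) < 2
    · by_cases hlt' : m (.inl 1) < 2
      · refine hm ((step (c := 2) (by decide) _ _ _ (hrel 1 1 2 2) m hlt).trans ?_)
        exact coeff_sq_mul_eq_zero _ _ (by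
          simpa [Finsupp.single_apply] using Nat.le_of_lt_succ hlt')
      · obtain ⟨j, rfl⟩ := exists_cubicExp_self (hP 1 1) hm (not_lt.1 hlt')
        exact hm (h1 j)
    · obtain ⟨j, rfl⟩ := exists_cubicExp_self (hP 1 1) hm (not_lt.1 hlt)
      exact hm (h0 1 1 j)
  ext m
  rw [coeff_zero]
  by_contra hm
  -- For the other pairs compare with `P 1 1 = 0` through the relation against `(1, 1)`.
  by_cases hlt : m (.inl 0) < 2
  · refine hm ((step (c := 1) (by decide) _ _ _ (hrel a b 1 1) m hlt).trans ?_)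
    rw [h11, mul_zero, coeff_zero]
  · obtain ⟨j, rfl⟩ := exists_cubicExp_self (hP a b) hm (not_lt.1 hlt)
    exact hm (h0 a b j)

theorem coeff_linear_mul (τ : Fin (n + 2) → ℂ) (a b : Fin 4) (c : Fin 4) (k : Fin (n + 2)) :
    coeff (cubicExp c c k)
      (X (.inl a) * X (.inl b) * ∑ j, C (τ j) * X (.inr j) : BiPoly 2 n) =
      if a = c ∧ b = c then τ k else 0 := by
  classical
  have h (j : Fin (n + 2)) : (X (.inl a) * X (.inl b) * (C (τ j) * X (.inr j)) : BiPoly 2 n) =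
      monomial (cubicExp a b j) (τ j) := by
    simp [cubicExp, X, monomial_mul, C_mul_monomial, add_assoc]
  rw [Finset.mul_sum, coeff_sum]
  simp only [h, coeff_monomial, cubicExp_eq_iff]
  by_cases hab : a = c ∧ b = c <;> simp [hab]

end CocyclePolynomials

/-! ### All sections of `Λ(0,1)` -/

namespace SnakeDiagram

open MvPolynomial

variable (D : SnakeDiagram 3) {n : ℕ}

/-- All sections of `Λ(0,1)` are combinations of products of sections of `Sym² V ⊗ O` and
coordinates. -/
theorem exists_lambdaSection (s : (twistZeroOne D.Λ (n + 1)).Sections) :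
    ∃ σ, s = D.lambdaSection σ := by
  choose P hPhom hPval using D.exists_lambda_poly s
  let i₀ := monomialEquiv s(0, 0)
  -- The section of a matrix contributes `x_0² σ_ab(z) - x_a x_b σ_00(z)` to the minor of `ab`
  -- against `00`. So the `x_0²` terms prescribe `σ_ab` for `ab ≠ 00`, and the `x_1²` terms of the
  -- minor of `11` prescribe `-σ_00`.
  let σ : Fin 10 → Fin (n + 2) → ℂ := fun i j =>
    if i = i₀ then - coeff (cubicExp 1 1 j) (P 1 1 0 0) else
      coeff (cubicExp 0 0 j) (P (fstVar i) (sndVar i) 0 0)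
  choose P' hPhom' hPval' using D.exists_lambda_poly (s - D.lambdaSection σ)
  have hP' (a b c d : Fin 4) : P' a b c d = P a b c d -
      (X (.inl c) * X (.inl d) * ∑ j, C (σ (monomialEquiv s(a, b)) j) * X (.inr j) -
        X (.inl a) * X (.inl b) * ∑ j, C (σ (monomialEquiv s(c, d)) j) * X (.inr j)) := by
    apply bipoly_ext
    intro A v w hv hw
    rw [← hPval' a b c d v hv w hw, lambdaVal_sub, lambdaVal_lambdaSection, hPval a b c d v hv w hw]
    simp [scalarMulVec]
  have hsymm (a b : Fin 4) : P a b 0 0 = P b a 0 0 := by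
    apply bipoly_ext
    intro A v w hv hw
    rw [← hPval a b 0 0 v hv w hw, ← hPval b a 0 0 v hv w hw]
    obtain ⟨u, hu⟩ := D.bFib_surjective _ (twistVal s (framedPoint (n := 3) v hv)
      (framedPoint w hw) (framedVec w hw))
    rw [lambdaVal, lambdaVal, ← hu, minorForm_bFib, minorForm_bFib, symCoo_comm b a]
    ring
  have hzero : P 0 0 0 0 = 0 := by
    apply bipoly_ext
    intro A v w hv hw
    rw [← hPval 0 0 0 0 v hv w hw, map_zero]
    obtain ⟨u, hu⟩ := D.bFib_surjective _ (twistVal s (framedPoint (n := 3) v hv)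
      (framedPoint w hw) (framedVec w hw))
    rw [lambdaVal, ← hu, minorForm_bFib, sub_self]
  have hvar (a b : Fin 4) : P (fstVar (monomialEquiv s(a, b))) (sndVar (monomialEquiv s(a, b))) 0 0 =
      P a b 0 0 := by
    have := monomialEquiv_symm (monomialEquiv s(a, b))
    rw [Equiv.symm_apply_apply, Sym2.eq_iff] at this
    obtain ⟨h, h'⟩ | ⟨h, h'⟩ := this
    · rw [← h, ← h']
    · rw [← h, ← h', hsymm]
  have hi₀ (a b : Fin 4) : monomialEquiv s(a, b) = i₀ ↔ a = 0 ∧ b = 0 := by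
    rw [monomialEquiv.apply_eq_iff_eq, Sym2.eq_iff, or_self]
  have hrel (a b c d : Fin 4) : X (.inl 0) * X (.inl 0) * P' a b c d =
      X (.inl c) * X (.inl d) * P' a b 0 0 - X (.inl a) * X (.inl b) * P' c d 0 0 := by
    apply bipoly_ext
    intro A v w hv hw
    simp only [map_mul, map_sub, aeval_X, Sum.elim_inl, ← hPval' _ _ _ _ v hv w hw]
    have h := D.lambdaVal_cocycle (s - D.lambdaSection σ) (framedPoint (n := 3) v hv)
      (framedPoint w hw) (framedVec v hv) (framedVec w hw) a b c d 0
    have hc : coo A 4 (framedVec v hv : A ⊗[ℂ] (Fin (3 + 1) → ℂ)) = v := coo_framedVec v hv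
    simpa only [lineForm_apply, hc] using h
  -- Subtracting the section of `σ` has removed exactly the coefficients that the vanishing
  -- criterion asks about.
  have hmain := cocycle_eq_zero (P := fun a b => P' a b 0 0) (fun a b => hPhom' a b 0 0) hrel
    (fun a b j => by
      change coeff _ (P' a b 0 0) = 0
      rw [hP', coeff_sub, coeff_sub, coeff_linear_mul, coeff_linear_mul, if_pos ⟨rfl, rfl⟩]
      by_cases hab : a = 0 ∧ b = 0
      · obtain ⟨rfl, rfl⟩ := hab
        simp [hzero]
      · rw [if_neg hab]
        simp only [σ, if_neg (mt (hi₀ a b).1 hab), hvar]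
        ring)
    (fun j => by
      change coeff _ (P' 1 1 0 0) = 0
      rw [hP', coeff_sub, coeff_sub, coeff_linear_mul, coeff_linear_mul, if_neg (by decide),
        if_pos ⟨rfl, rfl⟩]
      simp [σ, i₀])
  refine ⟨σ, D.section_eq_of_lambdaVal fun {A} v hv w hw a b c d => ?_⟩
  rw [← sub_eq_zero, ← lambdaVal_sub, hPval' a b c d v hv w hw]
  have : P' a b c d = 0 := by
    have := hrel a b c d
    rw [hmain a b, hmain c d, mul_zero, mul_zero, sub_zero] at this
    exact (mul_eq_zero.1 this).resolve_left (mul_ne_zero (X_ne_zero _) (X_ne_zero _))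
  rw [this, map_zero]

end SnakeDiagram

/-! ### Global sections of `Λ` and nonsplitting of the extension -/

namespace SnakeDiagram

variable (D : SnakeDiagram 3)

/-- All global sections of `Λ` come from `Sym² V`. -/
theorem exists_constLambda (t : D.Λ.Sections) : ∃ u, t = D.constLambda u := by
  -- Multiplying `t` by a coordinate of ℙ¹ gives a section of `Λ(0,1)`; `t` is recovered at the
  -- point `[1 : 0]`.
  obtain ⟨σ, hσ⟩ := D.exists_lambdaSection (twistSection t 1 0)
  refine ⟨fun i => σ i 0, Subtype.ext (funext fun A => funext fun x => ?_)⟩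
  let w : Fin (1 + 1) → A := ![1, 0]
  have hw : ∃ i, IsUnit (w i) := ⟨0, isUnit_one⟩
  have h1 := twistVal_twistSection t 0 x (framedPoint w hw) (framedVec w hw)
  rw [hσ, twistVal_lambdaSection, lineForm_apply, coo_framedVec] at h1
  have h2 : w 0 • Sections.eval t x = Sections.eval t x := one_smul _ _
  refine (h2.symm.trans h1.symm).trans ?_
  refine Eq.trans ?_ (D.eval_constLambda (fun i => σ i 0) x).symm
  congr 1
  apply (coo A 10).injective
  ext i
  rw [coo_vec, coo_tmul, scalarMulVec, Fin.sum_univ_two]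
  simp [w, Algebra.smul_def]

/-- The map `Λ → Sym² Q` on fibres. -/
noncomputable def pFib {A : CommAlgCat.{0} ℂ} (x : (projectiveSpace 3).obj A) :
    D.Λ.fib x →ₗ[A] SymSq A ((A ⊗[ℂ] (Fin (3 + 1) → ℂ)) ⧸ line x) :=
  Hom.app D.p x

theorem pFib_bFib {A : CommAlgCat.{0} ℂ} (x : (projectiveSpace 3).obj A)
    (u : SymSq A (A ⊗[ℂ] (Fin (3 + 1) → ℂ))) :
    D.pFib x (D.bFib x u) = symSqMap (line x).mkQ u := by
  have := comp_app D.b D.p x u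
  rw [D.comm_bottom] at this
  exact this.symm

/-- The kernel of `Sym² V → Sym² Q` at `[e_a]` is `V e_a`, whose elements have zero coordinate at
any pair of indices avoiding `a`. -/
theorem symCoo_eq_zero_of_symSqMap (a b c : Fin 4) (hb : b ≠ a) (hc : c ≠ a)
    (u : SymSq ℂ (ℂ ⊗[ℂ] (Fin (3 + 1) → ℂ))) {v : Fin 4 → ℂ}
    (hv : v = Pi.single a 1) (hu : ∃ i, IsUnit (v i))
    (h : symSqMap (line (A := CommAlgCat.of ℂ ℂ) (framedPoint (n := 3) v hu)).mkQ u = 0) :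
    symCoo ℂ b c u = 0 := by
  obtain ⟨t, rfl⟩ := (symMulSub_exact
    (line (A := CommAlgCat.of ℂ ℂ) (framedPoint (n := 3) v hu)) u).1 h
  clear h
  subst hv
  induction t using TensorProduct.induction_on with
  | zero => simp
  | add t t' ht ht' => rw [map_add, map_add, ht, ht', add_zero]
  | tmul y l =>
    obtain ⟨r, rfl⟩ := exists_smul_framedVec (n := 3) (A := CommAlgCat.of ℂ ℂ) _ hu l
    have hl (d : Fin 4) (hd : d ≠ a) : coo ℂ 4 ((r • framedVec (n := 3) (A := CommAlgCat.of ℂ ℂ)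
        (Pi.single a 1 : Fin 4 → ℂ) hu : line _) : ℂ ⊗[ℂ] (Fin 4 → ℂ)) d = 0 := by
      have h1 := congrFun (map_smul (coo ℂ 4) r (vec (Pi.single a 1 : Fin 4 → ℂ))) d
      refine h1.trans ?_
      rw [coo_vec, Pi.smul_apply, Pi.single_eq_of_ne hd, smul_zero]
    rw [symMulSub_tmul, symCoo_symMk]
    erw [hl b hb, hl c hc]
    simp

theorem exists_ne_of_pair (b c : Fin 4) : ∃ a, b ≠ a ∧ c ≠ a := by
  decide +revert

/-- Given a splitting `r`, the section `t - r p t` is killed by `p` and comes from `Sym² V`. An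
element of `Sym² V` that lies in `V e_a` for each `a` is zero, so `t = r p t`. This fails for the
section of `2 e_0 e_1` at `[e_0]`. -/
theorem not_split : ¬ ∃ r : (tautQuot 3).sym2 ⟶ D.Λ, r ≫ D.p = 𝟙 (tautQuot 3).sym2 := by
  rintro ⟨r, hr⟩
  have hpr {A : CommAlgCat.{0} ℂ} (x : (projectiveSpace 3).obj A)
      (rx : SymSq A ((A ⊗[ℂ] (Fin (3 + 1) → ℂ)) ⧸ line x) →ₗ[A] D.Λ.fib x)
      (hrx : rx = Hom.app r x) (q) : D.pFib x (rx q) = q := by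
    subst hrx
    have := comp_app r D.p x q
    rw [hr] at this
    exact this.symm
  let C := CommAlgCat.of ℂ ℂ
  let pt (a : Fin 4) : (projectiveSpace 3).obj C :=
    framedPoint (n := 3) (Pi.single a 1 : Fin 4 → ℂ) ⟨a, by simp⟩
  let u : Fin 10 → ℂ := Pi.single (monomialEquiv s(0, 1)) 1
  let t := D.constLambda u
  let t' := t - mapSection r (mapSection D.p t)
  have ht' {A : CommAlgCat.{0} ℂ} (x : (projectiveSpace 3).obj A) :
      ∃ rx : SymSq A ((A ⊗[ℂ] (Fin (3 + 1) → ℂ)) ⧸ line x) →ₗ[A] D.Λ.fib x, rx = Hom.app r x ∧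
        Sections.eval t' x = Sections.eval t x - rx (D.pFib x (Sections.eval t x)) :=
    ⟨Hom.app r x, rfl, rfl⟩
  obtain ⟨u', hu'⟩ := D.exists_constLambda t'
  have hzero : u' = 0 := by
    ext i
    -- Two indices cannot exhaust four, so some coordinate point detects this coordinate of `u'`.
    obtain ⟨a, hb, hc⟩ := exists_ne_of_pair (fstVar i) (sndVar i)
    have h1 : D.pFib (pt a) (Sections.eval t' (pt a)) = 0 := by
      obtain ⟨rx, hrx, h⟩ := ht' (pt a)
      rw [h, map_sub, hpr _ rx hrx, sub_self]
    rw [hu', eval_constLambda, lamFib, LinearMap.comp_apply, pFib_bFib] at h1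
    have h2 := symCoo_eq_zero_of_symSqMap a _ _ hb hc _ rfl _ h1
    rw [← coo_symCoordEquiv] at h2
    have h3 : coo ℂ 10 ((1 : ℂ) ⊗ₜ[ℂ] u') i = 0 := by
      refine Eq.trans ?_ h2
      exact congrFun (congrArg (coo ℂ 10) ((symCoordEquiv ℂ).apply_symm_apply _).symm) i
    simpa [coo_tmul] using h3
  have h4 : Sections.eval t (pt 0) = 0 := by
    have h5 : Sections.eval t' (pt 0) = 0 := by
      rw [hu', hzero, eval_constLambda, tmul_zero, map_zero]
    have h6 : D.pFib (pt 0) (Sections.eval t (pt 0)) = 0 := by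
      have h7 : Sections.eval t (pt 0) = D.bFib (pt 0) ((symCoordEquiv ℂ).symm (1 ⊗ₜ u)) := rfl
      -- The factor two compensates the averaging of the two orders in `symCoo`.
      have h8 : (symCoordEquiv ℂ).symm ((1 : ℂ) ⊗ₜ[ℂ] u) =
          (2 : ℂ) • symMk ℂ (stdVec ℂ 1) (stdVec ℂ 0) := by
        refine symCoo_ext fun a b => ?_
        rw [symCoo_symCoordEquiv_symm, coo_tmul, map_smul, symCoo_symMk]
        simp only [coo_stdVec, u, Pi.single_apply, monomialEquiv.apply_eq_iff_eq, Sym2.eq_iff]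
        fin_cases a <;> fin_cases b <;> simp
      rw [h7, pFib_bFib, h8, map_smul, symSqMap_symMk]
      have h9 : (line (pt 0)).mkQ (stdVec ℂ 0) = 0 := by
        rw [Submodule.mkQ_apply, Submodule.Quotient.mk_eq_zero]
        exact Submodule.mem_span_singleton_self _
      erw [h9, ← symMkBilin_apply, map_zero, smul_zero]
    obtain ⟨rx, -, h⟩ := ht' (pt 0)
    rwa [h, h6, map_zero, sub_zero] at h5
  have h10 : D.bFib (pt 0) ((symCoordEquiv ℂ).symm (1 ⊗ₜ u)) = 0 := h4
  -- At `e_0` the minor of `(0, 1)` against `(0, 0)` is one, so the value of `t` there is nonzero.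
  have h11 := congrArg (minorForm D (pt 0) (framedVec (n := 3) _ _) 0 1 0 0) h10
  rw [minorForm_bFib, map_zero] at h11
  have h12 (a b : Fin 4) : symCoo ℂ a b ((symCoordEquiv ℂ).symm ((1 : ℂ) ⊗ₜ[ℂ] u)) =
      u (monomialEquiv s(a, b)) := by
    rw [symCoo_symCoordEquiv_symm, coo_tmul, smul_eq_mul, mul_one]
  erw [h12, h12] at h11
  simp only [lineForm_apply] at h11
  erw [coo_framedVec] at h11
  simp [u] at h11

end SnakeDiagram

/-! ### Isomorphisms over a base from bijections on points -/

section OverIsomorphisms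

theorem nonempty_over_iso {X Y Z : CSpace} (α : X ⟶ Z) (β : Y ⟶ Z) (τ : X ⟶ Y) (hτ : τ ≫ β = α)
    (hbij : ∀ A, Function.Bijective (τ.app A)) : Nonempty (Over.mk β ≅ Over.mk α) := by
  have : ∀ A, IsIso (τ.app A) := fun A => (isIso_iff_bijective _).2 (hbij A)
  have : IsIso τ := NatIso.isIso_of_isIso_app τ
  exact ⟨(Over.isoMk (asIso τ) (by simpa using hτ)).symm⟩

end OverIsomorphisms

/-! ### Frames `ℂˡ ≅ ℂᵏ × ℂ` -/

section Frames

variable {A B : Type} [CommRing A] [CommRing B] [Algebra ℂ A] [Algebra ℂ B] {k l : ℕ}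

/-- The extension of scalars of an isomorphism `ℂˡ ≃ ℂᵏ × ℂ`. -/
noncomputable def frameEquiv (e : (Fin l → ℂ) ≃ₗ[ℂ] (Fin k → ℂ) × ℂ) (A : Type) [CommRing A]
    [Algebra ℂ A] : A ⊗[ℂ] (Fin l → ℂ) ≃ₗ[A] (A ⊗[ℂ] (Fin k → ℂ)) × A :=
  e.baseChange ℂ A _ _ ≪≫ₗ TensorProduct.prodRight ℂ A A _ _ ≪≫ₗ
    LinearEquiv.prodCongr (LinearEquiv.refl A _) (AlgebraTensorModule.rid ℂ A A)

theorem frameEquiv_tmul (e : (Fin l → ℂ) ≃ₗ[ℂ] (Fin k → ℂ) × ℂ) (a : A) (v : Fin l → ℂ) :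
    frameEquiv e A (a ⊗ₜ v) = (a ⊗ₜ (e v).1, (e v).2 • a) := rfl

theorem frameEquiv_extMap (e : (Fin l → ℂ) ≃ₗ[ℂ] (Fin k → ℂ) × ℂ) (φ : A →ₐ[ℂ] B)
    (w : A ⊗[ℂ] (Fin l → ℂ)) : frameEquiv e B (extMap _ φ w) =
      (extMap _ φ (frameEquiv e A w).1, φ (frameEquiv e A w).2) := by
  induction w using TensorProduct.induction_on with
  | zero => simp [← Prod.zero_eq_mk]
  | tmul a v => simp [frameEquiv_tmul]
  | add w w' hw hw' => simp [hw, hw']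

theorem frameEquiv_symm_extMap (e : (Fin l → ℂ) ≃ₗ[ℂ] (Fin k → ℂ) × ℂ) (φ : A →ₐ[ℂ] B)
    (z : (A ⊗[ℂ] (Fin k → ℂ)) × A) : (frameEquiv e B).symm (extMap _ φ z.1, φ z.2) =
      extMap _ φ ((frameEquiv e A).symm z) := by
  rw [LinearEquiv.symm_apply_eq, frameEquiv_extMap, LinearEquiv.apply_symm_apply]

theorem frameEquiv_fst (e : (Fin l → ℂ) ≃ₗ[ℂ] (Fin k → ℂ) × ℂ) {σ : Fin k → Fin l → ℂ}
    (hσ : ∀ w, (e w).1 = scalarMulVec ℂ σ w) (w : A ⊗[ℂ] (Fin l → ℂ)) :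
    (frameEquiv e A w).1 = vec (scalarMulVec A σ (coo A l w)) := by
  apply (coo A k).injective
  rw [coo_vec]
  ext i
  induction w using TensorProduct.induction_on with
  | zero => simp [scalarMulVec]
  | tmul a v =>
    rw [frameEquiv_tmul, coo_tmul, hσ, scalarMulVec, Finset.sum_smul, scalarMulVec]
    refine Finset.sum_congr rfl fun j _ => ?_
    rw [coo_tmul, mul_smul, ← Algebra.smul_def]
    rfl
  | add w w' hw hw' =>
    rw [map_add, map_add, Prod.fst_add, map_add, Pi.add_apply, hw, hw']
    simp [scalarMulVec, mul_add, Finset.sum_add_distrib]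

theorem frameEquiv_snd (e : (Fin l → ℂ) ≃ₗ[ℂ] (Fin k → ℂ) × ℂ) {u : Fin l → ℂ}
    (hu : ∀ w, (e w).2 = ∑ j, u j * w j) (w : A ⊗[ℂ] (Fin l → ℂ)) :
    (frameEquiv e A w).2 = ∑ j, algebraMap ℂ A (u j) * coo A l w j := by
  induction w using TensorProduct.induction_on with
  | zero => simp
  | tmul a v =>
    change (e v).2 • a = _
    rw [hu, Finset.sum_smul]
    refine Finset.sum_congr rfl fun j _ => ?_
    rw [coo_tmul, mul_smul, ← Algebra.smul_def]
  | add w w' hw hw' =>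
    rw [map_add, Prod.snd_add, hw, hw']
    simp [mul_add, Finset.sum_add_distrib]

end Frames

/-! ### Rank-one summands under split injections -/

section LineSubmodules

variable {R P Q : Type} [CommRing R] [AddCommGroup P] [AddCommGroup Q] [Module R P] [Module R Q]

theorem projective_quot_map (J : P →ₗ[R] Q) (g : Q →ₗ[R] P) (hg : ∀ z, g (J z) = z)
    [Module.Projective R Q] (K : Submodule R P) [Module.Projective R (P ⧸ K)] :
    Module.Projective R (Q ⧸ K.map J) := by
  obtain ⟨r, hr⟩ := exists_linear_retraction K
  refine projective_quot_of_retraction _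
    ((J.restrict fun z hz => Submodule.mem_map_of_mem hz : K →ₗ[R] K.map J) ∘ₗ r ∘ₗ g) ?_
  rintro ⟨_, z, hz, rfl⟩
  ext
  change J (r (g (J z))) = J z
  rw [hg, hr ⟨z, hz⟩]

theorem rank_map_eq_one (J : P →ₗ[R] Q) (g : Q →ₗ[R] P) (hg : ∀ z, g (J z) = z)
    (K : Submodule R P) (h : ∀ p, Module.rankAtStalk (R := R) K p = 1) (p) :
    Module.rankAtStalk (R := R) (K.map J) p = 1 := by
  rw [← Module.rankAtStalk_eq_of_equiv
    (Submodule.equivMapOfInjective J (Function.LeftInverse.injective hg) K), h]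

theorem map_comap_of_le_range (J : P →ₗ[R] Q) {m : Submodule R Q} (hm : m ≤ LinearMap.range J) :
    (m.comap J).map J = m := by
  rw [Submodule.map_comap_eq, inf_eq_right.2 hm]

theorem projective_quot_comap (J : P →ₗ[R] Q) (g : Q →ₗ[R] P) (hg : ∀ z, g (J z) = z)
    [Module.Projective R P] (m : Submodule R Q) (hm : m ≤ LinearMap.range J)
    [Module.Projective R (Q ⧸ m)] : Module.Projective R (P ⧸ m.comap J) := by
  obtain ⟨r, hr⟩ := exists_linear_retraction m
  have hJg (w : Q) (hw : w ∈ m) : J (g w) = w := by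
    obtain ⟨z, rfl⟩ := hm hw
    rw [hg]
  refine projective_quot_of_retraction _
    (LinearMap.codRestrict (m.comap J) (g ∘ₗ m.subtype ∘ₗ r ∘ₗ J) fun z => ?_) ?_
  · change J (g (r (J z))) ∈ m
    rw [hJg _ (r (J z)).2]
    exact (r (J z)).2
  · rintro ⟨z, hz⟩
    ext
    change g (r (J z)) = z
    rw [hr ⟨J z, hz⟩, hg]

theorem rank_comap_eq_one (J : P →ₗ[R] Q) (g : Q →ₗ[R] P) (hg : ∀ z, g (J z) = z)
    {m : Submodule R Q} (hm : m ≤ LinearMap.range J)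
    (h : ∀ p, Module.rankAtStalk (R := R) m p = 1) (p) :
    Module.rankAtStalk (R := R) (m.comap J) p = 1 := by
  have e := Submodule.equivMapOfInjective J (Function.LeftInverse.injective hg) (m.comap J)
  rw [map_comap_of_le_range J hm] at e
  rw [Module.rankAtStalk_eq_of_equiv e, h]

end LineSubmodules

/-! ### The Veronese inclusion of `L ⊗ L` -/

section VeroneseEmbedding

variable {A B : CommAlgCat.{0} ℂ}

/-- The inclusion `L ⊗ L → A^{10}` for a line `L`. -/
noncomputable def lineSqCoord (x : (projectiveSpace 3).obj A) :
    line x ⊗[A] line x →ₗ[A] A ⊗[ℂ] (Fin 10 → ℂ) :=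
  (symCoordEquiv A).toLinearMap ∘ₗ SnakeDiagram.lineSqIncl x

/-- The two orders averaged by `symCoo` agree on the rank-one module `L`, which leaves a plain
product. -/
theorem coo_lineSqCoord (x : (projectiveSpace 3).obj A) (l l' : line x) (i : Fin 10) :
    coo A 10 (lineSqCoord x (l ⊗ₜ l')) i =
      lineForm x (fstVar i) l * lineForm x (sndVar i) l' := by
  have h := congrArg (lineForm x (sndVar i)) (smul_comm_of_invertible (lineForm x (fstVar i)) l' l)
  simp only [map_smul, smul_eq_mul] at h
  have h1 : coo A 10 (lineSqCoord x (l ⊗ₜ l')) i =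
      symCoo A (fstVar i) (sndVar i) (SnakeDiagram.lineSqIncl x (l ⊗ₜ l')) :=
    coo_symCoordEquiv _ i
  rw [h1, SnakeDiagram.lineSqIncl_tmul, symCoo_symMk]
  simp only [← lineForm_apply]
  rw [mul_comm (lineForm x (sndVar i) l), h, ← two_mul, ← mul_assoc, half_add_half, one_mul]

theorem exists_leftInverse_lineSqCoord (x : (projectiveSpace 3).obj A) :
    ∃ g : A ⊗[ℂ] (Fin 10 → ℂ) →ₗ[A] line x ⊗[A] line x, ∀ t, g (lineSqCoord x t) = t := by
  obtain ⟨g, hg⟩ := exists_leftInverse_symMulSub_rTensor (line x)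
  refine ⟨g ∘ₗ (symCoordEquiv A).symm.toLinearMap, fun t => ?_⟩
  refine Eq.trans ?_ (hg t)
  exact congrArg g ((symCoordEquiv A).symm_apply_apply _)

theorem lineSqCoord_map (φ : A ⟶ B) {x : (projectiveSpace 3).obj A} {y : (projectiveSpace 3).obj B}
    (h : (projectiveSpace 3).map φ x = y) (t : line x ⊗[A] line x) :
    lineSqCoord y (TensorProduct.map (lineMap φ h) (lineMap φ h) t) =
      extMap _ φ.hom (lineSqCoord x t) := by
  induction t using TensorProduct.induction_on with
  | zero => simp
  | add t t' ht ht' => simp only [map_add, ht, ht']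
  | tmul l l' =>
    apply (coo B 10).injective
    ext i
    rw [TensorProduct.map_tmul, coo_lineSqCoord, coo_extMap, coo_lineSqCoord, map_mul]
    exact congrArg₂ (· * ·) (coo_lineMap φ h l _) (coo_lineMap φ h l' _)

theorem SnakeDiagram.lamFib_eq_zero_iff (D : SnakeDiagram 3) (x : (projectiveSpace 3).obj A)
    (u : A ⊗[ℂ] (Fin 10 → ℂ)) : D.lamFib x u = 0 ↔ ∃ t, lineSqCoord x t = u := by
  refine (D.bFib_eq_zero_iff x _).trans (exists_congr fun t => ?_)
  exact (LinearEquiv.eq_symm_apply (symCoordEquiv A))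

variable {n : ℕ}

/-- A point of `ℙᵐ × ℙⁿ`. -/
abbrev pairPoint {m : ℕ} (x : (projectiveSpace m).obj A) (y : (projectiveSpace n).obj A) :
    (FunctorToTypes.prod (projectiveSpace m) (projectiveSpace n)).obj A := ⟨x, y⟩

/-- The vanishing of a section of `Λ(0,1)` at a point. -/
theorem SnakeDiagram.eval_lambdaSection_eq_zero_iff (D : SnakeDiagram 3)
    (σ : Fin 10 → Fin (n + 1) → ℂ) (x : (projectiveSpace 3).obj A)
    (y : (projectiveSpace n).obj A) :
    Sections.eval (D.lambdaSection σ) (pairPoint x y) = 0 ↔ ∀ w ∈ line y, ∃ t, lineSqCoord x t =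
      vec (scalarMulVec A σ (coo A (n + 1) w)) := by
  have hz : Sections.eval (D.lambdaSection σ) (pairPoint x y) = 0 ↔
      ∀ w, twistVal (D.lambdaSection σ) x y w = 0 := by
    constructor
    · intro h w
      exact (congrArg (contractDual (R := A) (M := line y) (N := D.Λ.fib x) w) h).trans
        (map_zero _)
    · intro h
      refine eval_eq_of_twistVal (D.lambdaSection σ) 0 x y fun w => (h w).trans ?_
      exact (map_zero (contractDual (R := A) (M := line y) (N := D.Λ.fib x) w)).symm
  rw [hz]
  simp only [twistVal_lambdaSection, D.lamFib_eq_zero_iff, Subtype.forall]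

theorem span_range_lineMap (φ : A ⟶ B) {x : (projectiveSpace n).obj A}
    {y : (projectiveSpace n).obj B} (h : (projectiveSpace n).map φ x = y) :
    Submodule.span B (Set.range (TensorProduct.map (lineMap φ h) (lineMap φ h))) = ⊤ :=
  ((ONegTwo n).baseChange φ h).span_range

end VeroneseEmbedding

/-! ### Zero loci of sections of `Λ(0,1)` -/

section FramedLines

variable {A B : CommAlgCat.{0} ℂ} {n : ℕ}

/-- The inclusion `(L ⊗ L) × A → A^{n+1}` defined by a line and a frame. -/
noncomputable def frameLine (e : (Fin (n + 1) → ℂ) ≃ₗ[ℂ] (Fin 10 → ℂ) × ℂ)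
    (x : (projectiveSpace 3).obj A) :
    (line x ⊗[A] line x) × A →ₗ[A] A ⊗[ℂ] (Fin (n + 1) → ℂ) :=
  (frameEquiv e A).symm.toLinearMap ∘ₗ (lineSqCoord x).prodMap LinearMap.id

variable (e : (Fin (n + 1) → ℂ) ≃ₗ[ℂ] (Fin 10 → ℂ) × ℂ)

theorem frameEquiv_frameLine (x : (projectiveSpace 3).obj A) (z : (line x ⊗[A] line x) × A) :
    frameEquiv e A (frameLine e x z) = (lineSqCoord x z.1, z.2) :=
  (frameEquiv e A).apply_symm_apply _

theorem exists_leftInverse_frameLine (x : (projectiveSpace 3).obj A) :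
    ∃ g : A ⊗[ℂ] (Fin (n + 1) → ℂ) →ₗ[A] (line x ⊗[A] line x) × A,
      ∀ z, g (frameLine e x z) = z := by
  obtain ⟨g, hg⟩ := exists_leftInverse_lineSqCoord x
  refine ⟨g.prodMap LinearMap.id ∘ₗ (frameEquiv e A).toLinearMap, fun z => ?_⟩
  have := frameEquiv_frameLine e x z
  rw [LinearMap.comp_apply, LinearEquiv.coe_coe, this, LinearMap.prodMap_apply, hg,
    LinearMap.id_apply]

theorem frameLine_map (φ : A ⟶ B) {x : (projectiveSpace 3).obj A} {y : (projectiveSpace 3).obj B}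
    (h : (projectiveSpace 3).map φ x = y) (z : (line x ⊗[A] line x) × A) :
    frameLine e y (TensorProduct.map (lineMap φ h) (lineMap φ h) z.1, φ.hom z.2) =
      extMap _ φ.hom (frameLine e x z) := by
  refine Eq.trans ?_ (frameEquiv_symm_extMap e φ.hom (lineSqCoord x z.1, z.2))
  rw [← lineSqCoord_map φ h]
  rfl

/-- Vanishing means `σ(w) ∈ L²` for every `w` in the line. In the frame `e`, whose first component
is `σ`, the second component stays free, so the line lies in the copy of `L² ⊕ A`. -/
theorem eval_lambdaSection_eq_zero_iff_le (D : SnakeDiagram 3) {σ : Fin 10 → Fin (n + 1) → ℂ}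
    (hσ : ∀ w, (e w).1 = scalarMulVec ℂ σ w) (x : (projectiveSpace 3).obj A)
    (y : (projectiveSpace n).obj A) :
    Sections.eval (D.lambdaSection σ) (pairPoint x y) = 0 ↔
      line y ≤ LinearMap.range (frameLine e x) := by
  refine (D.eval_lambdaSection_eq_zero_iff σ x y).trans
    (forall_congr' fun w => forall_congr' fun _ => ?_)
  rw [← frameEquiv_fst e hσ]
  constructor
  · rintro ⟨t, ht⟩
    refine ⟨(t, (frameEquiv e A w).2), (frameEquiv e A).injective ?_⟩
    rw [frameEquiv_frameLine, ht]
  · rintro ⟨z, rfl⟩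
    exact ⟨z.1, by rw [frameEquiv_frameLine]⟩

/-- The bundle `O(-2) ⊕ O`. -/
noncomputable abbrev coneBundle : VecBundle (projectiveSpace 3) :=
  (ONegTwo 3).directSum (OZero 3)

/-- The fibres of `O(-2) ⊕ O` in coordinates. -/
noncomputable def coneEquiv (x : (projectiveSpace 3).obj A) :
    coneBundle.fib x ≃ₗ[A] (line x ⊗[A] line x) × A :=
  LinearEquiv.prodCongr (LinearEquiv.refl A (line x ⊗[A] line x)) (AlgebraTensorModule.rid ℂ A A)

theorem coneEquiv_map (φ : A ⟶ B) {x : (projectiveSpace 3).obj A}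
    {y : (projectiveSpace 3).obj B} (h : (projectiveSpace 3).map φ x = y) (z : coneBundle.fib x) :
    coneEquiv y (coneBundle.map φ h z) =
      (TensorProduct.map (lineMap φ h) (lineMap φ h) (coneEquiv x z).1, φ.hom (coneEquiv x z).2) := by
  have (c : A ⊗[ℂ] ℂ) : AlgebraTensorModule.rid ℂ B B (extMap ℂ φ.hom c) =
      φ.hom (AlgebraTensorModule.rid ℂ A A c) := by
    induction c using TensorProduct.induction_on with
    | zero => simp
    | tmul a c => simp
    | add c c' hc hc' => simp only [map_add, hc, hc']
  exact Prod.ext rfl (this z.2)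

/-- The inclusion of the fibres of `O(-2) ⊕ O` defined by a frame. -/
noncomputable def bundleFrame (x : (projectiveSpace 3).obj A) :
    coneBundle.fib x →ₗ[A] A ⊗[ℂ] (Fin (n + 1) → ℂ) :=
  frameLine e x ∘ₗ (coneEquiv x).toLinearMap

theorem exists_leftInverse_bundleFrame (x : (projectiveSpace 3).obj A) :
    ∃ g : A ⊗[ℂ] (Fin (n + 1) → ℂ) →ₗ[A] coneBundle.fib x, ∀ z, g (bundleFrame e x z) = z := by
  obtain ⟨g, hg⟩ := exists_leftInverse_frameLine e x
  refine ⟨(coneEquiv x).symm.toLinearMap ∘ₗ g, fun z => ?_⟩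
  rw [bundleFrame, LinearMap.comp_apply, LinearMap.comp_apply, hg]
  exact (coneEquiv x).symm_apply_apply z

theorem range_bundleFrame (x : (projectiveSpace 3).obj A) :
    LinearMap.range (bundleFrame e x) = LinearMap.range (frameLine e x) :=
  LinearMap.range_comp_of_range_eq_top _ (LinearEquiv.range _)

theorem bundleFrame_map (φ : A ⟶ B) {x : (projectiveSpace 3).obj A}
    {y : (projectiveSpace 3).obj B} (h : (projectiveSpace 3).map φ x = y) (z : coneBundle.fib x) :
    bundleFrame e y (coneBundle.map φ h z) = extMap _ φ.hom (bundleFrame e x z) := by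
  rw [bundleFrame, LinearMap.comp_apply, LinearEquiv.coe_coe, coneEquiv_map, frameLine_map]
  rfl

/-- The point of projective space defined by a line subbundle of `O(-2) ⊕ O`. -/
noncomputable def framePoint (x : (projectiveSpace 3).obj A)
    (N : LineSub A (coneBundle.fib x)) : (projectiveSpace n).obj A :=
  mkPoint (N.carrier.map (bundleFrame e x))
    (have := N.projective_quot
     projective_quot_map _ (exists_leftInverse_bundleFrame e x).choose
      (exists_leftInverse_bundleFrame e x).choose_spec _)
    (rank_map_eq_one _ (exists_leftInverse_bundleFrame e x).choose
      (exists_leftInverse_bundleFrame e x).choose_spec _ N.rank_eq_one)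

theorem line_framePoint (x : (projectiveSpace 3).obj A)
    (N : LineSub A (coneBundle.fib x)) :
    line (framePoint e x N) = N.carrier.map (bundleFrame e x) := rfl

theorem framePoint_map (φ : A ⟶ B) {x : (projectiveSpace 3).obj A}
    {y : (projectiveSpace 3).obj B} (h : (projectiveSpace 3).map φ x = y)
    (N : LineSub A (coneBundle.fib x))
    (N' : LineSub B (coneBundle.fib y)) (hN : N' = N.map (coneBundle.baseChange φ h)) :
    framePoint e y N' = (projectiveSpace n).map φ (framePoint e x N) := by
  have hN' : N'.carrier = Submodule.span B (coneBundle.map φ h '' N.carrier) := by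
    rw [hN]
    rfl
  apply point_ext
  rw [line_map φ rfl, line_framePoint, line_framePoint, hN', Submodule.map_span, Set.image_image]
  congr 1
  ext w
  simp only [Set.mem_image, SetLike.mem_coe, Submodule.mem_map, exists_exists_and_eq_and]
  refine exists_congr fun z => and_congr_right fun _ => ?_
  rw [← bundleFrame_map e φ h z]

theorem framePoint_eval (D : SnakeDiagram 3) {σ : Fin 10 → Fin (n + 1) → ℂ}
    (hσ : ∀ w, (e w).1 = scalarMulVec ℂ σ w) (x : (projectiveSpace 3).obj A)
    (N : LineSub A (coneBundle.fib x)) :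
    Sections.eval (D.lambdaSection σ) (pairPoint x (framePoint e x N)) = 0 := by
  rw [eval_lambdaSection_eq_zero_iff_le e D hσ, line_framePoint, ← range_bundleFrame]
  exact LinearMap.map_le_range

theorem framePoint_injective (x : (projectiveSpace 3).obj A) :
    Function.Injective (framePoint e x) := by
  intro N N' h
  obtain ⟨g, hg⟩ := exists_leftInverse_bundleFrame e x
  refine LineSub.ext (Submodule.map_injective_of_injective
    (Function.LeftInverse.injective hg) ?_)
  rw [← line_framePoint, ← line_framePoint, h]

theorem exists_framePoint (D : SnakeDiagram 3) {σ : Fin 10 → Fin (n + 1) → ℂ}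
    (hσ : ∀ w, (e w).1 = scalarMulVec ℂ σ w) (x : (projectiveSpace 3).obj A)
    (y : (projectiveSpace n).obj A)
    (h : Sections.eval (D.lambdaSection σ) (pairPoint x y) = 0) : ∃ N, framePoint e x N = y := by
  rw [eval_lambdaSection_eq_zero_iff_le e D hσ, ← range_bundleFrame] at h
  obtain ⟨g, hg⟩ := exists_leftInverse_bundleFrame e x
  refine ⟨⟨(line y).comap (bundleFrame e x), projective_quot_comap _ g hg _ h,
    rank_comap_eq_one _ g hg h (rankAtStalk_line y)⟩, point_ext ?_⟩
  rw [line_framePoint, map_comap_of_le_range _ h]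

/-- The zero locus of a section of `Λ(0,1)` is the projective bundle of `O(-2) ⊕ O`. -/
theorem nonempty_zeroLocus_iso (D : SnakeDiagram 3) {σ : Fin 10 → Fin (n + 1) → ℂ}
    (hσ : ∀ w, (e w).1 = scalarMulVec ℂ σ w) :
    Nonempty (Over.mk (zeroLocusProj (D.lambdaSection σ)) ≅
      Over.mk (projBundle.proj ((ONegTwo 3).directSum (OZero 3)))) := by
  let τ : projBundle ((ONegTwo 3).directSum (OZero 3)) ⟶
      (zeroLocus (D.lambdaSection σ)).toFunctor :=
    { app := fun A => ↾fun z => ⟨pairPoint z.1 (framePoint e z.1 z.2),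
        framePoint_eval e D hσ z.1 z.2⟩
      naturality := fun A B φ => by
        refine ConcreteCategory.hom_ext _ _ fun z => ?_
        apply Subtype.ext
        exact Prod.ext rfl (framePoint_map e φ rfl z.2 _ rfl) }
  refine nonempty_over_iso _ _ τ rfl fun A => ⟨?_, ?_⟩
  · rintro ⟨x, N⟩ ⟨x', N'⟩ h
    have h1 : x = x' := congrArg (fun z => z.1.1) h
    subst h1
    have h2 : framePoint e x N = framePoint e x N' := congrArg (fun z => z.1.2) h
    rw [framePoint_injective e x h2]
  · rintro ⟨⟨x, y⟩, h⟩
    obtain ⟨N, rfl⟩ := exists_framePoint e D hσ x y h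
    exact ⟨⟨x, N⟩, rfl⟩

end FramedLines

/-! ### Forms on invertible modules -/

section InvertibleModules

variable {R M P : Type} [CommRing R] [AddCommGroup M] [AddCommMonoid P] [Module R M] [Module R P]

/-- Bilinear forms on an invertible module are determined by the associated quadratic forms. -/
theorem form_ext_of_invertible [Algebra ℂ R] [Module.Invertible R P] {T T' : P ⊗[R] P →ₗ[R] R}
    (h : ∀ w, T (w ⊗ₜ w) = T' (w ⊗ₜ w)) : T = T' := by
  apply TensorProduct.ext'
  intro x y
  have h1 := h (x + y)
  simp only [tmul_add, add_tmul, map_add, h x, h y] at h1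
  -- Bilinear forms are automatically symmetric in rank one, so polarization needs only the inverse
  -- of two.
  have hc : y ⊗ₜ[R] x = x ⊗ₜ[R] y := Module.Invertible.tmul_comm ..
  rw [hc] at h1
  have h2 : 2 * T (x ⊗ₜ y) = 2 * T' (x ⊗ₜ y) := by linear_combination h1
  have h3 := half_add_half R
  linear_combination algebraMap ℂ R (1 / 2) * h2 - (T (x ⊗ₜ y) - T' (x ⊗ₜ y)) * h3

/-- By hypothesis the elements `π (τ w)` generate the unit ideal, and `π t • τ w = π (τ w) • t` puts
every `π (τ w) • t` in the image. -/
theorem surjective_of_forall_maximal {M : Type} [AddCommMonoid M] [Module R M]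
    [Module.Invertible R P] (τ : M →ₗ[R] P)
    (h : ∀ I : Ideal R, I.IsMaximal → ¬ ∀ (π : P →ₗ[R] R) (w : M), π (τ w) ∈ I) :
    Function.Surjective τ := by
  let I : Ideal R := Ideal.span {r | ∃ (π : P →ₗ[R] R) (w : M), π (τ w) = r}
  have hI : I = ⊤ := by
    by_contra hI
    obtain ⟨J, hJ, hle⟩ := Ideal.exists_le_maximal I hI
    exact h J hJ fun π w => hle (Ideal.subset_span ⟨π, w, rfl⟩)
  intro t
  have key : I ≤ (LinearMap.range τ).comap (LinearMap.toSpanSingleton R P t) := by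
    refine Ideal.span_le.2 ?_
    rintro _ ⟨π, w, rfl⟩
    refine ⟨π t • w, ?_⟩
    rw [map_smul, LinearMap.toSpanSingleton_apply, smul_comm_of_invertible π]
  have h1 : (1 : R) ∈ I := hI ▸ Submodule.mem_top
  obtain ⟨w, hw⟩ := key h1
  exact ⟨w, by rw [hw, LinearMap.toSpanSingleton_apply, one_smul]⟩

theorem rank_range_eq_one [Module.Invertible R P] (f : P →ₗ[R] M) (g : M →ₗ[R] P)
    (h : g ∘ₗ f = LinearMap.id) (p) :
    Module.rankAtStalk (R := R) (LinearMap.range f) p = 1 := by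
  have := Module.Invertible.congr
    (LinearEquiv.ofInjective f (Function.LeftInverse.injective (DFunLike.congr_fun h)))
  exact rank_eq_one_of_invertible p

/-- Both tensors are bilinear forms on the invertible module `M ⊗ M`, hence determined on the
diagonal. The equation of the double cover thereby becomes an equation of scalars. -/
theorem tmul_self_eq_iff [Algebra ℂ R] [Module.Invertible R M]
    (Y : Module.Dual R M ⊗[R] Module.Dual R M)
    (F : (Module.Dual R M ⊗[R] Module.Dual R M) ⊗[R] (Module.Dual R M ⊗[R] Module.Dual R M)) :
    Y ⊗ₜ[R] Y = F ↔ ∀ t : M ⊗[R] M, toForm Y t ^ 2 = toQuarticForm F (t ⊗ₜ t) := by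
  have h1 (t : M ⊗[R] M) : toQuarticForm (Y ⊗ₜ[R] Y) (t ⊗ₜ t) = toForm Y t ^ 2 := by
    rw [toQuarticForm_tmul, sq]
  constructor
  · rintro rfl t
    exact (h1 t).symm
  · intro h
    refine toQuarticForm_injective ?_
    exact form_ext_of_invertible fun t => (h1 t).trans (h t)

end InvertibleModules

/-! ### Equations of quadrics and double covers on vectors -/

section QuadraticConditions

variable {A B : CommAlgCat.{0} ℂ} {n : ℕ}

/-- The quadratic form with a matrix of complex coefficients. -/
noncomputable def quadOn {A : Type} [CommRing A] [Algebra ℂ A] {k : ℕ} (Γ : Fin k → Fin k → ℂ)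
    (v : Fin k → A) : A :=
  ∑ p : Fin k × Fin k, algebraMap ℂ A (Γ p.1 p.2) * (v p.1 * v p.2)

/-- Each quartic monomial is a product of two Veronese coordinates, so a quartic on `L` is a
quadratic form restricted to the image of `L²`. -/
theorem quarticEval_quarticSection_diag (Γ : Fin 10 → Fin 10 → ℂ) (x : (projectiveSpace 3).obj A)
    (t : line x ⊗[A] line x) :
    quarticEval (quarticSection Γ) x (t ⊗ₜ t) = quadOn Γ (coo A 10 (lineSqCoord x t)) := by
  have key (t t' : line x ⊗[A] line x) : quarticEval (quarticSection Γ) x (t ⊗ₜ t') =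
      ∑ p : Fin 10 × Fin 10, algebraMap ℂ A (Γ p.1 p.2) *
        (coo A 10 (lineSqCoord x t) p.1 * coo A 10 (lineSqCoord x t') p.2) := by
    induction t using TensorProduct.induction_on with
    | zero => simp
    | add t₁ t₂ h₁ h₂ =>
      simp only [add_tmul, map_add, h₁, h₂, Pi.add_apply, add_mul, mul_add, Finset.sum_add_distrib]
    | tmul l₁ l₂ =>
      induction t' using TensorProduct.induction_on with
      | zero => simp
      | add t₁ t₂ h₁ h₂ =>
        simp only [tmul_add, map_add, h₁, h₂, Pi.add_apply, mul_add, Finset.sum_add_distrib]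
      | tmul l₃ l₄ =>
        rw [quarticEval_quarticSection]
        refine Finset.sum_congr rfl fun p _ => ?_
        rw [coo_lineSqCoord, coo_lineSqCoord]
        rfl
  exact key t t

theorem eval_quadSection_eq_zero_iff {m : ℕ} (C : Fin (n + 1) → Fin (n + 1) → ℂ)
    (x : (projectiveSpace m).obj A) (y : (projectiveSpace n).obj A) :
    Sections.eval (quadSection m C) (pairPoint x y) = 0 ↔
      ∀ w ∈ line y, quadOn C (coo A (n + 1) w) = 0 := by
  have hq (w : line y) : quadEval (quadSection m C) x y (w ⊗ₜ w) =
      quadOn C (coo A (n + 1) (w : A ⊗[ℂ] (Fin (n + 1) → ℂ))) := quadEval_quadSection C x y w w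
  have h0 : quadEval (0 : (OZeroTwo m n).Sections) x y = 0 :=
    map_zero (toQuadForm (A := A) (M := line y))
  constructor
  · intro h w hw
    rw [← hq ⟨w, hw⟩]
    have : quadEval (quadSection m C) x y = 0 :=
      (congrArg (toQuadForm (A := A) (M := line y)) h).trans (map_zero _)
    rw [this, LinearMap.zero_apply]
  · intro h
    refine eval_eq_of_quadEval (quadSection m C) 0 x y ?_
    rw [h0]
    exact form_ext_of_invertible (R := A) (P := line y) (T := quadEval (quadSection m C) x y)
      (T' := 0) fun w => (hq w).trans (h w w.2)

/-- The points of the double cover in terms of quadratic forms. -/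
theorem tmul_self_eq_eval_iff (f : ((OTwo n).tensor (OTwo n)).Sections)
    (x : (projectiveSpace n).obj A) (Y : Module.Dual A (line x) ⊗[A] Module.Dual A (line x)) :
    tmulFib (E := OTwo n) (F := OTwo n) (x := x) Y Y = Sections.eval f x ↔
      ∀ t : line x ⊗[A] line x, toForm (R := A) (M := line x) Y t ^ 2 =
        quarticEval f x (t ⊗ₜ t) := by
  have h (F) := tmul_self_eq_iff (R := A) (M := line x) Y F
  exact h (Sections.eval f x)

end QuadraticConditions

/-! ### Graphs of linear forms on `L ⊗ L` -/

section Graphs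

variable {A B : CommAlgCat.{0} ℂ} {n : ℕ} (e : (Fin (n + 1) → ℂ) ≃ₗ[ℂ] (Fin 10 → ℂ) × ℂ)

/-- The embedding of `L ⊗ L` as the graph of a linear form. -/
noncomputable def graphMap (x : (projectiveSpace 3).obj A) (h : line x ⊗[A] line x →ₗ[A] A) :
    line x ⊗[A] line x →ₗ[A] A ⊗[ℂ] (Fin (n + 1) → ℂ) :=
  frameLine e x ∘ₗ LinearMap.id.prod h

theorem frameEquiv_graphMap (x : (projectiveSpace 3).obj A) (h : line x ⊗[A] line x →ₗ[A] A)
    (t : line x ⊗[A] line x) :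
    frameEquiv e A (graphMap e x h t) = (lineSqCoord x t, h t) :=
  frameEquiv_frameLine e x _

theorem exists_leftInverse_graphMap (x : (projectiveSpace 3).obj A)
    (h : line x ⊗[A] line x →ₗ[A] A) :
    ∃ g : A ⊗[ℂ] (Fin (n + 1) → ℂ) →ₗ[A] line x ⊗[A] line x,
      g ∘ₗ graphMap e x h = LinearMap.id := by
  obtain ⟨g, hg⟩ := exists_leftInverse_frameLine e x
  refine ⟨LinearMap.fst A _ _ ∘ₗ g, LinearMap.ext fun t => ?_⟩
  exact congrArg Prod.fst (hg (t, h t))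

/-- The point of projective space defined by the graph of a linear form on `L ⊗ L`. -/
noncomputable def graphPoint (x : (projectiveSpace 3).obj A) (h : line x ⊗[A] line x →ₗ[A] A) :
    (projectiveSpace n).obj A :=
  mkPoint (LinearMap.range (graphMap e x h))
    (projective_quot_range (R := A) (N := line x ⊗[A] line x)
      (M := A ⊗[ℂ] (Fin (n + 1) → ℂ)) (graphMap e x h) (exists_leftInverse_graphMap e x h).choose
      (exists_leftInverse_graphMap e x h).choose_spec)
    (rank_range_eq_one (R := A) (P := line x ⊗[A] line x)
      (M := A ⊗[ℂ] (Fin (n + 1) → ℂ)) (graphMap e x h) (exists_leftInverse_graphMap e x h).choose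
      (exists_leftInverse_graphMap e x h).choose_spec)

theorem line_graphPoint (x : (projectiveSpace 3).obj A) (h : line x ⊗[A] line x →ₗ[A] A) :
    line (graphPoint e x h) = LinearMap.range (graphMap e x h) := rfl

theorem graphPoint_map (φ : A ⟶ B) {x : (projectiveSpace 3).obj A}
    {y : (projectiveSpace 3).obj B} (hxy : (projectiveSpace 3).map φ x = y)
    (h : line x ⊗[A] line x →ₗ[A] A) (h' : line y ⊗[B] line y →ₗ[B] B)
    (hh : ∀ t, h' (TensorProduct.map (lineMap φ hxy) (lineMap φ hxy) t) = φ.hom (h t)) :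
    graphPoint e y h' = (projectiveSpace n).map φ (graphPoint e x h) := by
  have key (t : line x ⊗[A] line x) :
      graphMap e y h' (TensorProduct.map (lineMap φ hxy) (lineMap φ hxy) t) =
        extMap _ φ.hom (graphMap e x h t) := by
    refine Eq.trans ?_ (frameLine_map e φ hxy (t, h t))
    rw [← hh]
    rfl
  apply point_ext
  rw [line_map φ rfl, line_graphPoint, line_graphPoint, ← Submodule.map_top,
    ← span_range_lineMap φ hxy, Submodule.map_span]
  congr 1
  ext w
  simp only [Set.mem_image, Set.mem_range, exists_exists_eq_and, SetLike.mem_coe,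
    LinearMap.mem_range, key]

theorem graphPoint_injective (x : (projectiveSpace 3).obj A) :
    Function.Injective (graphPoint (n := n) e x) := by
  intro h h' heq
  refine LinearMap.ext fun t => ?_
  have hmem : graphMap e x h t ∈ line (graphPoint e x h') := by
    rw [← heq]
    exact ⟨t, rfl⟩
  obtain ⟨t', ht'⟩ := hmem
  have h1 := congrArg (frameEquiv e A) ht'
  rw [frameEquiv_graphMap, frameEquiv_graphMap, Prod.mk.injEq] at h1
  obtain ⟨g, hg⟩ := exists_leftInverse_lineSqCoord x
  have h2 := congrArg g h1.1
  rw [hg, hg] at h2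
  rw [← h1.2, h2]

/-- A line in the cone over the Veronese image on which a suitable quadratic form vanishes is the
graph of a linear form. -/
theorem exists_graphPoint (x : (projectiveSpace 3).obj A) (y : (projectiveSpace n).obj A)
    (hy : line y ≤ LinearMap.range (frameLine e x)) (Γ : Fin 10 → Fin 10 → ℂ)
    (hΓ : ∀ w ∈ line y, (frameEquiv e A w).2 ^ 2 = quadOn Γ (coo A 10 (frameEquiv e A w).1)) :
    ∃ h, graphPoint e x h = y ∧
      ∀ t, h t ^ 2 = quadOn Γ (coo A 10 (lineSqCoord x t)) := by
  obtain ⟨g, hg⟩ := exists_leftInverse_frameLine e x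
  let τ : line y →ₗ[A] line x ⊗[A] line x := LinearMap.fst A _ _ ∘ₗ g ∘ₗ (line y).subtype
  let u : line y →ₗ[A] A :=
    LinearMap.snd A _ _ ∘ₗ (frameEquiv e A).toLinearMap ∘ₗ (line y).subtype
  have hτ (w : line y) : frameEquiv e A w = (lineSqCoord x (τ w), u w) := by
    obtain ⟨z, hz⟩ := hy w.2
    have h1 : τ w = z.1 := by
      change (g (w : A ⊗[ℂ] (Fin (n + 1) → ℂ))).1 = z.1
      rw [← hz, hg]
    refine Prod.ext ?_ rfl
    rw [h1, ← hz, frameEquiv_frameLine]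
  -- If `τ` vanished modulo a maximal ideal `I`, the quadratic equation would give `u² ∈ I`, hence
  -- `u ∈ I`, and the whole line would vanish modulo `I`.
  have hsurj : Function.Surjective τ := by
    refine surjective_of_forall_maximal τ fun I hI hmem => hI.ne_top ?_
    have hcoo (w : line y) (i : Fin 10) : coo A 10 (lineSqCoord x (τ w)) i ∈ I :=
      hmem (LinearMap.proj i ∘ₗ (coo A 10).toLinearMap ∘ₗ lineSqCoord x) w
    have hu (w : line y) : u w ∈ I := by
      refine hI.isPrime.mem_of_pow_mem 2 ?_
      have := hΓ w w.2
      rw [hτ] at this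
      rw [this]
      exact Ideal.sum_mem _ fun p _ => Ideal.mul_mem_left _ _ (Ideal.mul_mem_left _ _ (hcoo w _))
    -- A linear form on the line extends by the retraction to a form in the ten coordinates and `u`,
    -- all of which take values in `I`.
    refine ideal_eq_top_of_invertible (M := line y) I fun f w => ?_
    obtain ⟨r, hr⟩ := exists_linear_retraction (line y)
    let F : (A ⊗[ℂ] (Fin 10 → ℂ)) × A →ₗ[A] A := f ∘ₗ r ∘ₗ (frameEquiv e A).symm.toLinearMap
    have hF : f w = F (lineSqCoord x (τ w), u w) := by
      rw [← hτ w]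
      change f w = f (r ((frameEquiv e A).symm (frameEquiv e A w)))
      rw [LinearEquiv.symm_apply_apply, hr]
    have hF' : F (lineSqCoord x (τ w), u w) =
        ∑ i, coo A 10 (lineSqCoord x (τ w)) i * F (stdVec A i, 0) + u w * F (0, 1) := by
      have h1 : ((lineSqCoord x (τ w), u w) : (A ⊗[ℂ] (Fin 10 → ℂ)) × A) =
          LinearMap.inl A _ _ (lineSqCoord x (τ w)) + u w • (0, 1) := by simp
      have h2 (v : A ⊗[ℂ] (Fin 10 → ℂ)) : F (LinearMap.inl A _ _ v) =
          ∑ i, coo A 10 v i * F (stdVec A i, 0) := by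
        conv_lhs => rw [← sum_coo_stdVec v, map_sum, map_sum]
        simp only [map_smul, smul_eq_mul, LinearMap.inl_apply]
      rw [h1, map_add, h2, map_smul, smul_eq_mul]
    rw [hF, hF']
    exact add_mem (Ideal.sum_mem _ fun i _ => Ideal.mul_mem_right _ _ (hcoo w i))
      (Ideal.mul_mem_right _ _ (hu w))
  -- A surjection between invertible modules is an isomorphism, so the line is the graph of `u ∘
  -- τ⁻¹`.
  have hbij : Function.Bijective τ := Module.Invertible.bijective_of_surjective hsurj
  let τe := LinearEquiv.ofBijective τ hbij
  have hτe (t : line x ⊗[A] line x) : frameEquiv e A (τe.symm t) =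
      (lineSqCoord x t, (u ∘ₗ τe.symm.toLinearMap) t) := by
    rw [hτ]
    congr 1
    exact congrArg _ (τe.apply_symm_apply t)
  have hgraph (t : line x ⊗[A] line x) :
      graphMap e x (u ∘ₗ τe.symm.toLinearMap) t = τe.symm t := by
    apply (frameEquiv e A).injective
    rw [frameEquiv_graphMap, hτe]
  refine ⟨u ∘ₗ τe.symm.toLinearMap, point_ext ?_, fun t => ?_⟩
  · rw [line_graphPoint]
    apply le_antisymm
    · rintro _ ⟨t, rfl⟩
      rw [hgraph]
      exact (τe.symm t).2
    · intro w hw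
      refine ⟨τe ⟨w, hw⟩, ?_⟩
      rw [hgraph, LinearEquiv.symm_apply_apply]
  · have := hΓ _ (τe.symm t).2
    rwa [hτe] at this

end Graphs

/-! ### Double covers as zero loci -/

theorem toForm_map {R S M N : Type} [CommRing R] [CommRing S] [AddCommGroup M] [AddCommGroup N]
    [Module R M] [Module S N] {φ : R →+* S}
    (g : M →ₛₗ[φ] N) (d : Module.Dual R M →ₛₗ[φ] Module.Dual S N)
    (hd : ∀ f m, d f (g m) = φ (f m)) (u : Module.Dual R M ⊗[R] Module.Dual R M) (t : M ⊗[R] M) :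
    toForm (TensorProduct.map d d u) (TensorProduct.map g g t) = φ (toForm u t) := by
  induction t using TensorProduct.induction_on with
  | zero => simp
  | add t t' ht ht' => simp only [map_add, ht, ht']
  | tmul m m' => exact toForm_semilinear g d hd u m m'

section DoubleCovers

variable {A B : CommAlgCat.{0} ℂ} {n : ℕ} (e : (Fin (n + 1) → ℂ) ≃ₗ[ℂ] (Fin 10 → ℂ) × ℂ)

/-- The map from the double cover to projective space defined by a frame. -/
noncomputable def coverPoint (x : (projectiveSpace 3).obj A)
    (Y : Module.Dual A (line x) ⊗[A] Module.Dual A (line x)) : (projectiveSpace n).obj A :=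
  graphPoint e x (toForm (R := A) (M := line x) Y)

theorem coverPoint_map (φ : A ⟶ B) {x : (projectiveSpace 3).obj A}
    {y : (projectiveSpace 3).obj B} (h : (projectiveSpace 3).map φ x = y)
    (Y : Module.Dual A (line x) ⊗[A] Module.Dual A (line x)) :
    coverPoint e y (TensorProduct.map (OOneMap φ h) (OOneMap φ h) Y) =
      (projectiveSpace n).map φ (coverPoint e x Y) := by
  have key (t) := toForm_map (R := A) (S := B) (M := line x) (N := line y) (lineMap φ h)
    (OOneMap φ h) (OOne_map_apply φ h) Y t
  exact graphPoint_map e φ h (toForm (R := A) (M := line x) Y) _ key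

theorem coverPoint_injective (x : (projectiveSpace 3).obj A) :
    Function.Injective (coverPoint (n := n) e x) :=
  have := finite_line x
  have := projective_line x
  (graphPoint_injective e x).comp (dualDistrib_bijective (R := A) (M := line x) (N := line x)).1

variable (D : SnakeDiagram 3) {σ : Fin 10 → Fin (n + 1) → ℂ} {u : Fin (n + 1) → ℂ}
  {C : Fin (n + 1) → Fin (n + 1) → ℂ} {Γ : Fin 10 → Fin 10 → ℂ} {c : ℂ}

/-- By `hC` the quadric is, up to the nonzero scalar `c`, the form `u² - Γ(σ)`, and `σ` and `u` are
the two components of the frame. -/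
theorem eval_prodSection_eq_zero_iff (hσ : ∀ w, (e w).1 = scalarMulVec ℂ σ w)
    (hu : ∀ w, (e w).2 = ∑ j, u j * w j) (hc : c ≠ 0)
    (hC : ∀ w : Fin (n + 1) → A, algebraMap ℂ A c * quadOn C w =
      (∑ j, algebraMap ℂ A (u j) * w j) ^ 2 - quadOn Γ (scalarMulVec A σ w))
    (x : (projectiveSpace 3).obj A) (y : (projectiveSpace n).obj A) :
    Sections.eval (prodSection (D.lambdaSection σ) (quadSection 3 C)) (pairPoint x y) = 0 ↔
      line y ≤ LinearMap.range (frameLine e x) ∧ ∀ w ∈ line y,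
        (frameEquiv e A w).2 ^ 2 = quadOn Γ (coo A 10 (frameEquiv e A w).1) := by
  rw [← eval_lambdaSection_eq_zero_iff_le e D hσ]
  refine Prod.mk_eq_zero.trans (and_congr_right fun _ => ?_)
  rw [eval_quadSection_eq_zero_iff]
  refine forall₂_congr fun w _ => ?_
  rw [frameEquiv_fst e hσ, frameEquiv_snd e hu, coo_vec]
  conv_rhs => rw [← sub_eq_zero, ← hC, (isUnit_algebraMap hc).mul_right_eq_zero]

theorem coverPoint_eval (hσ : ∀ w, (e w).1 = scalarMulVec ℂ σ w)
    (hu : ∀ w, (e w).2 = ∑ j, u j * w j) (hc : c ≠ 0)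
    (hC : ∀ w : Fin (n + 1) → A, algebraMap ℂ A c * quadOn C w =
      (∑ j, algebraMap ℂ A (u j) * w j) ^ 2 - quadOn Γ (scalarMulVec A σ w))
    (x : (projectiveSpace 3).obj A) (Y : Module.Dual A (line x) ⊗[A] Module.Dual A (line x))
    (hY : tmulFib (E := OTwo 3) (F := OTwo 3) (x := x) Y Y = Sections.eval (quarticSection Γ) x) :
    Sections.eval (prodSection (D.lambdaSection σ) (quadSection 3 C))
      (pairPoint x (coverPoint e x Y)) = 0 := by
  rw [eval_prodSection_eq_zero_iff e D hσ hu hc hC]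
  rw [tmul_self_eq_eval_iff] at hY
  refine ⟨?_, ?_⟩
  · rintro _ ⟨t, rfl⟩
    exact ⟨_, rfl⟩
  · rintro _ ⟨t, rfl⟩
    rw [frameEquiv_graphMap, ← quarticEval_quarticSection_diag]
    exact hY t

/-- The linear form on `L ⊗ L` supplied by `exists_graphPoint` is an element of the fibre of `O(2)`,
and its square equation is the equation of the double cover. -/
theorem exists_coverPoint (hσ : ∀ w, (e w).1 = scalarMulVec ℂ σ w)
    (hu : ∀ w, (e w).2 = ∑ j, u j * w j) (hc : c ≠ 0)
    (hC : ∀ w : Fin (n + 1) → A, algebraMap ℂ A c * quadOn C w =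
      (∑ j, algebraMap ℂ A (u j) * w j) ^ 2 - quadOn Γ (scalarMulVec A σ w))
    (x : (projectiveSpace 3).obj A) (y : (projectiveSpace n).obj A)
    (h : Sections.eval (prodSection (D.lambdaSection σ) (quadSection 3 C)) (pairPoint x y) = 0) :
    ∃ Y : Module.Dual A (line x) ⊗[A] Module.Dual A (line x),
      tmulFib (E := OTwo 3) (F := OTwo 3) (x := x) Y Y = Sections.eval (quarticSection Γ) x ∧
        coverPoint e x Y = y := by
  rw [eval_prodSection_eq_zero_iff e D hσ hu hc hC] at h
  obtain ⟨b, hb, hΓ⟩ := exists_graphPoint e x y h.1 Γ h.2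
  have := finite_line x
  have := projective_line x
  obtain ⟨Y, rfl⟩ := (dualDistrib_bijective (R := A) (M := line x) (N := line x)).2 b
  refine ⟨Y, ?_, hb⟩
  rw [tmul_self_eq_eval_iff]
  intro t
  rw [quarticEval_quarticSection_diag]
  exact hΓ t

/-- The zero locus of a section of `Λ(0,1) ⊕ O(0,2)` is a double cover of projective space. -/
theorem nonempty_zeroLocus_iso_doubleCover (hσ : ∀ w, (e w).1 = scalarMulVec ℂ σ w)
    (hu : ∀ w, (e w).2 = ∑ j, u j * w j) (hc : c ≠ 0)
    (hC : ∀ (A : CommAlgCat.{0} ℂ) (w : Fin (n + 1) → A), algebraMap ℂ A c * quadOn C w =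
      (∑ j, algebraMap ℂ A (u j) * w j) ^ 2 - quadOn Γ (scalarMulVec A σ w)) :
    Nonempty (Over.mk (zeroLocusProj (prodSection (D.lambdaSection σ) (quadSection 3 C))) ≅
      Over.mk (doubleCover.proj (OTwo 3) (quarticSection Γ))) := by
  let τ : doubleCover (OTwo 3) (quarticSection Γ) ⟶
      (zeroLocus (prodSection (D.lambdaSection σ) (quadSection 3 C))).toFunctor :=
    { app := fun A => ↾fun z => ⟨pairPoint z.1 (coverPoint e z.1 z.2.1),
        coverPoint_eval e D hσ hu hc (hC A) z.1 z.2.1 z.2.2⟩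
      naturality := fun A B φ => by
        refine ConcreteCategory.hom_ext _ _ fun z => ?_
        apply Subtype.ext
        exact Prod.ext rfl (coverPoint_map e φ rfl z.2.1) }
  refine nonempty_over_iso _ _ τ rfl fun A => ⟨?_, ?_⟩
  · rintro ⟨x, Y, hY⟩ ⟨x', Y', hY'⟩ h
    have h1 : x = x' := congrArg (fun z => z.1.1) h
    subst h1
    have h2 : coverPoint e x Y = coverPoint e x Y' := congrArg (fun z => z.1.2) h
    have h3 : Y = Y' := coverPoint_injective e x h2
    subst h3
    rfl
  · rintro ⟨⟨x, y⟩, h⟩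
    obtain ⟨Y, hY, rfl⟩ := exists_coverPoint e D hσ hu hc (hC A) x y h
    exact ⟨⟨x, Y, hY⟩, rfl⟩

end DoubleCovers

/-! ### Completing the square along the kernel of a matrix -/

section Elimination

variable {R S : Type*} [CommRing R] [CommRing S] {n : ℕ}

/-- The bilinear form with a given matrix. -/
def bilin (B : Fin n → Fin n → R) : LinearMap.BilinForm R (Fin n → R) :=
  Matrix.toBilin' (Matrix.of B)

theorem bilin_apply (B : Fin n → Fin n → R) (v w : Fin n → R) :
    bilin B v w = ∑ p : Fin n × Fin n, B p.1 p.2 * (v p.1 * w p.2) := by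
  rw [bilin, Matrix.toBilin'_apply, Fintype.sum_prod_type]
  refine Finset.sum_congr rfl fun i _ => Finset.sum_congr rfl fun j _ => ?_
  rw [Matrix.of_apply]
  ring

theorem map_bilin (φ : R →+* S) (B : Fin n → Fin n → R) (v w : Fin n → R) :
    φ (bilin B v w) = bilin (fun i j => φ (B i j)) (fun i => φ (v i)) fun i => φ (w i) := by
  simp only [bilin_apply, map_sum, map_mul]

/-- The square matrix obtained by adding the last coordinate as a last row. -/
def frameMatrix (σ : Fin n → Fin (n + 1) → R) : Matrix (Fin (n + 1)) (Fin (n + 1)) R :=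
  Matrix.of (Fin.snoc (α := fun _ => Fin (n + 1) → R) σ (Pi.single (Fin.last n) 1))

/-- The columns of the adjugate matrix, multiples of the dual basis of the rows. -/
def frameDual (σ : Fin n → Fin (n + 1) → R) (i j : Fin (n + 1)) : R :=
  (frameMatrix σ).adjugate j i

theorem map_frameMatrix (φ : R →+* S) (σ : Fin n → Fin (n + 1) → R) :
    φ.mapMatrix (frameMatrix σ) = frameMatrix fun i j => φ (σ i j) := by
  ext i j
  induction i using Fin.lastCases with
  | last => simp [frameMatrix, Pi.single_apply, apply_ite φ]
  | cast i => simp [frameMatrix]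

theorem map_det_frameMatrix (φ : R →+* S) (σ : Fin n → Fin (n + 1) → R) :
    φ (frameMatrix σ).det = (frameMatrix fun i j => φ (σ i j)).det := by
  rw [RingHom.map_det, map_frameMatrix]

theorem map_frameDual (φ : R →+* S) (σ : Fin n → Fin (n + 1) → R) (i j : Fin (n + 1)) :
    φ (frameDual σ i j) = frameDual (fun i j => φ (σ i j)) i j := by
  rw [frameDual, frameDual, ← map_frameMatrix, ← RingHom.map_adjugate]
  rfl

/-- Multiply `M w` by the adjugate; the last row of `M` reads off the last coordinate. When the
determinant is nonzero in a field, the kernel of `σ` is thus spanned by `frameDual σ (Fin.last n)`.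
-/
theorem det_smul_eq_sum (σ : Fin n → Fin (n + 1) → R) (w : Fin (n + 1) → R) :
    (frameMatrix σ).det • w = ∑ i : Fin n, (∑ j, σ i j * w j) • frameDual σ i.castSucc +
      w (Fin.last n) • frameDual σ (Fin.last n) := by
  have h1 : (frameMatrix σ).adjugate.mulVec ((frameMatrix σ).mulVec w) =
      (frameMatrix σ).det • w := by
    rw [Matrix.mulVec_mulVec, Matrix.adjugate_mul, Matrix.smul_mulVec, Matrix.one_mulVec]
  rw [← h1]
  ext k
  rw [Matrix.mulVec, dotProduct, Fin.sum_univ_castSucc]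
  simp [frameMatrix, Matrix.mulVec, dotProduct, frameDual, mul_comm, Pi.single_apply]

/-- The linear form `w ↦ B(w, n) + B(n, w)` polar to the kernel vector `n` of `σ`. -/
def polarForm (σ : Fin n → Fin (n + 1) → R) (B : Fin (n + 1) → Fin (n + 1) → R) :
    (Fin (n + 1) → R) →ₗ[R] R :=
  (bilin B).flip (frameDual σ (Fin.last n)) + bilin B (frameDual σ (Fin.last n))

/-- The value of the quadratic form `B` at the kernel vector of `σ`. -/
def kernelValue (σ : Fin n → Fin (n + 1) → R) (B : Fin (n + 1) → Fin (n + 1) → R) : R :=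
  bilin B (frameDual σ (Fin.last n)) (frameDual σ (Fin.last n))

/-- The quadratic form in `σ(w)` left after completing the square in `B`: the discriminant of `B`
along the fibres of `σ`. -/
def branchMatrix (σ : Fin n → Fin (n + 1) → R) (B : Fin (n + 1) → Fin (n + 1) → R)
    (i k : Fin n) : R :=
  polarForm σ B (frameDual σ i.castSucc) * polarForm σ B (frameDual σ k.castSucc) -
    4 * kernelValue σ B * bilin B (frameDual σ i.castSucc) (frameDual σ k.castSucc)

theorem polarForm_apply (σ : Fin n → Fin (n + 1) → R) (B : Fin (n + 1) → Fin (n + 1) → R)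
    (w : Fin (n + 1) → R) : polarForm σ B w =
      bilin B w (frameDual σ (Fin.last n)) + bilin B (frameDual σ (Fin.last n)) w := rfl

theorem map_kernelValue (φ : R →+* S) (σ : Fin n → Fin (n + 1) → R)
    (B : Fin (n + 1) → Fin (n + 1) → R) :
    φ (kernelValue σ B) = kernelValue (fun i j => φ (σ i j)) fun i j => φ (B i j) := by
  simp only [kernelValue, map_bilin, map_frameDual]

theorem map_polarForm (φ : R →+* S) (σ : Fin n → Fin (n + 1) → R)
    (B : Fin (n + 1) → Fin (n + 1) → R) (w : Fin (n + 1) → R) :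
    φ (polarForm σ B w) =
      polarForm (fun i j => φ (σ i j)) (fun i j => φ (B i j)) fun i => φ (w i) := by
  simp only [polarForm_apply, map_add, map_bilin, map_frameDual]

theorem map_branchMatrix (φ : R →+* S) (σ : Fin n → Fin (n + 1) → R)
    (B : Fin (n + 1) → Fin (n + 1) → R) (i k : Fin n) :
    φ (branchMatrix σ B i k) =
      branchMatrix (fun i j => φ (σ i j)) (fun i j => φ (B i j)) i k := by
  simp only [branchMatrix, map_sub, map_mul, map_polarForm, map_kernelValue, map_bilin,
    map_frameDual, map_ofNat]

/-- Write `d w = y + t N` with `N` the kernel vector and `y` a combination of dual vectors with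
coefficients `σ(w)`. Then `B` is a quadratic polynomial in `t`, and its leading coefficient times
four times its value is the square of its derivative minus the discriminant, which depends on `σ(w)`
alone. -/
theorem complete_square (σ : Fin n → Fin (n + 1) → R) (B : Fin (n + 1) → Fin (n + 1) → R)
    (w : Fin (n + 1) → R) :
    4 * kernelValue σ B * (frameMatrix σ).det ^ 2 * bilin B w w =
      ((frameMatrix σ).det * polarForm σ B w) ^ 2 -
        bilin (branchMatrix σ B) (fun i => ∑ j, σ i j * w j) fun i => ∑ j, σ i j * w j := by
  set s : Fin n → R := fun i => ∑ j, σ i j * w j with hs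
  set y : Fin (n + 1) → R := ∑ i, s i • frameDual σ i.castSucc with hy
  set t := w (Fin.last n)
  set N := frameDual σ (Fin.last n) with hN
  set d := (frameMatrix σ).det
  have hw : d • w = y + t • N := det_smul_eq_sum σ w
  have h1 : d * polarForm σ B w = polarForm σ B y + 2 * t * kernelValue σ B := by
    rw [← smul_eq_mul, ← map_smul, hw, map_add, map_smul, polarForm_apply σ B N, ← hN,
      kernelValue, ← hN, smul_eq_mul]
    ring
  have h2 : d ^ 2 * bilin B w w =
      bilin B y y + t * polarForm σ B y + t ^ 2 * kernelValue σ B := by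
    have : d ^ 2 * bilin B w w = bilin B (d • w) (d • w) := by
      simp only [map_smul, LinearMap.smul_apply, smul_eq_mul]
      ring
    rw [this, hw, polarForm_apply, kernelValue, ← hN]
    simp only [map_add, LinearMap.add_apply, map_smul, LinearMap.smul_apply, smul_eq_mul]
    ring
  have h3 : bilin (branchMatrix σ B) s s =
      polarForm σ B y ^ 2 - 4 * kernelValue σ B * bilin B y y := by
    have hu : polarForm σ B y = ∑ i, s i * polarForm σ B (frameDual σ i.castSucc) := by
      simp only [hy, map_sum, map_smul, smul_eq_mul]
    have hb : bilin B y y = ∑ p : Fin n × Fin n,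
        s p.1 * s p.2 * bilin B (frameDual σ p.1.castSucc) (frameDual σ p.2.castSucc) := by
      rw [Fintype.sum_prod_type]
      simp only [hy, map_sum, map_smul, LinearMap.sum_apply, LinearMap.smul_apply, smul_eq_mul,
        Finset.mul_sum]
      rw [Finset.sum_comm]
      refine Finset.sum_congr rfl fun i _ => Finset.sum_congr rfl fun j _ => by ring
    rw [hu, hb, sq, Finset.sum_mul_sum, ← Fintype.sum_prod_type', Finset.mul_sum,
      ← Finset.sum_sub_distrib, bilin_apply]
    refine Finset.sum_congr rfl fun p _ => ?_
    rw [branchMatrix]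
    ring
  rw [h3, h1]
  linear_combination 4 * kernelValue σ B * h2

theorem eq_zero_of_frameMatrix_mulVec {K : Type*} [Field K] (σ : Fin n → Fin (n + 1) → K)
    (hd : (frameMatrix σ).det ≠ 0) (w : Fin (n + 1) → K) (h : ∀ i, ∑ j, σ i j * w j = 0)
    (hw : w (Fin.last n) = 0) : w = 0 := by
  have := det_smul_eq_sum σ w
  simp only [h, hw, zero_smul, Finset.sum_const_zero, add_zero] at this
  exact (smul_eq_zero.1 this).resolve_left hd

/-- The kernel of `σ` is spanned by `N`, where the polar form takes the value `2 B(N, N) ≠ 0`. Hence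
`σ` and the polar form together give a frame. -/
theorem eq_zero_of_polarForm_eq_zero {K : Type*} [Field K] [NeZero (2 : K)]
    (σ : Fin n → Fin (n + 1) → K)
    (B : Fin (n + 1) → Fin (n + 1) → K) (hd : (frameMatrix σ).det ≠ 0)
    (hc : kernelValue σ B ≠ 0) (w : Fin (n + 1) → K) (h : ∀ i, ∑ j, σ i j * w j = 0)
    (hw : polarForm σ B w = 0) : w = 0 := by
  refine eq_zero_of_frameMatrix_mulVec σ hd w h ?_
  have h1 := det_smul_eq_sum σ w
  simp only [h, zero_smul, Finset.sum_const_zero, zero_add] at h1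
  have h2 : polarForm σ B ((frameMatrix σ).det • w) = 0 := by rw [map_smul, hw, smul_zero]
  rw [h1, map_smul, polarForm_apply, ← kernelValue, ← two_mul, smul_eq_mul] at h2
  exact (mul_eq_zero.1 h2).resolve_right (mul_ne_zero (NeZero.ne 2) hc)

end Elimination

/-! ### Zero loci for nondegenerate matrices -/

section Frames

theorem exists_frame (σ : Fin 10 → Fin 11 → ℂ) (u : (Fin 11 → ℂ) →ₗ[ℂ] ℂ)
    (h : ∀ w, (∀ i, ∑ j, σ i j * w j = 0) → u w = 0 → w = 0) :
    ∃ e : (Fin 11 → ℂ) ≃ₗ[ℂ] (Fin 10 → ℂ) × ℂ,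
      (∀ w, (e w).1 = scalarMulVec ℂ σ w) ∧ ∀ w, (e w).2 = u w := by
  let f : (Fin 11 → ℂ) →ₗ[ℂ] (Fin 10 → ℂ) × ℂ := (Matrix.of σ).mulVecLin.prod u
  have hf : Function.Injective f := by
    refine (injective_iff_map_eq_zero f).2 fun w hw => h w (fun i => ?_) (congrArg Prod.snd hw)
    exact congrFun (congrArg Prod.fst hw) i
  refine ⟨LinearEquiv.ofInjectiveOfFinrankEq f hf (by simp), fun w => rfl, fun w => rfl⟩

theorem nonempty_iso_of_det_ne_zero (D : SnakeDiagram 3) (σ : Fin 10 → Fin 11 → ℂ)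
    (hd : (frameMatrix σ).det ≠ 0) :
    Nonempty (Over.mk (zeroLocusProj (D.lambdaSection σ)) ≅
      Over.mk (projBundle.proj ((ONegTwo 3).directSum (OZero 3)))) := by
  obtain ⟨e, he, -⟩ := exists_frame σ (LinearMap.proj (Fin.last 10))
    fun w => eq_zero_of_frameMatrix_mulVec σ hd w
  exact nonempty_zeroLocus_iso e D he

theorem quadOn_eq_bilin {A : Type} [CommRing A] [Algebra ℂ A] {k : ℕ} (Γ : Fin k → Fin k → ℂ)
    (v : Fin k → A) : quadOn Γ v = bilin (fun i j => algebraMap ℂ A (Γ i j)) v v := by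
  rw [bilin_apply, quadOn]

/-- The determinant times the polar form serves as the eleventh coordinate of the frame.
`complete_square` over each algebra `A` is then the relation needed between the quadric and `u² -
Γ(σ)`. -/
theorem nonempty_iso_doubleCover_of_ne_zero (D : SnakeDiagram 3) (σ : Fin 10 → Fin 11 → ℂ)
    (B : Fin 11 → Fin 11 → ℂ) (hd : (frameMatrix σ).det ≠ 0) (hc : kernelValue σ B ≠ 0) :
    Nonempty (Over.mk (zeroLocusProj (prodSection (D.lambdaSection σ) (quadSection 3 B))) ≅
      Over.mk (doubleCover.proj (OTwo 3) (quarticSection (branchMatrix σ B)))) := by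
  obtain ⟨e, he, he'⟩ := exists_frame σ ((frameMatrix σ).det • polarForm σ B) fun w h h' =>
    eq_zero_of_polarForm_eq_zero σ B hd hc w h
      ((smul_eq_zero.1 h').resolve_left hd)
  have h4 : 4 * kernelValue σ B * (frameMatrix σ).det ^ 2 ≠ 0 :=
    mul_ne_zero (mul_ne_zero (by norm_num) hc) (pow_ne_zero 2 hd)
  refine nonempty_zeroLocus_iso_doubleCover e D he
    (u := fun j => (frameMatrix σ).det * polarForm σ B (Pi.single j 1))
    (c := 4 * kernelValue σ B * (frameMatrix σ).det ^ 2) (fun w => ?_)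
    h4 fun A w => ?_
  · rw [he', LinearMap.smul_apply, LinearMap.pi_apply_eq_sum_univ, smul_eq_mul, Finset.mul_sum]
    refine Finset.sum_congr rfl fun j _ => ?_
    have : (fun k => if j = k then (1 : ℂ) else 0) = Pi.single j 1 := by
      ext k
      simp [Pi.single_apply, eq_comm]
    rw [this, smul_eq_mul]
    ring
  · have key := complete_square (fun i j => algebraMap ℂ A (σ i j))
      (fun i j => algebraMap ℂ A (B i j)) w
    rw [quadOn_eq_bilin, quadOn_eq_bilin]
    simp only [map_mul, map_pow, map_ofNat, map_branchMatrix, map_kernelValue,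
      map_det_frameMatrix, map_polarForm]
    refine key.trans ?_
    congr 2
    rw [LinearMap.pi_apply_eq_sum_univ, Finset.mul_sum]
    refine Finset.sum_congr rfl fun j _ => ?_
    have : (fun k => if j = k then (1 : A) else 0) =
        fun k => algebraMap ℂ A ((Pi.single j 1 : Fin 11 → ℂ) k) := by
      ext k
      simp [Pi.single_apply, eq_comm, apply_ite (algebraMap ℂ A)]
    rw [this, smul_eq_mul]
    ring

end Frames

/-! ### Singular points of quartics -/

section Quartics

variable {R S : Type*} [CommRing R] [CommRing S]

/-- The monomials of degree four, indexed by pairs of monomials of degree two. -/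
noncomputable def quarticTerm (p : Fin 10 × Fin 10) (v : Fin 4 → R) : R :=
  (v (fstVar p.1) * v (sndVar p.1)) * (v (fstVar p.2) * v (sndVar p.2))

/-- The derivatives of a monomial of degree four in the direction `w`. -/
noncomputable def quarticTermDeriv (p : Fin 10 × Fin 10) (v w : Fin 4 → R) : R :=
  (w (fstVar p.1) * v (sndVar p.1) + v (fstVar p.1) * w (sndVar p.1)) *
      (v (fstVar p.2) * v (sndVar p.2)) +
    (v (fstVar p.1) * v (sndVar p.1)) *
      (w (fstVar p.2) * v (sndVar p.2) + v (fstVar p.2) * w (sndVar p.2))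

theorem map_quarticTerm (φ : R →+* S) (p : Fin 10 × Fin 10) (v : Fin 4 → R) :
    φ (quarticTerm p v) = quarticTerm p fun i => φ (v i) := by
  simp only [quarticTerm, map_mul]

theorem map_quarticTermDeriv (φ : R →+* S) (p : Fin 10 × Fin 10) (v w : Fin 4 → R) :
    φ (quarticTermDeriv p v w) = quarticTermDeriv p (fun i => φ (v i)) fun i => φ (w i) := by
  simp only [quarticTermDeriv, map_mul, map_add]

/-- The tangent vector at `v` in the direction `w`. -/
def tangentVec (v w : Fin 4 → ℂ) (i : Fin 4) : DualNumber ℂ :=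
  TrivSqZeroExt.inl (v i) + TrivSqZeroExt.inr (w i)

theorem snd_quarticTerm (p : Fin 10 × Fin 10) (v w : Fin 4 → ℂ) :
    (quarticTerm p (tangentVec v w)).snd = quarticTermDeriv p v w := by
  simp only [quarticTerm, quarticTermDeriv, tangentVec, TrivSqZeroExt.snd_mul,
    TrivSqZeroExt.fst_mul, TrivSqZeroExt.fst_add, TrivSqZeroExt.snd_add, TrivSqZeroExt.fst_inl,
    TrivSqZeroExt.snd_inl, TrivSqZeroExt.fst_inr, TrivSqZeroExt.snd_inr, smul_eq_mul,
    MulOpposite.smul_eq_mul_unop, MulOpposite.unop_op, zero_add, add_zero]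
  ring

/-- A quartic with matrix `Γ` is singular at `v`. -/
def IsSingularAt (Γ : Fin 10 × Fin 10 → ℂ) (v : Fin 4 → ℂ) : Prop :=
  ∑ p, Γ p * quarticTerm p v = 0 ∧ ∀ w, ∑ p, Γ p * quarticTermDeriv p v w = 0

theorem quarticVal_eq_zero {n : ℕ} {f : ((OTwo n).tensor (OTwo n)).Sections}
    {A : CommAlgCat.{0} ℂ} {x : (projectiveSpace n).obj A} (h : Sections.eval f x = 0)
    (l : line x) : quarticVal f x l = 0 := by
  have : quarticEval f x = 0 :=
    (congrArg (toQuarticForm (R := A) (M := line x)) h).trans (map_zero _)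
  rw [quarticVal, this, LinearMap.zero_apply]

theorem framedPoint_congr {n : ℕ} {A : CommAlgCat.{0} ℂ} {v v' : Fin (n + 1) → A} (h : v = v')
    (hv : ∃ i, IsUnit (v i)) (hv' : ∃ i, IsUnit (v' i)) :
    framedPoint v hv = framedPoint v' hv' := by
  subst h
  rfl

theorem sum_quarticTerm_eq_zero {A : CommAlgCat.{0} ℂ} (Γ : Fin 10 × Fin 10 → ℂ) (v : Fin 4 → A)
    (hv : ∃ i, IsUnit (v i)) {f : ((OTwo 3).tensor (OTwo 3)).Sections}
    (hf : quarticSection (fun i k => Γ (i, k)) = f)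
    (h : Sections.eval f (framedPoint v hv) = 0) :
    ∑ p, algebraMap ℂ A (Γ p) * quarticTerm p v = 0 := by
  refine (quarticVal_quarticSection (fun i k => Γ (i, k)) v hv).symm.trans ?_
  rw [hf]
  exact quarticVal_eq_zero h _

theorem exists_normalized_framedPoint {n : ℕ}
    (x : (projectiveSpace n).obj (CommAlgCat.of ℂ ℂ)) :
    ∃ (v : Fin (n + 1) → ℂ) (i : Fin (n + 1)) (_ : v i = 1) (hv : ∃ i, IsUnit (v i)),
      x = framedPoint (A := CommAlgCat.of ℂ ℂ) v hv := by
  obtain ⟨v', ⟨i, hi⟩, rfl⟩ := exists_framedPoint_of_isLocalRing (A := CommAlgCat.of ℂ ℂ) x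
  have hi0 : (v' i : ℂ) ≠ 0 := IsUnit.ne_zero (M₀ := ℂ) hi
  let v : Fin (n + 1) → ℂ := fun j => (v' i)⁻¹ * v' j
  have hvi : v i = 1 := inv_mul_cancel₀ hi0
  have hv : ∃ i, IsUnit (v i) := ⟨i, hvi ▸ isUnit_one⟩
  exact ⟨v, i, hvi, hv, (framedPoint_smul (A := CommAlgCat.of ℂ ℂ) v' ⟨i, hi⟩ ((v' i)⁻¹ : ℂ)
      (IsUnit.mk0 _ (inv_ne_zero hi0)) hv).symm⟩

/-- Non-smoothness means that the quartic vanishes on every tangent vector `v + ε w` at some zero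
`v`, and the `ε`-part of this value is the derivative in direction `w`. -/
theorem exists_isSingularAt (Γ : Fin 10 × Fin 10 → ℂ)
    (h : ¬ IsSmoothDivisor (quarticSection fun i k => Γ (i, k))) :
    ∃ (v : Fin 4 → ℂ) (i : Fin 4), v i = 1 ∧ IsSingularAt Γ v := by
  generalize hf : (quarticSection fun i k => Γ (i, k)) = f at h
  unfold IsSmoothDivisor at h
  push Not at h
  obtain ⟨x, hx, hy⟩ := h
  obtain ⟨v, i, hvi, hv, rfl⟩ := exists_normalized_framedPoint x
  refine ⟨v, i, hvi, sum_quarticTerm_eq_zero (A := CommAlgCat.of ℂ ℂ) Γ v hv hf hx, fun w => ?_⟩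
  have hfst (j) : (tangentVec v w j).fst = v j := by simp [tangentVec]
  have hw : ∃ j, IsUnit (tangentVec v w j) :=
    ⟨i, TrivSqZeroExt.isUnit_iff_isUnit_fst.2 (by rw [hfst, hvi]; exact isUnit_one)⟩
  have hpt : (projectiveSpace 3).map (CommAlgCat.ofHom (TrivSqZeroExt.fstHom ℂ ℂ ℂ))
      (framedPoint (n := 3) (A := CommAlgCat.of ℂ (DualNumber ℂ)) (tangentVec v w) hw) =
      framedPoint (n := 3) (A := CommAlgCat.of ℂ ℂ) v hv :=
    (map_framedPoint _ _ _).trans (framedPoint_congr (funext hfst) _ _)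
  have key := sum_quarticTerm_eq_zero (A := CommAlgCat.of ℂ (DualNumber ℂ)) Γ (tangentVec v w) hw
    hf (hy _ hpt)
  have key' : ∑ p, Γ p • quarticTerm p (tangentVec v w) = 0 := by
    refine Eq.trans (Finset.sum_congr rfl fun p _ => ?_) key
    exact Algebra.smul_def _ _
  have h2 := congrArg (TrivSqZeroExt.sndHom ℂ ℂ) key'
  rw [map_sum, map_zero] at h2
  rw [← h2]
  refine Finset.sum_congr rfl fun p _ => ?_
  rw [map_smul, TrivSqZeroExt.sndHom_apply, snd_quarticTerm, smul_eq_mul]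

end Quartics

/-! ### Algebraic dependence by counting variables -/

section AlgebraicDependence

/-- An algebraically independent family is no larger than the transcendence degree, which for the
polynomial ring is the number of variables. -/
theorem exists_ne_zero_aeval_eq_zero {S P : Type} [Fintype S] [Fintype P]
    (h : Fintype.card S < Fintype.card P) (Φ : P → MvPolynomial S ℂ) :
    ∃ Q : MvPolynomial P ℂ, Q ≠ 0 ∧ MvPolynomial.aeval Φ Q = 0 := by
  by_contra! hQ
  have hind : AlgebraicIndependent ℂ Φ :=
    (injective_iff_map_eq_zero _).2 fun Q hQ0 => by_contra fun hne => hQ Q hne hQ0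
  have := hind.cardinalMk_le_trdeg
  rw [MvPolynomial.trdeg_of_isDomain, Cardinal.mk_fintype, Cardinal.lift_id,
    Cardinal.mk_fintype, Nat.cast_le] at this
  omega

end AlgebraicDependence

/-! ### A polynomial vanishing on singular quartics -/

section Discriminant

/-- The index of the monomial `X_i X_j`. -/
noncomputable def monomialIndex (i j : Fin 4) : Fin 10 := monomialEquiv s(i, j)

theorem monomialIndex_vars (i j : Fin 4) :
    (fstVar (monomialIndex i j) = i ∧ sndVar (monomialIndex i j) = j) ∨
      (fstVar (monomialIndex i j) = j ∧ sndVar (monomialIndex i j) = i) := by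
  have := monomialEquiv_symm (monomialIndex i j)
  rw [monomialIndex, Equiv.symm_apply_apply, Sym2.eq_iff] at this
  rcases this with h | h
  · exact Or.inl ⟨h.1.symm, h.2.symm⟩
  · exact Or.inr ⟨h.2.symm, h.1.symm⟩

/-- The index of the monomial `X_i³ X_j`. -/
noncomputable def pivot (i j : Fin 4) : Fin 10 × Fin 10 := (monomialIndex i i, monomialIndex i j)

theorem pivot_injective (i : Fin 4) : Function.Injective (pivot i) := fun j j' h => by
  have := monomialEquiv.injective (congrArg Prod.snd h)
  exact Sym2.congr_right.1 this

variable {R S : Type*} [CommRing R] [CommRing S]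

theorem quarticTerm_pivot (i j : Fin 4) (v : Fin 4 → R) (hv : v i = 1) :
    quarticTerm (pivot i j) v = v j := by
  rw [quarticTerm, pivot]
  rcases monomialIndex_vars i i with h | h <;> rcases monomialIndex_vars i j with h' | h' <;>
    simp [h, h', hv]

/-- The derivative of `X_i³ X_j` along `w` reduces to `w_j`, so each derivative equation can be
solved for the coefficient at a single pivot. -/
theorem quarticTermDeriv_pivot (i j : Fin 4) (v w : Fin 4 → R) (hv : v i = 1) (hw : w i = 0) :
    quarticTermDeriv (pivot i j) v w = w j := by
  rw [quarticTermDeriv, pivot]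
  rcases monomialIndex_vars i i with h | h <;> rcases monomialIndex_vars i j with h' | h' <;>
    simp [h, h', hv, hw]

/-- The point in the `i`-th standard chart with coordinates read off at the pivots. -/
noncomputable def chartVec (i : Fin 4) (t : Fin 10 × Fin 10 → R) (j : Fin 4) : R :=
  if j = i then 1 else t (pivot i j)

open Classical in
/-- The coefficients other than that of `X_i⁴` of a quartic singular at `chartVec i t`. -/
noncomputable def singularAux (i : Fin 4) (t : Fin 10 × Fin 10 → R) (p : Fin 10 × Fin 10) : R :=
  if h : ∃ j, pivot i j = p then
    -∑ q ∈ (Finset.univ.image (pivot i))ᶜ,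
      t q * quarticTermDeriv q (chartVec i t) (Pi.single h.choose 1)
  else t p

/-- The coefficients of a quartic singular at `chartVec i t`. -/
noncomputable def singularQuartic (i : Fin 4) (t : Fin 10 × Fin 10 → R) (p : Fin 10 × Fin 10) : R :=
  if p = pivot i i then
    -∑ q ∈ {pivot i i}ᶜ, singularAux i t q * quarticTerm q (chartVec i t)
  else singularAux i t p

theorem map_chartVec (φ : R →+* S) (i : Fin 4) (t : Fin 10 × Fin 10 → R) (j : Fin 4) :
    φ (chartVec i t j) = chartVec i (fun p => φ (t p)) j := by
  simp only [chartVec, apply_ite φ, map_one]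

theorem map_singularAux (φ : R →+* S) (i : Fin 4) (t : Fin 10 × Fin 10 → R)
    (p : Fin 10 × Fin 10) :
    φ (singularAux i t p) = singularAux i (fun p => φ (t p)) p := by
  have h1 (j k : Fin 4) : φ ((Pi.single j 1 : Fin 4 → R) k) = (Pi.single j 1 : Fin 4 → S) k := by
    simp only [Pi.single_apply, apply_ite φ, map_one, map_zero]
  simp only [singularAux]
  split_ifs
  · simp only [map_neg, map_sum, map_mul, map_quarticTermDeriv, map_chartVec, h1]
  · rfl

theorem map_singularQuartic (φ : R →+* S) (i : Fin 4) (t : Fin 10 × Fin 10 → R)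
    (p : Fin 10 × Fin 10) :
    φ (singularQuartic i t p) = singularQuartic i (fun p => φ (t p)) p := by
  simp only [singularQuartic, apply_ite φ, map_neg, map_sum, map_mul, map_singularAux,
    map_quarticTerm, map_chartVec]

open Classical in
/-- The parameters of a quartic singular at `v`. -/
noncomputable def singularParam (Γ : Fin 10 × Fin 10 → ℂ) (v : Fin 4 → ℂ) (i : Fin 4)
    (p : Fin 10 × Fin 10) : ℂ :=
  if h : ∃ j, pivot i j = p then (if h.choose = i then 0 else v h.choose) else Γ p

theorem singularParam_pivot (Γ : Fin 10 × Fin 10 → ℂ) (v : Fin 4 → ℂ) (i j : Fin 4) :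
    singularParam Γ v i (pivot i j) = if j = i then 0 else v j := by
  have h : ∃ j', pivot i j' = pivot i j := ⟨j, rfl⟩
  rw [singularParam, dif_pos h, pivot_injective i h.choose_spec]

/-- The pivots with `j ≠ i` store the point `v`. The derivative in direction `e_j` recovers the
coefficient at `pivot i j`, and then vanishing at `v` recovers the one at `pivot i i`. -/
theorem singularQuartic_singularParam {Γ : Fin 10 × Fin 10 → ℂ} {v : Fin 4 → ℂ} {i : Fin 4}
    (hv : v i = 1) (h : IsSingularAt Γ v) : singularQuartic i (singularParam Γ v i) = Γ := by
  classical
  have hvec : chartVec i (singularParam Γ v i) = v := by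
    ext j
    rw [chartVec, singularParam_pivot]
    split_ifs with hj
    · rw [hj, hv]
    · rfl
  have haux (p) (hp : p ≠ pivot i i) : singularAux i (singularParam Γ v i) p = Γ p := by
    rw [singularAux, hvec]
    split_ifs with hj
    · have hsingle : (Pi.single hj.choose 1 : Fin 4 → ℂ) i = 0 := by
        refine Pi.single_eq_of_ne ?_ _
        intro hi
        exact hp (by rw [← hj.choose_spec, ← hi])
      have h1 := h.2 (Pi.single hj.choose 1)
      rw [← Finset.sum_add_sum_compl (Finset.univ.image (pivot i)),
        Finset.sum_image fun _ _ _ _ hjk => pivot_injective i hjk] at h1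
      simp only [quarticTermDeriv_pivot i _ v _ hv hsingle, Pi.single_apply, mul_ite, mul_one,
        mul_zero, Finset.sum_ite_eq', Finset.mem_univ, if_true] at h1
      rw [hj.choose_spec] at h1
      rw [neg_eq_iff_eq_neg, eq_neg_iff_add_eq_zero, ← h1, add_comm]
      congr 1
      refine Finset.sum_congr rfl fun q hq => ?_
      rw [singularParam, dif_neg]
      simpa using hq
    · rw [singularParam, dif_neg hj]
  ext p
  rw [singularQuartic]
  split_ifs with hp
  · have h1 := h.1
    rw [← Finset.sum_add_sum_compl {pivot i i}, Finset.sum_singleton,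
      quarticTerm_pivot i i v hv, hv, mul_one] at h1
    rw [hp, hvec, neg_eq_iff_eq_neg, eq_neg_iff_add_eq_zero, ← h1, add_comm]
    congr 1
    refine Finset.sum_congr rfl fun q hq => ?_
    rw [haux q (by simpa using hq)]
  · exact haux p hp

/-- The parameter at `pivot i i` is always zero and can be dropped. Coefficient vectors singular in
this chart are then values of 100 polynomials in 99 variables, and `Q` is an algebraic relation
among these polynomials. -/
theorem exists_discriminant_chart (i : Fin 4) :
    ∃ Q : MvPolynomial (Fin 10 × Fin 10) ℂ, Q ≠ 0 ∧ ∀ (Γ : Fin 10 × Fin 10 → ℂ) (v : Fin 4 → ℂ),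
      v i = 1 → IsSingularAt Γ v → MvPolynomial.eval Γ Q = 0 := by
  classical
  let t (p : Fin 10 × Fin 10) : MvPolynomial {p // p ≠ pivot i i} ℂ :=
    if h : p ≠ pivot i i then MvPolynomial.X ⟨p, h⟩ else 0
  obtain ⟨Q, hQ, h0⟩ := exists_ne_zero_aeval_eq_zero (S := {p // p ≠ pivot i i})
    (Fintype.card_subtype_lt (x := pivot i i) (by simp)) (singularQuartic i t)
  refine ⟨Q, hQ, fun Γ v hv h => ?_⟩
  let ψ := MvPolynomial.eval fun q : {p // p ≠ pivot i i} => singularParam Γ v i q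
  have ht (p) : ψ (t p) = singularParam Γ v i p := by
    by_cases hp : p = pivot i i
    · rw [hp, singularParam_pivot, if_pos rfl]
      simp [t]
    · simp [t, hp, ψ]
  have hΓ (p) : ψ (singularQuartic i t p) = Γ p := by
    rw [map_singularQuartic]
    simp only [ht]
    exact congrFun (singularQuartic_singularParam hv h) p
  have h1 := congrArg ψ h0
  rw [map_zero, MvPolynomial.aeval_def, MvPolynomial.hom_eval₂] at h1
  rw [← h1, MvPolynomial.eval, MvPolynomial.coe_eval₂Hom]
  congr 1
  · ext c
    simp [ψ]
  · ext p
    exact (hΓ p).symm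

/-- There is a nonzero polynomial in the coefficients of a quartic which vanishes on the quartics
that are not smooth. -/
theorem exists_discriminant :
    ∃ Q : MvPolynomial (Fin 10 × Fin 10) ℂ, Q ≠ 0 ∧ ∀ Γ : Fin 10 × Fin 10 → ℂ,
      MvPolynomial.eval Γ Q ≠ 0 → IsSmoothDivisor (quarticSection fun i k => Γ (i, k)) := by
  choose Q hQ h using exists_discriminant_chart
  refine ⟨∏ i, Q i, Finset.prod_ne_zero_iff.2 fun i _ => hQ i, fun Γ hΓ => ?_⟩
  by_contra hs
  obtain ⟨v, i, hv, hsing⟩ := exists_isSingularAt Γ hs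
  refine hΓ ?_
  rw [map_prod]
  exact Finset.prod_eq_zero (Finset.mem_univ i) (h i Γ v hv hsing)

end Discriminant

/-! ### General elements of a spanned vector space -/

section GeneralElements

theorem eval_bind₁ {ι κ : Type*} (w : κ → ℂ) (f : ι → MvPolynomial κ ℂ) (Q : MvPolynomial ι ℂ) :
    MvPolynomial.eval w (MvPolynomial.bind₁ f Q) =
      MvPolynomial.eval (fun i => MvPolynomial.eval w (f i)) Q :=
  MvPolynomial.eval₂Hom_bind₁ _ _ _ _

/-- General elements may be tested on the coefficients with respect to a spanning family. -/
theorem forGeneral_of_span {H : Type*} [AddCommGroup H] [Module ℂ H] {ι : Type} [Fintype ι]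
    (g : ι → H) (hg : ∀ s, ∃ w : ι → ℂ, s = ∑ i, w i • g i) {P : H → Prop}
    {F : MvPolynomial ι ℂ} (hF : F ≠ 0)
    (hP : ∀ w, MvPolynomial.eval w F ≠ 0 → P (∑ i, w i • g i)) : ForGeneral P := by
  let ψ : (ι → ℂ) →ₗ[ℂ] H := Fintype.linearCombination ℂ g
  have hψ (w) : ψ w = ∑ i, w i • g i := Fintype.linearCombination_apply ℂ g w
  have hsurj : Function.Surjective ψ := fun s => by
    obtain ⟨w, rfl⟩ := hg s
    exact ⟨w, hψ w⟩
  have : Module.Finite ℂ H := Module.Finite.of_surjective ψ hsurj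
  obtain ⟨θ, hθ⟩ := ψ.exists_rightInverse_of_surjective (LinearMap.range_eq_top.2 hsurj)
  have hθ' (s) : ψ (θ s) = s := DFunLike.congr_fun hθ s
  obtain ⟨w₀, hw₀⟩ : ∃ w, MvPolynomial.eval w F ≠ 0 := by
    by_contra! h
    exact hF (MvPolynomial.funext fun w => by rw [h w, map_zero])
  let b := Module.finBasis ℂ H
  -- `G` is `F` along the affine section `s ↦ θ (s - ψ w₀) + w₀` of `ψ`. The translation makes it
  -- pass through `w₀`, where `F` is nonzero; the image of `θ` alone could lie inside `F = 0`.
  let G : MvPolynomial (Fin (Module.finrank ℂ H)) ℂ := MvPolynomial.bind₁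
    (fun i => MvPolynomial.C (w₀ i - θ (ψ w₀) i) +
      ∑ j, MvPolynomial.C (θ (b j) i) * MvPolynomial.X j) F
  have hG (s) : MvPolynomial.eval (fun j => b.repr s j) G =
      MvPolynomial.eval (θ (s - ψ w₀) + w₀) F := by
    rw [eval_bind₁]
    refine congrArg (fun v => MvPolynomial.eval v F) (funext fun i => ?_)
    have h1 : θ s i = ∑ j, θ (b j) i * b.repr s j := by
      have := congrArg (fun z => θ z i) (b.sum_repr s)
      simp only [map_sum, map_smul, Finset.sum_apply, Pi.smul_apply, smul_eq_mul] at this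
      simp only [← this, mul_comm]
    simp only [map_add, map_sub, map_sum, map_mul, MvPolynomial.eval_C, MvPolynomial.eval_X,
      Pi.add_apply, Pi.sub_apply, h1]
    ring
  refine ⟨_, b, G, fun h0 => ?_, fun s hs => ?_⟩
  · have := hG (ψ w₀)
    rw [h0, map_zero, sub_self, map_zero, zero_add] at this
    exact hw₀ this.symm
  · rw [hG] at hs
    have := hP _ hs
    rwa [← hψ, map_add, hθ', sub_add_cancel] at this

end GeneralElements

/-! ### A standard frame and a quadric with prescribed branch form -/

section StandardFrame

variable {n : ℕ}

/-- The projection forgetting the last coordinate. -/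
def standardFrame (n : ℕ) (i : Fin n) : Fin (n + 1) → ℂ := Pi.single i.castSucc 1

theorem frameMatrix_standardFrame : frameMatrix (standardFrame n) = 1 := by
  ext i j
  induction i using Fin.lastCases with
  | last => simp [frameMatrix, Matrix.one_apply, Pi.single_apply, eq_comm]
  | cast i => simp [frameMatrix, standardFrame, Matrix.one_apply, Pi.single_apply, eq_comm]

theorem frameDual_standardFrame (i : Fin (n + 1)) :
    frameDual (standardFrame n) i = Pi.single i 1 := by
  ext j
  rw [frameDual, frameMatrix_standardFrame, Matrix.adjugate_one, Matrix.one_apply, Pi.single_apply]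

/-- The block diagonal quadratic form with blocks `-Γ / 4` and `1`. -/
noncomputable def standardQuadric (Γ : Fin n → Fin n → ℂ) : Fin (n + 1) → Fin (n + 1) → ℂ :=
  Fin.snoc (α := fun _ => Fin (n + 1) → ℂ)
    (fun i => Fin.snoc (α := fun _ => ℂ) (fun k => -(Γ i k / 4)) 0) (Pi.single (Fin.last n) 1)

theorem bilin_single (B : Fin n → Fin n → ℂ) (i k : Fin n) :
    bilin B (Pi.single i 1) (Pi.single k 1) = B i k := by
  rw [bilin, Matrix.toBilin'_single, Matrix.of_apply]

theorem kernelValue_standard (Γ : Fin n → Fin n → ℂ) :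
    kernelValue (standardFrame n) (standardQuadric Γ) = 1 := by
  rw [kernelValue, frameDual_standardFrame, bilin_single]
  simp [standardQuadric]

/-- The quadric is block diagonal, so its polar form vanishes on the first `n` basis vectors and
only `-4 · 1 · (-Γ / 4)` survives. Every matrix therefore occurs as a branch matrix. -/
theorem branchMatrix_standard (Γ : Fin n → Fin n → ℂ) :
    branchMatrix (standardFrame n) (standardQuadric Γ) = Γ := by
  ext i k
  rw [branchMatrix, kernelValue_standard, polarForm_apply, polarForm_apply]
  simp only [frameDual_standardFrame, bilin_single]
  simp [standardQuadric]
  ring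

end StandardFrame

/-! ### Sections of direct sums -/

section GeneralSections

variable {X : CSpace} (E F : VecBundle X)

/-- Sections of the first summand of a direct sum. -/
def sectionInl : E.Sections →ₗ[ℂ] (E.directSum F).Sections where
  toFun s := prodSection s 0
  map_add' _ _ := Subtype.ext <| funext fun _ => funext fun x =>
    Prod.ext rfl (add_zero (0 : F.fib x)).symm
  map_smul' c _ := Subtype.ext <| funext fun A => funext fun x =>
    Prod.ext rfl (smul_zero (A := F.fib x) (algebraMap ℂ A c)).symm

/-- Sections of the second summand of a direct sum. -/
def sectionInr : F.Sections →ₗ[ℂ] (E.directSum F).Sections where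
  toFun t := prodSection 0 t
  map_add' _ _ := Subtype.ext <| funext fun _ => funext fun x =>
    Prod.ext (add_zero (0 : E.fib x)).symm rfl
  map_smul' c _ := Subtype.ext <| funext fun A => funext fun x =>
    Prod.ext (smul_zero (A := E.fib x) (algebraMap ℂ A c)).symm rfl

variable {E F}

theorem prodSection_eq_add (s : E.Sections) (t : F.Sections) :
    prodSection s t = sectionInl E F s + sectionInr E F t :=
  Subtype.ext <| funext fun _ => funext fun x =>
    Prod.ext (add_zero (Sections.eval s x)).symm (zero_add (Sections.eval t x)).symm

theorem exists_prodSection (s : (E.directSum F).Sections) : ∃ s₁ s₂, s = prodSection s₁ s₂ :=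
  ⟨⟨fun _ x => (Sections.eval s x).1, fun φ _ _ h => congrArg Prod.fst (s.2 φ h)⟩,
    ⟨fun _ x => (Sections.eval s x).2, fun φ _ _ h => congrArg Prod.snd (s.2 φ h)⟩, rfl⟩

theorem sum_elim_smul {ι κ : Type*} [Fintype ι] [Fintype κ] (g : ι → E.Sections)
    (h : κ → F.Sections) (w : ι ⊕ κ → ℂ) :
    ∑ i, w i • Sum.elim (fun i => sectionInl E F (g i)) (fun k => sectionInr E F (h k)) i =
      prodSection (∑ i, w (Sum.inl i) • g i) (∑ k, w (Sum.inr k) • h k) := by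
  rw [Fintype.sum_sum_type, prodSection_eq_add, map_sum, map_sum]
  simp only [Sum.elim_inl, Sum.elim_inr, map_smul]

end GeneralSections

/-! ### The general zero loci and the converse -/

namespace SnakeDiagram

variable (D : SnakeDiagram 3)

/-- Generators of the space of sections of `Λ(0,1)`. -/
noncomputable def lambdaGenerator (n : ℕ) (p : Fin 10 × Fin (n + 1)) :
    (twistZeroOne D.Λ n).Sections :=
  twistSection (D.constLambda (Pi.single p.1 1)) n p.2

theorem sum_lambdaGenerator {n : ℕ} (w : Fin 10 × Fin (n + 1) → ℂ) :
    ∑ p, w p • D.lambdaGenerator n p = D.lambdaSection fun i j => w (i, j) := rfl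

theorem _root_.FanoBundles.sum_quadMonomial {m n : ℕ} (w : Fin (n + 1) × Fin (n + 1) → ℂ) :
    ∑ q, w q • quadMonomial m n q.1 q.2 = quadSection m fun i j => w (i, j) := rfl

/-- The zero locus of a general section of `Λ(0,1)` is a projective bundle. -/
theorem forGeneral_projBundle :
    ForGeneral (fun s : (twistZeroOne D.Λ 10).Sections =>
      Nonempty (Over.mk (zeroLocusProj s) ≅
        Over.mk (projBundle.proj ((ONegTwo 3).directSum (OZero 3))))) := by
  let F : MvPolynomial (Fin 10 × Fin 11) ℂ :=
    (frameMatrix fun i j => MvPolynomial.X (R := ℂ) (i, j)).det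
  have hF (w) : MvPolynomial.eval w F = (frameMatrix fun i j => w (i, j)).det := by
    rw [map_det_frameMatrix]
    simp only [MvPolynomial.eval_X]
  refine forGeneral_of_span (D.lambdaGenerator 10) (F := F) (fun s => ?_) (fun h0 => ?_)
    fun w hw => ?_
  · obtain ⟨σ, hσ⟩ := D.exists_lambdaSection s
    exact ⟨fun p => σ p.1 p.2, by rw [sum_lambdaGenerator, hσ]⟩
  -- The standard frame has determinant one, so `F` is not the zero polynomial.
  · have := hF fun p => standardFrame 10 p.1 p.2
    rw [h0, map_zero] at this
    change 0 = (frameMatrix (standardFrame 10)).det at this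
    rw [frameMatrix_standardFrame, Matrix.det_one] at this
    exact zero_ne_one this
  · rw [hF] at hw
    rw [sum_lambdaGenerator]
    exact nonempty_iso_of_det_ne_zero D _ hw

/-- The zero locus of a general section of `Λ(0,1) ⊕ O(0,2)` is a double cover branched along a
smooth quartic. -/
theorem forGeneral_doubleCover :
    ForGeneral (fun s : ((twistZeroOne D.Λ 10).directSum (OZeroTwo 3 10)).Sections =>
      ∃ f : ((OTwo 3).tensor (OTwo 3)).Sections, IsSmoothDivisor f ∧
        Nonempty (Over.mk (zeroLocusProj s) ≅ Over.mk (doubleCover.proj (OTwo 3) f))) := by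
  obtain ⟨Q, hQ, hsmooth⟩ := exists_discriminant
  let σ (i : Fin 10) (j : Fin 11) : MvPolynomial ((Fin 10 × Fin 11) ⊕ (Fin 11 × Fin 11)) ℂ :=
    MvPolynomial.X (Sum.inl (i, j))
  let B (j k : Fin 11) : MvPolynomial ((Fin 10 × Fin 11) ⊕ (Fin 11 × Fin 11)) ℂ :=
    MvPolynomial.X (Sum.inr (j, k))
  -- The factors ensure that `σ` extends to a frame, that the quadric is nonzero on the kernel of
  -- `σ`, and that the branch quartic avoids the discriminant.
  let F := (frameMatrix σ).det * kernelValue σ B *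
    MvPolynomial.bind₁ (fun p : Fin 10 × Fin 10 => branchMatrix σ B p.1 p.2) Q
  have hF (w) : MvPolynomial.eval w F =
      (frameMatrix fun i j => w (Sum.inl (i, j))).det *
        kernelValue (fun i j => w (Sum.inl (i, j))) (fun j k => w (Sum.inr (j, k))) *
        MvPolynomial.eval (fun p : Fin 10 × Fin 10 => branchMatrix (fun i j => w (Sum.inl (i, j)))
          (fun j k => w (Sum.inr (j, k))) p.1 p.2) Q := by
    rw [map_mul, map_mul, eval_bind₁, map_det_frameMatrix, map_kernelValue]
    simp only [map_branchMatrix, σ, B, MvPolynomial.eval_X]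
  refine forGeneral_of_span (Sum.elim (fun p => sectionInl _ _ (D.lambdaGenerator 10 p))
    fun q => sectionInr _ _ (quadMonomial 3 10 q.1 q.2)) (F := F) (fun s => ?_) (fun h0 => ?_)
    fun w hw => ?_
  · obtain ⟨s₁, s₂, rfl⟩ := exists_prodSection s
    obtain ⟨σ', rfl⟩ := D.exists_lambdaSection s₁
    obtain ⟨B', rfl⟩ := exists_quadSection s₂
    refine ⟨Sum.elim (fun p => σ' p.1 p.2) fun q => B' q.1 q.2, ?_⟩
    rw [sum_elim_smul, sum_lambdaGenerator, sum_quadMonomial]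
    rfl
  -- `F` is nonzero because a matrix `Γ` off the discriminant is realized by the standard frame and
  -- quadric.
  · obtain ⟨Γ, hΓ⟩ : ∃ Γ, MvPolynomial.eval Γ Q ≠ 0 := by
      by_contra! h
      exact hQ (MvPolynomial.funext fun w => by rw [h w, map_zero])
    have := hF (Sum.elim (fun p => standardFrame 10 p.1 p.2)
      fun q => standardQuadric (fun i k => Γ (i, k)) q.1 q.2)
    simp only [Sum.elim_inl, Sum.elim_inr] at this
    rw [h0, map_zero] at this
    change 0 = (frameMatrix (standardFrame 10)).det * kernelValue (standardFrame 10)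
      (standardQuadric fun i k => Γ (i, k)) * MvPolynomial.eval (fun p : Fin 10 × Fin 10 =>
        branchMatrix (standardFrame 10) (standardQuadric fun i k => Γ (i, k)) p.1 p.2) Q at this
    rw [frameMatrix_standardFrame, Matrix.det_one, kernelValue_standard, branchMatrix_standard,
      one_mul, one_mul] at this
    exact hΓ this.symm
  · rw [hF] at hw
    have h1 := right_ne_zero_of_mul hw
    have h2 := left_ne_zero_of_mul hw
    rw [sum_elim_smul, sum_lambdaGenerator, sum_quadMonomial]
    exact ⟨_, hsmooth _ h1, nonempty_iso_doubleCover_of_ne_zero D _ _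
      (left_ne_zero_of_mul h2) (right_ne_zero_of_mul h2)⟩

/-- Any quartic has a matrix `Γ`, and `Γ` is the branch matrix of the standard quadric, whose
determinant and kernel value are both one. -/
theorem exists_section_iso_doubleCover (f : ((OTwo 3).tensor (OTwo 3)).Sections) :
    ∃ s : ((twistZeroOne D.Λ 10).directSum (OZeroTwo 3 10)).Sections,
      Nonempty (Over.mk (zeroLocusProj s) ≅ Over.mk (doubleCover.proj (OTwo 3) f)) := by
  obtain ⟨Γ, rfl⟩ := exists_quarticSection f
  have h := nonempty_iso_doubleCover_of_ne_zero D (standardFrame 10) (standardQuadric Γ)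
    (by rw [frameMatrix_standardFrame, Matrix.det_one]; exact one_ne_zero)
    (by rw [kernelValue_standard]; exact one_ne_zero)
  rw [branchMatrix_standard] at h
  exact ⟨_, h⟩

end SnakeDiagram

end FanoBundles

open FanoBundles CategoryTheory VecBundle in
theorem lemma4p1 :
    IsShortExact (eulerIncl 3) (eulerProj 3) ∧
    IsShortExact (symIncl 3) (symProj 3) ∧
    Nonempty ((trivV 3).sym2 ≅ trivial (projectiveSpace 3) (Fin 10 → ℂ)) ∧
    Nonempty (SnakeDiagram 3) ∧
    (∀ D D' : SnakeDiagram 3, ∃! φ : D.Λ ≅ D'.Λ,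
      D.b ≫ φ.hom = D'.b ∧ D.j ≫ φ.hom = D'.j ∧ φ.hom ≫ D'.p = D.p) ∧
    ∀ D : SnakeDiagram 3,
      D.Λ.HasRank 9 ∧
      Nonempty (GLLinearization D.Λ) ∧
      (¬ ∃ r : (tautQuot 3).sym2 ⟶ D.Λ, r ≫ D.p = 𝟙 (tautQuot 3).sym2) ∧
      ForGeneral (fun s : (twistZeroOne D.Λ 10).Sections =>
        Nonempty (Over.mk (zeroLocusProj s) ≅
          Over.mk (projBundle.proj ((ONegTwo 3).directSum (OZero 3))))) ∧
      ForGeneral (fun s : ((twistZeroOne D.Λ 10).directSum (OZeroTwo 3 10)).Sections =>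
        ∃ f : ((OTwo 3).tensor (OTwo 3)).Sections, IsSmoothDivisor f ∧
          Nonempty (Over.mk (zeroLocusProj s) ≅ Over.mk (doubleCover.proj (OTwo 3) f))) ∧
      (∀ f : ((OTwo 3).tensor (OTwo 3)).Sections, IsSmoothDivisor f →
        ∃ s : ((twistZeroOne D.Λ 10).directSum (OZeroTwo 3 10)).Sections,
          Nonempty (Over.mk (zeroLocusProj s) ≅ Over.mk (doubleCover.proj (OTwo 3) f))) := by
  exact ⟨euler_isShortExact 3, sym_isShortExact 3, ⟨symTrivialIso⟩, snake_exists 3,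
    SnakeDiagram.existsUnique_iso, fun D => ⟨D.hasRank_nine, ⟨D.linearization⟩, D.not_split,
      D.forGeneral_projBundle, D.forGeneral_doubleCover,
      fun f _ => D.exists_section_iso_doubleCover f⟩⟩
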